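/- **Setting.** Let $\mathbb G$ be a stratified group of step $\iota$, i.e. a connected, simply connected nilpotent Lie group whose Lie algebra splits as $V_1\oplus\dots\oplus V_\iota$ with $V_{j+1}=[V_1,V_j]$ for $j\ge1$, $V_\iota\neq\{0\}$ and $V_{\iota+1}=\{0\}$. Through the exponential map $\mathbb G$ is identified with the vector space of its Lie algebra, $\mathbb G=H_1\oplus\dots\oplus H_\iota$, with the group law given by the Baker–Campbell–Hausdorff formula; $0$ is the unit element, $l_x(z)=xz$ is the left translation, and $\delta_r$ ($r>0$) is the linear map that multiplies $H_j$ by $r^j$. Fix a left invariant Riemannian metric $g$ for which the layers are orthogonal (equivalently, a scalar product on the vector space $\mathbb G$ for which the $H_j$ are orthogonal), a basis $X_1,\dots,X_n$ of the Lie algebra that is orthonormal and adapted to the layers, with $X_i\in V_{d_i}$ and $d_1\le\dots\le d_n$, and a homogeneous distance $d$ on $\mathbb G$, i.e. a continuous distance with $d(zx,zy)=d(x,y)$ and $d(\delta_rx,\delta_ry)=r\,d(x,y)$. Let $B(x,r)$ be its open balls and $\mathbb B=B(0,1)$. For $\alpha=(\alpha_1<\dots<\alpha_p)$ put $X_\alpha=X_{\alpha_1}\wedge\dots\wedge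 X_{\alpha_p}$ and $d(\alpha)=d_{\alpha_1}+\dots+d_{\alpha_p}$, and let $D(p)=\max_\alpha d(\alpha)$. The norm $\|\cdot\|$ on $\Lambda_p\mathbb G$ makes the $X_\alpha$ orthonormal. For a $p$-vector $\tau$ at $x$, write $(\Lambda_p dl_{x^{-1}})(\tau)=\sum_\alpha c_\alpha X_\alpha$ and $(\tau)_{D,x}=\sum_{d(\alpha)=D}c_\alpha X_\alpha$, where $p$-vectors at $x$ and at $0$ are identified by left translation. For a $p$-dimensional (embedded) $C^1$ submanifold $\Sigma\subset\mathbb G$ let $\tau_\Sigma(x)=v_1\wedge\dots\wedge v_p$, where $v_1,\dots,v_p$ is any basis of the tangent space of $\Sigma$ at $x$; the degree of $\Sigma$ at $x$ is the largest $d(\alpha)$ with $c_\alpha\ne0$ for $\tau=\tau_\Sigma(x)$, and $x$ is transversal if this degree equals $D(p)$. Let $\tilde g$ be any smooth Riemannian metric on $\mathbb G$, let $\tilde\mu$ be the Riemannian surface measure that it induces on $\Sigma$, and let $\tau_{\Sigma,\tilde g}(x)=\tau_\Sigma(x)/\|\tau_\Sigma(x)\|_{\tilde g,x}$, where $\|v_1\wedge\dots\wedge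 v_p\|_{\tilde g,x}=\sqrt{\det(\tilde g_x(v_i,v_j))}$. For a nonzero simple $p$-vector $\tau$ with associated subspace $S=\{w\in\mathbb G: w\wedge\tau=0\}$, the metric factor is $\theta^d_g(\tau)=\mathcal H^p_{|\cdot|}(S\cap\mathbb B)$, where $\mathcal H^p_{|\cdot|}$ is the Hausdorff measure of the Euclidean distance given by $g$ on the vector space $\mathbb G$, normalized to be the Lebesgue measure on $p$-planes. **Theorem (Blow-up theorem).** Let $p\ge1$, let $\Sigma\subset\mathbb G$ be a $p$-dimensional $C^1$ submanifold and let $x\in\Sigma$ be transversal. Let $\Pi_\Sigma(x)=\{w\in\mathbb G: w\wedge(\tau_\Sigma(x))_{D(p),x}=0\}$ be the subspace associated to $(\tau_\Sigma(x))_{D(p),x}$. Then $\Pi_\Sigma(x)$ is a $p$-dimensional normal subgroup of $\mathbb G$ that is closed under dilations and has Hausdorff dimension $D(p)$ with respect to $d$; it has the form $Z\oplus H_{\ell+1}\oplus\dots\oplus H_\iota$ for some $\ell$ and some subspace $\{0\}\neq Z\subseteq H_\ell$. For every compact neighbourhood $F$ of $0$, the sets $\delta_{1/r}(x^{-1}\Sigma)$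 converge to $\Pi_\Sigma(x)$ on $F$ as $r\to0^+$, in the following sense: $F\cap\delta_{1/r}(x^{-1}\Sigma)$ is compact for all small $r>0$, $$\sup_{z\in F\cap\delta_{1/r}(x^{-1}\Sigma)}d\big(z,F\cap\Pi_\Sigma(x)\big)\to0,\qquad \sup_{w\in F\cap\Pi_\Sigma(x)}d\big(w,\delta_{1/r}(x^{-1}\Sigma)\big)\to0,$$ and, whenever $F\cap\Pi_\Sigma(x)$ is contained in the closure of $\mathrm{int}(F)\cap\Pi_\Sigma(x)$ (for instance if $F$ is a closed ball of $d$ centred at $0$), $$F\cap\delta_{1/r}(x^{-1}\Sigma)\to F\cap\Pi_\Sigma(x)\quad\text{as } r\to0^+$$ in the Hausdorff distance. Moreover, $$\lim_{r\to0^+}\frac{\tilde\mu\big(\Sigma\cap B(x,r)\big)}{r^{D(p)}}=\frac{\theta^d_g\big((\tau_\Sigma(x))_{D(p),x}\big)}{\big\|\big(\tau_{\Sigma,\tilde g}(x)\big)_{D(p),x}\big\|}.$$ -/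

import Mathlib

open Filter MeasureTheory Set
open scoped Topology ENNReal ContDiff Manifold

noncomputable section

/-! ### The Baker–Campbell–Hausdorff operation -/

/-- Right-nested iterated bracket `[x₁, [x₂, [… , x_m]]]` of a list of vectors. -/
def nestedLie {G : Type*} [AddCommGroup G] [Module ℝ G] (lie : G →ₗ[ℝ] G →ₗ[ℝ] G) :
    List G → G
  | [] => 0
  | [x] => x
  | x :: y :: l => lie x (nestedLie lie (y :: l))

/-- The word `x^{r₁} y^{s₁} ⋯ x^{r_k} y^{s_k}` for `a i = (r_i, s_i)`. -/
def dynkinWord {G : Type*} (x y : G) {k : ℕ} (a : Fin k → ℕ × ℕ) : List G :=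
  (List.ofFn a).flatMap fun q => List.replicate q.1 x ++ List.replicate q.2 y

/-- Exponent pairs `(r, s)` with `r, s ≤ N` and `r + s ≥ 1`. -/
def dynkinPairs (N : ℕ) : Finset (ℕ × ℕ) :=
  (Finset.range (N + 1) ×ˢ Finset.range (N + 1)).filter fun q => 1 ≤ q.1 + q.2

/-- The Baker–Campbell–Hausdorff series `log (exp x exp y)` in Dynkin's form,
`∑_k (-1)^{k-1}/k ∑_{r_i + s_i ≥ 1} (∑_i (r_i + s_i))⁻¹ ∏_i (r_i! s_i!)⁻¹ [x^{r₁} y^{s₁} ⋯ x^{r_k} y^{s_k}]`.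
If `lie` is nilpotent of step at most `N`, all words of length greater than `N` contribute zero,
so that the finite sum below is the whole series. -/
def bch {G : Type*} [AddCommGroup G] [Module ℝ G] (lie : G →ₗ[ℝ] G →ₗ[ℝ] G) (N : ℕ)
    (x y : G) : G :=
  ∑ k ∈ Finset.Icc 1 N, ∑ a ∈ Fintype.piFinset (fun _ : Fin k => dynkinPairs N),
    (((-1 : ℝ) ^ (k - 1) / (k : ℝ)) * (∑ i, ((a i).1 + (a i).2 : ℝ))⁻¹ *
      ∏ i, (((a i).1.factorial : ℝ) * ((a i).2.factorial : ℝ))⁻¹) •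
        nestedLie lie (dynkinWord x y a)

/-! ### Stratified groups -/

/-- A stratified group, seen (through the exponential map) as the vector space underlying its
Lie algebra, with the group operation given by the Baker–Campbell–Hausdorff formula.
The scalar product of `G` is the graded metric `g`: it is a scalar product on the Lie algebra
(hence a left invariant metric on the group) for which the layers are mutually orthogonal. -/
class StratifiedGroup (G : Type*) [NormedAddCommGroup G] [InnerProductSpace ℝ G]
    extends Group G where
  /-- The Lie bracket. -/
  lie : G →ₗ[ℝ] G →ₗ[ℝ] G
  lie_self : ∀ x, lie x x = 0
  jacobi : ∀ x y z, lie x (lie y z) + lie y (lie z x) + lie z (lie x y) = 0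
  /-- The step `ι`. -/
  step : ℕ
  /-- The layers; only the indices `1, …, ι` matter. -/
  layer : ℕ → Submodule ℝ G
  layer_zero : layer 0 = ⊥
  layer_of_gt : ∀ j, step < j → layer j = ⊥
  layer_step : layer step ≠ ⊥
  layer_iSup : ⨆ j, layer j = ⊤
  layer_ortho : ∀ i j, i ≠ j → layer i ⟂ layer j
  /-- `V_{j+1} = [V_1, V_j]`. -/
  layer_succ : ∀ j, 1 ≤ j →
    layer (j + 1) = Submodule.span ℝ {z | ∃ x ∈ layer 1, ∃ y ∈ layer j, lie x y = z}
  mul_eq_bch : ∀ x y : G, x * y = bch lie step x y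

open StratifiedGroup

/-- The dilations `δ_r`: multiplication by `r ^ j` on the layer `j`. -/
def dilation {G : Type*} [NormedAddCommGroup G] [InnerProductSpace ℝ G] [FiniteDimensional ℝ G]
    [StratifiedGroup G] (r : ℝ) (x : G) : G :=
  ∑ j ∈ Finset.Icc 1 (step G), r ^ j • (layer (G := G) j).starProjection x

/-- A homogeneous distance: a continuous, left invariant distance that is compatible with
dilations. -/
structure HomogeneousDistance (G : Type*) [NormedAddCommGroup G] [InnerProductSpace ℝ G]
    [FiniteDimensional ℝ G] [StratifiedGroup G] where
  d : G → G → ℝ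
  continuous_d : Continuous fun q : G × G => d q.1 q.2
  eq_zero_iff : ∀ x y, d x y = 0 ↔ x = y
  symm : ∀ x y, d x y = d y x
  triangle : ∀ x y z, d x z ≤ d x y + d y z
  left_inv : ∀ x y z, d (z * x) (z * y) = d x y
  homogeneous : ∀ r : ℝ, 0 < r → ∀ x y, d (dilation r x) (dilation r y) = r * d x y

namespace HomogeneousDistance

variable {G : Type*} [NormedAddCommGroup G] [InnerProductSpace ℝ G] [FiniteDimensional ℝ G]
  [StratifiedGroup G]

/-- The metric space `(G, d)`. -/
abbrev metricSpace (ρ : HomogeneousDistance G) : MetricSpace G where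
  dist := ρ.d
  dist_self x := (ρ.eq_zero_iff x x).2 rfl
  dist_comm := ρ.symm
  dist_triangle := ρ.triangle
  eq_of_dist_eq_zero {x y} h := (ρ.eq_zero_iff x y).1 h

/-- The open ball `B(x, r)` of the homogeneous distance. -/
def ball (ρ : HomogeneousDistance G) (x : G) (r : ℝ) : Set G := {y | ρ.d x y < r}

/-- The Hausdorff distance between subsets of `(G, d)`. -/
def hausdorffEDist (ρ : HomogeneousDistance G) (A B : Set G) : ℝ≥0∞ :=
  letI := ρ.metricSpace
  Metric.hausdorffEDist A B

/-- The Hausdorff dimension of a subset of `(G, d)`. -/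
def dimH (ρ : HomogeneousDistance G) (A : Set G) : ℝ≥0∞ :=
  letI := ρ.metricSpace
  _root_.dimH A

end HomogeneousDistance

/-! ### Graded bases, degrees of multi-indices, multivectors -/

/-- A graded basis: an orthonormal basis adapted to the stratification, with the degrees
`d_1 ≤ … ≤ d_n` of its elements. -/
structure GradedBasis (G : Type*) [NormedAddCommGroup G] [InnerProductSpace ℝ G]
    [StratifiedGroup G] (n : ℕ) where
  X : OrthonormalBasis (Fin n) ℝ G
  deg : Fin n → ℕ
  deg_mono : Monotone deg
  mem_layer : ∀ i, X i ∈ layer (G := G) (deg i)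

namespace GradedBasis

variable {G : Type*} [NormedAddCommGroup G] [InnerProductSpace ℝ G] [StratifiedGroup G] {n : ℕ}

/-- `d(α)`, for a multi-index `α_1 < … < α_p` given by the set of its entries. -/
def multiDeg (b : GradedBasis G n) {p : ℕ} (α : Set.powersetCard (Fin n) p) : ℕ :=
  ∑ i ∈ (α : Finset (Fin n)), b.deg i

/-- The maximal dimension `D(p)`. -/
def maxDim (b : GradedBasis G n) (p : ℕ) : ℕ :=
  Finset.univ.sup fun α : Set.powersetCard (Fin n) p => b.multiDeg α

/-- The coordinate `c_α` of the `p`-vector `∑ c_α X_α`. -/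
def coord (b : GradedBasis G n) {p : ℕ} (τ : ⋀[ℝ]^p G) (α : Set.powersetCard (Fin n) p) : ℝ :=
  (b.X.toBasis.exteriorPower p).repr τ α

/-- The norm on `p`-vectors induced by the graded metric (the `X_α` are orthonormal). -/
def pnorm (b : GradedBasis G n) {p : ℕ} (τ : ⋀[ℝ]^p G) : ℝ :=
  Real.sqrt (∑ α, b.coord τ α ^ 2)

/-- The projection `π_D` onto the homogeneous `p`-vectors of degree `D`,
which are spanned by the `X_α` with `d(α) = D`. -/
def proj (b : GradedBasis G n) {p : ℕ} (D : ℕ) (τ : ⋀[ℝ]^p G) : ⋀[ℝ]^p G :=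
  ∑ α with b.multiDeg α = D, b.coord τ α • b.X.toBasis.exteriorPower p α

end GradedBasis

/-- The linear subspace `{w | w ∧ τ = 0}`; if `τ = ζ_1 ∧ ⋯ ∧ ζ_p ≠ 0` is simple, this is the
span of `ζ_1, …, ζ_p`. -/
def assocSubspace {G : Type*} [AddCommGroup G] [Module ℝ G] {p : ℕ} (τ : ⋀[ℝ]^p G) :
    Submodule ℝ G :=
  LinearMap.ker
    ((LinearMap.mulRight ℝ (τ : ExteriorAlgebra ℝ G)).comp (ExteriorAlgebra.ι ℝ))

/-- The metric factor `θ(τ) = H^p(S ∩ 𝔹)`, where `S` is the subspace associated to `τ`, `𝔹` is the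
open unit ball of the homogeneous distance, and `H^p` is the Euclidean Hausdorff measure of the
scalar product of `G`, normalized so that it is the Lebesgue measure on `p`-planes. -/
def metricFactor {G : Type*} [NormedAddCommGroup G] [InnerProductSpace ℝ G]
    [FiniteDimensional ℝ G] [StratifiedGroup G] [MeasurableSpace G] [BorelSpace G]
    (ρ : HomogeneousDistance G) {p : ℕ} (τ : ⋀[ℝ]^p G) : ℝ≥0∞ :=
  (Measure.euclideanHausdorffMeasure p : Measure G) ((assocSubspace τ : Set G) ∩ ρ.ball 0 1)

/-! ### Submanifolds -/

/-- `Φ : A → M` is a `C¹` local parametrization of the set `M`: a `C¹` immersion of an open set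
`A ⊆ ℝ^p` that is a homeomorphism onto a relatively open subset of `M`. -/
structure IsC1Param {G : Type*} [NormedAddCommGroup G] [NormedSpace ℝ G] {p : ℕ} (M : Set G)
    (A : Set (EuclideanSpace ℝ (Fin p))) (Φ : EuclideanSpace ℝ (Fin p) → G) : Prop where
  isOpen : IsOpen A
  contDiffOn : ContDiffOn ℝ 1 Φ A
  immersion : ∀ t ∈ A, Function.Injective (fderiv ℝ Φ t)
  isEmbedding : Topology.IsEmbedding (A.domRestrict Φ)
  image_eq : ∃ U : Set G, IsOpen U ∧ Φ '' A = M ∩ U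

/-- `M` is a `p`-dimensional (embedded) `C¹` submanifold of `G`. -/
def IsC1Submanifold {G : Type*} [NormedAddCommGroup G] [NormedSpace ℝ G] (p : ℕ)
    (M : Set G) : Prop :=
  ∀ y ∈ M, ∃ (A : Set (EuclideanSpace ℝ (Fin p))) (Φ : EuclideanSpace ℝ (Fin p) → G),
    IsC1Param M A Φ ∧ y ∈ Φ '' A

/-- The Euclidean tangent cone of `M` at `x`. -/
def tangentCone {G : Type*} [NormedAddCommGroup G] [NormedSpace ℝ G] (M : Set G) (x : G) :
    Set G :=
  {w | ∃ (t : ℝ) (v : G) (u : ℕ → G), 0 ≤ t ∧ w = t • v ∧ (∀ i, u i ∈ M ∧ u i ≠ x) ∧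
    Tendsto u atTop (𝓝 x) ∧ Tendsto (fun i => ‖u i - x‖⁻¹ • (u i - x)) atTop (𝓝 v)}

/-- `v_1, …, v_p` is a basis of the tangent space of `M` at `x`, so that `v_1 ∧ ⋯ ∧ v_p` is a
tangent `p`-vector of `M` at `x`. -/
def IsTangentFrame {G : Type*} [NormedAddCommGroup G] [NormedSpace ℝ G] {p : ℕ} (M : Set G)
    (x : G) (v : Fin p → G) : Prop :=
  LinearIndependent ℝ v ∧ (Submodule.span ℝ (range v) : Set G) = tangentCone M x

/-- The `p`-vector `v_1 ∧ ⋯ ∧ v_p` at `x`, left translated to the origin: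
`(Λ_p dl_{x⁻¹}) (v_1 ∧ ⋯ ∧ v_p)`. -/
def translatedPVector {G : Type*} [NormedAddCommGroup G] [InnerProductSpace ℝ G]
    [StratifiedGroup G] {p : ℕ} (x : G) (v : Fin p → G) : ⋀[ℝ]^p G :=
  exteriorPower.ιMulti ℝ p fun i => fderiv ℝ (fun y : G => x⁻¹ * y) x (v i)

/-- The degree `d_M(x)`: the largest `d(α)` such that the left invariant `p`-vector field `X_α`
occurs in a tangent `p`-vector `∑ c_α X_α(x)` of `M` at `x`. -/
def pointDegree {G : Type*} [NormedAddCommGroup G] [InnerProductSpace ℝ G]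
    [StratifiedGroup G] {n : ℕ} (b : GradedBasis G n) (p : ℕ) (M : Set G) (x : G) : ℕ :=
  sSup {N | ∃ (v : Fin p → G) (α : Set.powersetCard (Fin n) p), IsTangentFrame M x v ∧
    b.coord (translatedPVector x v) α ≠ 0 ∧ N = b.multiDeg α}

/-- `x` is a transversal point of the `p`-dimensional submanifold `M`. -/
def IsTransversal {G : Type*} [NormedAddCommGroup G] [InnerProductSpace ℝ G]
    [StratifiedGroup G] {n : ℕ} (b : GradedBasis G n) (p : ℕ) (M : Set G) (x : G) : Prop :=
  pointDegree b p M x = b.maxDim p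

/-! ### Auxiliary Riemannian metric and surface measure -/

/-- A smooth Riemannian metric on the manifold `G`. -/
abbrev SmoothRiemannianMetric (G : Type*) [NormedAddCommGroup G] [NormedSpace ℝ G] :=
  Bundle.ContMDiffRiemannianMetric 𝓘(ℝ, G) ∞ G (fun x : G => TangentSpace 𝓘(ℝ, G) x)

/-- `‖v_1 ∧ ⋯ ∧ v_p‖_{g̃,x}`, the square root of the Gram determinant. -/
def riemNorm {G : Type*} [NormedAddCommGroup G] [NormedSpace ℝ G]
    (gt : SmoothRiemannianMetric G) (x : G) {p : ℕ} (v : Fin p → G) : ℝ :=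
  Real.sqrt (Matrix.det (Matrix.of fun i j : Fin p => (gt.inner x (v i) (v j) : ℝ)))

/-- The surface measure carried by one parametrization: the image under `Φ` of
`‖∂_1Φ ∧ ⋯ ∧ ∂_pΦ‖_{g̃} dt` on `A`. -/
def paramMeasure {G : Type*} [NormedAddCommGroup G] [NormedSpace ℝ G] [MeasurableSpace G]
    (gt : SmoothRiemannianMetric G) {p : ℕ}
    (A : Set (EuclideanSpace ℝ (Fin p))) (Φ : EuclideanSpace ℝ (Fin p) → G) : Measure G :=
  Measure.map Φ ((volume.restrict A).withDensity fun t => ENNReal.ofReal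
    (riemNorm gt (Φ t) fun i => fderiv ℝ Φ t (EuclideanSpace.single i 1)))

/-- The Riemannian surface measure of the `p`-dimensional `C¹` submanifold `M`. The measures
carried by the local parametrizations agree on overlaps, and the surface measure is the measure
obtained by gluing them, that is their least upper bound among measures. -/
def surfaceMeasure {G : Type*} [NormedAddCommGroup G] [NormedSpace ℝ G] [MeasurableSpace G]
    (gt : SmoothRiemannianMetric G) (p : ℕ) (M : Set G) : Measure G :=
  ⨆ (A : Set (EuclideanSpace ℝ (Fin p))) (Φ : EuclideanSpace ℝ (Fin p) → G)
    (_ : IsC1Param M A Φ), paramMeasure gt A Φ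

/-! ### Blow-ups -/

/-- The dilated translate `δ_{1/r}(x⁻¹ M)`. -/
def blowUp {G : Type*} [NormedAddCommGroup G] [InnerProductSpace ℝ G] [FiniteDimensional ℝ G]
    [StratifiedGroup G] (M : Set G) (x : G) (r : ℝ) : Set G :=
  (fun y => dilation (1 / r) (x⁻¹ * y)) '' M

/-- `Π_M(x)`, the subspace of `G` associated to the part `(τ_M(x))_{D(p),x}` of top degree of the
tangent `p`-vector `τ_M(x) = v_1 ∧ ⋯ ∧ v_p`. -/
def blowUpSubspace {G : Type*} [NormedAddCommGroup G] [InnerProductSpace ℝ G]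
    [StratifiedGroup G] {n : ℕ} (b : GradedBasis G n) {p : ℕ} (x : G) (v : Fin p → G) :
    Submodule ℝ G :=
  assocSubspace (b.proj (b.maxDim p) (translatedPVector x v))

/-- The unit tangent `p`-vector `τ_{M,g̃}(x)`, left translated to the origin. -/
def unitTangent {G : Type*} [NormedAddCommGroup G] [InnerProductSpace ℝ G]
    [StratifiedGroup G] (gt : SmoothRiemannianMetric G) {p : ℕ} (x : G) (v : Fin p → G) :
    ⋀[ℝ]^p G :=
  (riemNorm gt x v)⁻¹ • translatedPVector x v

end

/-!
Left translation turns `x` into the origin. The tangent `p`-vector at a transversal point has a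
nonzero coordinate along some `X_α` of maximal degree `D(p)`, so near the origin the translated
submanifold is a graph over the coordinates of index in `α`. By an exchange argument, maximality
means that no `X_k` with `k` outside `α` has larger degree than some `X_{α_i}`. Hence the graph,
rescaled by `δ_{1/r}`, converges uniformly on bounded sets to a linear parametrization, whose
columns are the components of the tangent vectors in the layers of the `X_{α_i}` and have wedge
product `(τ_Σ(x))_{D(p),x}`. The same exchange argument shows that the span of these columns
contains all layers above the lowest one that it meets, so it is an ideal and therefore a normal
subgroup.

The limit of the rescaled measures follows from the area formula in the dilated graph coordinates by
dominated convergence, because homogeneous spheres meet the limit plane in a null set. Finally, the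
Lebesgue measure on the limit plane is invariant under its left translations and homogeneous of
degree `D(p)` under dilations, which gives the Hausdorff dimension.
-/

open StratifiedGroup

/-! ### The Baker–Campbell–Hausdorff operation -/

section DynkinWord

variable {H : Type*} {k : ℕ}

theorem dynkinWord_map {K : Type*} (f : H → K) (x y : H) (a : Fin k → ℕ × ℕ) :
    dynkinWord (f x) (f y) a = (dynkinWord x y a).map f := by
  simp [dynkinWord, List.map_flatMap]

theorem eq_or_eq_of_mem_dynkinWord {x y z : H} {a : Fin k → ℕ × ℕ}
    (h : z ∈ dynkinWord x y a) : z = x ∨ z = y := by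
  simp only [dynkinWord, List.mem_flatMap, List.mem_append, List.mem_replicate] at h
  tauto

theorem length_dynkinWord (x y : H) (a : Fin k → ℕ × ℕ) :
    (dynkinWord x y a).length = ∑ i, ((a i).1 + (a i).2) := by
  simp [dynkinWord, List.length_flatMap, List.map_ofFn, List.sum_ofFn, Function.comp_def]

theorem le_length_dynkinWord (x y : H) {N : ℕ} {a : Fin k → ℕ × ℕ}
    (ha : a ∈ Fintype.piFinset fun _ => dynkinPairs N) : k ≤ (dynkinWord x y a).length := by
  have one_le (i : Fin k) : 1 ≤ (a i).1 + (a i).2 :=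
    (Finset.mem_filter.1 (Fintype.mem_piFinset.1 ha i)).2
  simpa [length_dynkinWord] using Finset.sum_le_sum fun i (_ : i ∈ Finset.univ) => one_le i

end DynkinWord

section Bch

variable {G : Type*} [AddCommGroup G] [Module ℝ G] {lie : G →ₗ[ℝ] G →ₗ[ℝ] G}

theorem nestedLie_map {f : G →ₗ[ℝ] G} (hf : ∀ x y, f (lie x y) = lie (f x) (f y)) :
    ∀ l : List G, f (nestedLie lie l) = nestedLie lie (l.map f)
  | [] => map_zero f
  | [_] => rfl
  | x :: y :: l => (hf _ _).trans (congrArg (lie (f x)) (nestedLie_map hf (y :: l)))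

theorem bch_map {f : G →ₗ[ℝ] G} (hf : ∀ x y, f (lie x y) = lie (f x) (f y)) (N : ℕ) (x y : G) :
    f (bch lie N x y) = bch lie N (f x) (f y) := by
  simp only [bch, map_sum, map_smul, nestedLie_map hf, dynkinWord_map]

theorem nestedLie_sub_nestedLie_mem {I : Submodule ℝ G} (hr : ∀ x, ∀ y ∈ I, lie x y ∈ I)
    (hl : ∀ x ∈ I, ∀ y, lie x y ∈ I) :
    ∀ l : List (G × G), (∀ q ∈ l, q.1 - q.2 ∈ I) →
      nestedLie lie (l.map Prod.fst) - nestedLie lie (l.map Prod.snd) ∈ I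
  | [], _ => by simp [nestedLie]
  | [q], h => h q List.mem_cons_self
  | q :: q' :: l, h => by
    have ih := nestedLie_sub_nestedLie_mem hr hl (q' :: l) fun u hu =>
      h u (List.mem_cons_of_mem _ hu)
    have hq := hl _ (h q List.mem_cons_self) (nestedLie lie ((q' :: l).map Prod.snd))
    have h := I.add_mem (hr q.1 _ ih) hq
    rw [map_sub, map_sub, LinearMap.sub_apply, sub_add_sub_cancel] at h
    exact h

theorem bch_sub_bch_mem {I : Submodule ℝ G} (hr : ∀ x, ∀ y ∈ I, lie x y ∈ I)
    (hl : ∀ x ∈ I, ∀ y, lie x y ∈ I) (N : ℕ) {x x' y y' : G} (hx : x - x' ∈ I)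
    (hy : y - y' ∈ I) : bch lie N x y - bch lie N x' y' ∈ I := by
  simp only [bch, ← Finset.sum_sub_distrib, ← smul_sub]
  refine I.sum_mem fun k _ => I.sum_mem fun a _ => I.smul_mem _ ?_
  have h := nestedLie_sub_nestedLie_mem hr hl (dynkinWord (x, x') (y, y') a) fun q hq => by
    rcases eq_or_eq_of_mem_dynkinWord hq with rfl | rfl
    exacts [hx, hy]
  simpa only [← dynkinWord_map] using h

theorem nestedLie_eq_zero_of_collinear (h : ∀ x, lie x x = 0) (z : G) :
    ∀ l : List G, (∀ x ∈ l, ∃ c : ℝ, x = c • z) → l.length ≠ 1 → nestedLie lie l = 0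
  | [], _, _ => rfl
  | [_], _, h1 => absurd rfl h1
  | [x, y], hl, _ => by
    obtain ⟨c, rfl⟩ := hl x (by simp)
    obtain ⟨c', rfl⟩ := hl y (by simp)
    simp [nestedLie, h]
  | x :: y :: w :: l, hl, _ => by
    have ih := nestedLie_eq_zero_of_collinear h z (y :: w :: l)
      (fun u hu => hl u (List.mem_cons_of_mem _ hu)) (by simp)
    rw [nestedLie, ih, map_zero]

theorem nestedLie_dynkinWord_smul_smul (h : ∀ x, lie x x = 0) (z : G) (c c' : ℝ) {k : ℕ}
    {a : Fin k → ℕ × ℕ} (ha : (dynkinWord (c • z) (c' • z) a).length ≠ 1) :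
    nestedLie lie (dynkinWord (c • z) (c' • z) a) = 0 := by
  refine nestedLie_eq_zero_of_collinear h z _ (fun x hx => ?_) ha
  rcases eq_or_eq_of_mem_dynkinWord hx with rfl | rfl
  exacts [⟨c, rfl⟩, ⟨c', rfl⟩]

theorem bch_smul_smul (h : ∀ x, lie x x = 0) {N : ℕ} (hN : 1 ≤ N) (z : G) (c c' : ℝ) :
    bch lie N (c • z) (c' • z) = (c + c') • z := by
  have one_ne : (fun _ : Fin 1 => ((1, 0) : ℕ × ℕ)) ≠ fun _ => (0, 1) := fun h => by
    simpa using congrFun h 0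
  have words_subset : ({fun _ => (1, 0), fun _ => (0, 1)} : Finset (Fin 1 → ℕ × ℕ)) ⊆
      Fintype.piFinset fun _ => dynkinPairs N := by
    simpa [Finset.insert_subset_iff, dynkinPairs] using Nat.lt_of_lt_of_le one_pos hN
  rw [bch, Finset.sum_eq_single_of_mem 1 (by simpa using hN)]
  · rw [← Finset.sum_subset words_subset]
    · rw [Finset.sum_pair one_ne]
      simp [dynkinWord, nestedLie, add_smul]
    · intro a _ ha
      rw [nestedLie_dynkinWord_smul_smul h, smul_zero]
      contrapose! ha
      simp only [length_dynkinWord, Fin.sum_univ_one] at ha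
      simp only [Finset.mem_insert, Finset.mem_singleton, funext_iff, Fin.forall_fin_one,
        Prod.ext_iff]
      omega
  · intro k hk hk1
    refine Finset.sum_eq_zero fun a ha => ?_
    have two_le : 2 ≤ (dynkinWord (c • z) (c' • z) a).length :=
      le_trans (by have := (Finset.mem_Icc.1 hk).1; omega) (le_length_dynkinWord _ _ ha)
    rw [nestedLie_dynkinWord_smul_smul h z c c' (by omega), smul_zero]

end Bch

section Smooth

variable {G : Type*} [NormedAddCommGroup G] [NormedSpace ℝ G] [FiniteDimensional ℝ G]
  (lie : G →ₗ[ℝ] G →ₗ[ℝ] G) {m : WithTop ℕ∞}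

theorem contDiff_nestedLie {H : Type*} [NormedAddCommGroup H] [NormedSpace ℝ H] :
    ∀ l : List (H → G), (∀ f ∈ l, ContDiff ℝ m f) →
      ContDiff ℝ m fun q => nestedLie lie (l.map fun f => f q)
  | [], _ => contDiff_const
  | [f], h => h f List.mem_cons_self
  | f :: g :: l, h =>
    (lie.toContinuousBilinearMap.contDiff.comp (h f List.mem_cons_self)).clm_apply
      (contDiff_nestedLie (g :: l) fun u hu => h u (List.mem_cons_of_mem _ hu))

theorem contDiff_bch (N : ℕ) : ContDiff ℝ m fun q : G × G => bch lie N q.1 q.2 := by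
  refine ContDiff.sum fun k _ => ContDiff.sum fun a _ => ContDiff.const_smul _ ?_
  have h := contDiff_nestedLie (m := m) lie (dynkinWord (Prod.fst : G × G → G) Prod.snd a)
    fun f hf => by
      rcases eq_or_eq_of_mem_dynkinWord hf with rfl | rfl
      exacts [contDiff_fst, contDiff_snd]
  simpa only [← dynkinWord_map] using h

end Smooth

/-! ### Stratified groups and dilations -/

namespace StratifiedGroup

variable {G : Type*} [NormedAddCommGroup G] [InnerProductSpace ℝ G] [StratifiedGroup G]

theorem one_le_step : 1 ≤ step G := by
  by_contra! h
  exact layer_step (G := G) (by rw [Nat.lt_one_iff.1 h, layer_zero])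

theorem lie_skew (x y : G) : lie x y = -lie y x := by
  have h := lie_self (x + y)
  simp only [map_add, LinearMap.add_apply, lie_self, zero_add, add_zero] at h
  exact eq_neg_of_add_eq_zero_right h

theorem lie_lie (x y z : G) : lie (lie x y) z = lie x (lie y z) - lie y (lie x z) := by
  rw [lie_skew (lie x y) z, lie_skew x z, map_neg, sub_neg_eq_add]
  exact neg_eq_of_add_eq_zero_left (jacobi x y z)

theorem lie_mem_layer_succ {j : ℕ} {x y : G} (hx : x ∈ layer (G := G) 1)
    (hy : y ∈ layer (G := G) j) : lie x y ∈ layer (G := G) (j + 1) := by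
  rcases j.eq_zero_or_pos with rfl | hj
  · rw [layer_zero, Submodule.mem_bot] at hy
    simp [hy]
  · rw [layer_succ j hj]
    exact Submodule.subset_span ⟨x, hx, y, hy, rfl⟩

theorem lie_mem_layer {i j : ℕ} {x y : G} (hx : x ∈ layer (G := G) i)
    (hy : y ∈ layer (G := G) j) : lie x y ∈ layer (G := G) (i + j) := by
  rcases i.eq_zero_or_pos with rfl | hi
  · rw [layer_zero, Submodule.mem_bot] at hx
    simp [hx]
  induction i, hi using Nat.le_induction generalizing j x y with
  | base => exact add_comm j 1 ▸ lie_mem_layer_succ hx hy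
  | succ i hi ih =>
    rw [layer_succ i hi] at hx
    induction hx using Submodule.span_induction with
    | zero => simp
    | add u v _ _ hu hv => simpa using Submodule.add_mem _ hu hv
    | smul c u _ hu => simpa using Submodule.smul_mem _ c hu
    | mem u hu =>
      obtain ⟨a, ha, z, hz, rfl⟩ := hu
      have first : lie a (lie z y) ∈ layer (G := G) (i + 1 + j) := by
        convert lie_mem_layer_succ ha (ih hz hy) using 2; ring
      have second : lie z (lie a y) ∈ layer (G := G) (i + 1 + j) := by
        convert ih hz (lie_mem_layer_succ ha hy) using 2; ring
      exact lie_lie a z y ▸ Submodule.sub_mem _ first second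

theorem linearMap_ext {F : Type*} [AddCommGroup F] [Module ℝ F] {f g : G →ₗ[ℝ] F}
    (h : ∀ j, ∀ x ∈ layer (G := G) j, f x = g x) : f = g := by
  have layers_le : ⨆ j, layer (G := G) j ≤ LinearMap.eqLocus f g := iSup_le fun j x hx => h j x hx
  exact LinearMap.ext fun x => layers_le (layer_iSup (G := G) ▸ Submodule.mem_top)

theorem one_eq_zero : (1 : G) = 0 := by
  have h : (1 : G) * 0 = 1 := by
    rw [mul_eq_bch]
    simpa using bch_smul_smul (lie := lie (G := G)) lie_self one_le_step 1 1 0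
  simpa using h.symm

theorem mul_zero_eq_self (x : G) : x * 0 = x := by rw [← one_eq_zero, mul_one]

theorem zero_mul_eq_self (x : G) : 0 * x = x := by rw [← one_eq_zero, one_mul]

theorem inv_mul_self_eq_zero (x : G) : x⁻¹ * x = 0 := by rw [inv_mul_cancel, one_eq_zero]

theorem inv_eq_neg (x : G) : x⁻¹ = -x := by
  refine inv_eq_of_mul_eq_one_right ?_
  rw [mul_eq_bch, one_eq_zero]
  simpa using bch_smul_smul (lie := lie (G := G)) lie_self one_le_step x 1 (-1)

section Ideal

variable {I : Submodule ℝ G} (hI : ∀ x, ∀ y ∈ I, lie x y ∈ I)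
include hI

theorem mul_sub_mul_mem {x x' y y' : G} (hx : x - x' ∈ I) (hy : y - y' ∈ I) :
    x * y - x' * y' ∈ I := by
  rw [mul_eq_bch, mul_eq_bch]
  exact bch_sub_bch_mem hI (fun x hx y => lie_skew x y ▸ I.neg_mem (hI _ _ hx)) _ hx hy

theorem mul_mem_of_lie_mem {x y : G} (hx : x ∈ I) (hy : y ∈ I) : x * y ∈ I := by
  simpa [zero_mul_eq_self] using
    mul_sub_mul_mem hI (x' := 0) (y' := 0) (by simpa using hx) (by simpa using hy)

theorem conj_mem_of_lie_mem {y : G} (hy : y ∈ I) (x : G) : x * y * x⁻¹ ∈ I := by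
  have h : x * y - x * 0 ∈ I := mul_sub_mul_mem hI (by simp) (by simpa using hy)
  simpa [mul_zero_eq_self, one_eq_zero] using mul_sub_mul_mem hI (y := x⁻¹) (y' := x⁻¹) h (by simp)

theorem exists_normal_subgroup_coe_eq : ∃ P : Subgroup G, P.Normal ∧ (P : Set G) = I := by
  let P : Subgroup G :=
    { carrier := I
      mul_mem' := mul_mem_of_lie_mem hI
      one_mem' := one_eq_zero (G := G) ▸ I.zero_mem
      inv_mem' := fun {x} hx => inv_eq_neg x ▸ I.neg_mem hx }
  exact ⟨P, ⟨fun _ => conj_mem_of_lie_mem hI⟩, rfl⟩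

end Ideal

section FiniteDimensional

variable [FiniteDimensional ℝ G] {m : WithTop ℕ∞}

theorem contDiff_mul : ContDiff ℝ m fun q : G × G => q.1 * q.2 := by
  simp only [mul_eq_bch]
  exact contDiff_bch _ _

theorem contDiff_mul_left (x : G) : ContDiff ℝ m fun y : G => x * y :=
  contDiff_mul.comp (contDiff_const.prodMk contDiff_id)

theorem hasFDerivAt_mul_left (x y : G) :
    HasFDerivAt (fun y : G => x * y) (fderiv ℝ (fun y : G => x * y) y) y :=
  ((contDiff_mul_left (m := 1) x).differentiable one_ne_zero y).hasFDerivAt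

theorem fderiv_mul_left_comp_fderiv_inv_mul (x : G) :
    (fderiv ℝ (fun y : G => x * y) 0).comp (fderiv ℝ (fun y : G => x⁻¹ * y) x) =
      ContinuousLinearMap.id ℝ G := by
  have hasFDerivAt_comp :=
    (hasFDerivAt_mul_left x (x⁻¹ * x)).comp x (hasFDerivAt_mul_left x⁻¹ x)
  rw [inv_mul_self_eq_zero] at hasFDerivAt_comp
  have comp_eq_id : (fun y : G => x * y) ∘ (fun y : G => x⁻¹ * y) = id := by ext y; simp
  exact (comp_eq_id ▸ hasFDerivAt_comp).unique (hasFDerivAt_id x)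

theorem injective_fderiv_inv_mul (x : G) :
    Function.Injective (fderiv ℝ (fun y : G => x⁻¹ * y) x) :=
  Function.LeftInverse.injective (g := fderiv ℝ (fun y : G => x * y) 0)
    (DFunLike.congr_fun (fderiv_mul_left_comp_fderiv_inv_mul x))

end FiniteDimensional

end StratifiedGroup

section Dilation

variable {G : Type*} [NormedAddCommGroup G] [InnerProductSpace ℝ G] [FiniteDimensional ℝ G]
  [StratifiedGroup G]

/-- The dilation `δ_r` as a linear map. -/
noncomputable def dilationLinear (r : ℝ) : G →ₗ[ℝ] G where
  toFun := dilation r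
  map_add' x y := by simp [dilation, Finset.sum_add_distrib]
  map_smul' c x := by simp [dilation, Finset.smul_sum, smul_comm c]

@[simp] theorem dilationLinear_apply (r : ℝ) (x : G) : dilationLinear r x = dilation r x := rfl

@[simp] theorem dilation_zero_right (r : ℝ) : dilation r (0 : G) = 0 :=
  (dilationLinear r).map_zero

theorem continuous_dilation : Continuous fun q : ℝ × G => dilation q.1 q.2 := by
  unfold dilation
  fun_prop

theorem continuous_dilation_right (r : ℝ) : Continuous (dilation (G := G) r) :=
  continuous_dilation.comp (by fun_prop : Continuous fun x : G => (r, x))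

theorem dilation_of_mem_layer (r : ℝ) {j : ℕ} {x : G} (hx : x ∈ layer (G := G) j) :
    dilation r x = r ^ j • x := by
  rw [dilation, Finset.sum_eq_single j]
  · rw [Submodule.starProjection_eq_self_iff.2 hx]
  · intro i _ hij
    rw [(Submodule.starProjection_apply_eq_zero_iff _).2 (layer_ortho i j hij |>.symm hx),
      smul_zero]
  · intro hj
    have layer_eq_bot : layer (G := G) j = ⊥ := by
      rcases j.eq_zero_or_pos with rfl | hj0
      · exact layer_zero
      · exact layer_of_gt j (by simpa [Nat.one_le_iff_ne_zero, hj0.ne'] using hj)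
    rw [layer_eq_bot, Submodule.mem_bot] at hx
    simp [hx]

theorem dilation_dilation (r s : ℝ) (x : G) : dilation r (dilation s x) = dilation (r * s) x := by
  have h : dilationLinear r ∘ₗ dilationLinear s = dilationLinear (G := G) (r * s) :=
    linearMap_ext fun j x hx => by
      simp [dilation_of_mem_layer _ hx, smul_smul, mul_pow, mul_comm (s ^ j)]
  exact DFunLike.congr_fun h x

theorem dilation_one (x : G) : dilation 1 x = x := by
  have h : dilationLinear (G := G) 1 = LinearMap.id :=
    linearMap_ext fun j x hx => by simp [dilation_of_mem_layer _ hx]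
  exact DFunLike.congr_fun h x

theorem dilation_zero_left (x : G) : dilation 0 x = 0 :=
  Finset.sum_eq_zero fun j hj => by
    rw [zero_pow (Nat.one_le_iff_ne_zero.1 (Finset.mem_Icc.1 hj).1), zero_smul]

theorem dilation_dilation_one_div {r : ℝ} (hr : r ≠ 0) (x : G) :
    dilation r (dilation (1 / r) x) = x := by
  rw [dilation_dilation, mul_one_div_cancel hr, dilation_one]

theorem dilation_one_div_dilation {r : ℝ} (hr : r ≠ 0) (x : G) :
    dilation (1 / r) (dilation r x) = x := by
  rw [dilation_dilation, one_div_mul_cancel hr, dilation_one]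

theorem dilation_lie (r : ℝ) (x y : G) :
    dilation r (lie x y) = lie (dilation r x) (dilation r y) := by
  have h : (lie (G := G)).compr₂ (dilationLinear r) =
      (lie (G := G)).compl₁₂ (dilationLinear r) (dilationLinear r) :=
    linearMap_ext fun i x hx => linearMap_ext fun j y hy => by
      simp [dilation_of_mem_layer r (lie_mem_layer hx hy), dilation_of_mem_layer r hx,
        dilation_of_mem_layer r hy, smul_smul, pow_add,
        mul_comm (r ^ i)]
  exact DFunLike.congr_fun (DFunLike.congr_fun h x) y

theorem dilation_mul (r : ℝ) (x y : G) : dilation r (x * y) = dilation r x * dilation r y := by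
  rw [mul_eq_bch, mul_eq_bch]
  exact bch_map (f := dilationLinear r) (dilation_lie r) _ x y

theorem norm_dilation_sq (r : ℝ) (x : G) :
    ‖dilation r x‖ ^ 2 =
      ∑ j ∈ Finset.Icc 1 (step G), (|r| ^ j) ^ 2 * ‖(layer (G := G) j).starProjection x‖ ^ 2 := by
  have hortho : OrthogonalFamily ℝ (fun j => layer (G := G) j) fun j => (layer j).subtypeₗᵢ :=
    fun i j hij u v => (layer_ortho i j hij).inner_eq u.2 v.2
  simpa [norm_smul, mul_pow, dilation] using
    hortho.norm_sum (fun j => r ^ j • (layer j).orthogonalProjectionOnto x) (Finset.Icc 1 (step G))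

theorem norm_dilation_le {r : ℝ} (h0 : 0 ≤ r) (h1 : r ≤ 1) (x : G) :
    ‖dilation r x‖ ≤ r * ‖x‖ := by
  refine le_of_sq_le_sq ?_ (by positivity)
  nth_rw 2 [← dilation_one x]
  rw [mul_pow, norm_dilation_sq, norm_dilation_sq, Finset.mul_sum]
  refine Finset.sum_le_sum fun j hj => ?_
  rw [abs_one, one_pow, one_pow, one_mul, abs_of_nonneg h0]
  gcongr
  exact pow_le_of_le_one h0 h1 (Nat.one_le_iff_ne_zero.1 (Finset.mem_Icc.1 hj).1)

end Dilation

namespace GradedBasis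

variable {G : Type*} [NormedAddCommGroup G] [InnerProductSpace ℝ G] [StratifiedGroup G] {n : ℕ}
  (b : GradedBasis G n)

theorem deg_pos (i : Fin n) : 0 < b.deg i := by
  refine Nat.pos_of_ne_zero fun h0 => b.X.orthonormal.ne_zero i ?_
  simpa [h0, layer_zero] using b.mem_layer i

theorem repr_eq_zero_of_mem_layer {j : ℕ} {x : G} (hx : x ∈ layer (G := G) j) {i : Fin n}
    (hi : b.deg i ≠ j) : b.X.repr x i = 0 := by
  rw [OrthonormalBasis.repr_apply_apply]
  exact (layer_ortho (b.deg i) j hi).inner_eq (b.mem_layer i) hx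

theorem mem_layer_iff {j : ℕ} {x : G} :
    x ∈ layer (G := G) j ↔ ∀ i, b.deg i ≠ j → b.X.repr x i = 0 := by
  refine ⟨fun hx i hi => b.repr_eq_zero_of_mem_layer hx hi, fun h => ?_⟩
  rw [← b.X.sum_repr x]
  refine Submodule.sum_mem _ fun i _ => ?_
  by_cases hi : b.deg i = j
  · exact Submodule.smul_mem _ _ (hi ▸ b.mem_layer i)
  · simp [h i hi]

theorem repr_dilation [FiniteDimensional ℝ G] (r : ℝ) (x : G) (i : Fin n) :
    b.X.repr (dilation r x) i = r ^ b.deg i * b.X.repr x i := by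
  have h : b.X.toBasis.coord i ∘ₗ dilationLinear r = r ^ b.deg i • b.X.toBasis.coord i :=
    linearMap_ext fun j y hy => by
      by_cases hi : b.deg i = j
      · simp [dilation_of_mem_layer r hy, hi]
      · simp [dilation_of_mem_layer r hy, b.repr_eq_zero_of_mem_layer hy hi]
  simpa using DFunLike.congr_fun h x

end GradedBasis

/-! ### The topology of a homogeneous distance -/

namespace HomogeneousDistance

variable {G : Type*} [NormedAddCommGroup G] [InnerProductSpace ℝ G] [FiniteDimensional ℝ G]
  [StratifiedGroup G] (ρ : HomogeneousDistance G)

theorem d_self (x : G) : ρ.d x x = 0 := (ρ.eq_zero_iff x x).2 rfl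

theorem d_nonneg (x y : G) : 0 ≤ ρ.d x y := by
  have triangle := ρ.triangle x y x
  rw [ρ.d_self, ρ.symm y x] at triangle
  linarith

theorem d_eq_d_zero_inv_mul (x y : G) : ρ.d x y = ρ.d 0 (x⁻¹ * y) := by
  rw [← ρ.left_inv x y x⁻¹, inv_mul_self_eq_zero]

theorem d_zero_dilation {r : ℝ} (hr : 0 < r) (x : G) : ρ.d 0 (dilation r x) = r * ρ.d 0 x := by
  simpa using ρ.homogeneous r hr 0 x

theorem continuous_d_right (x : G) : Continuous (ρ.d x) :=
  ρ.continuous_d.comp (by fun_prop : Continuous fun y : G => (x, y))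

theorem isOpen_ball (x : G) (r : ℝ) : IsOpen (ρ.ball x r) :=
  isOpen_lt (ρ.continuous_d_right x) continuous_const

theorem mem_ball_self (x : G) {r : ℝ} (hr : 0 < r) : x ∈ ρ.ball x r :=
  (ρ.d_self x).trans_lt hr

theorem exists_le_d_zero_of_norm_eq_one : ∃ c : ℝ, 0 < c ∧ ∀ z, ‖z‖ = 1 → c ≤ ρ.d 0 z := by
  simp only [← mem_sphere_zero_iff_norm]
  rcases (Metric.sphere (0 : G) 1).eq_empty_or_nonempty with h | h
  · exact ⟨1, one_pos, by simp [h]⟩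
  · obtain ⟨z₀, hz₀, hmin⟩ := (isCompact_sphere (0 : G) 1).exists_isMinOn h
      (ρ.continuous_d_right 0).continuousOn
    refine ⟨ρ.d 0 z₀, (ρ.d_nonneg _ _).lt_of_ne fun h0 => ?_, fun z hz => hmin hz⟩
    simp [← (ρ.eq_zero_iff 0 z₀).1 h0.symm] at hz₀

/- Along `r ↦ δ_r z` the norm goes continuously from `0` to `‖z‖`; if `1 < ‖z‖`, the curve meets the
unit sphere, where `d 0` is at least `c`, at some `r ≤ 1`. -/
theorem norm_le_one_of_d_zero_lt {c : ℝ} (hc : ∀ z, ‖z‖ = 1 → c ≤ ρ.d 0 z) {z : G}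
    (hz : ρ.d 0 z < c) : ‖z‖ ≤ 1 := by
  by_contra! h
  have norm_continuousOn : ContinuousOn (fun r : ℝ => ‖dilation r z‖) (Icc 0 1) :=
    (continuous_dilation.comp (by fun_prop : Continuous fun r : ℝ => (r, z))).norm.continuousOn
  obtain ⟨r, hr, hrz⟩ := intermediate_value_Icc zero_le_one norm_continuousOn
    (show (1 : ℝ) ∈ _ by simp [dilation_zero_left, dilation_one, h.le])
  have r_pos : 0 < r := hr.1.lt_of_ne fun h0 => by simp [← h0, dilation_zero_left] at hrz
  have c_le := hc (dilation r z) hrz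
  rw [ρ.d_zero_dilation r_pos] at c_le
  nlinarith [hr.2, ρ.d_nonneg 0 z]

theorem exists_norm_le : ∃ C : ℝ, 0 < C ∧ ∀ z, ρ.d 0 z ≤ 1 → ‖z‖ ≤ C := by
  obtain ⟨c, hc, hsphere⟩ := ρ.exists_le_d_zero_of_norm_eq_one
  obtain ⟨C, hC⟩ := (isCompact_closedBall (0 : G) 1).exists_bound_of_continuousOn
    (continuous_dilation_right (1 / (c / 2))).continuousOn
  refine ⟨max C 1, by positivity, fun z hz => le_max_of_le_left ?_⟩
  have norm_le_one : ‖dilation (c / 2) z‖ ≤ 1 := ρ.norm_le_one_of_d_zero_lt hsphere (by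
    rw [ρ.d_zero_dilation (by positivity)]
    nlinarith)
  simpa only [dilation_one_div_dilation (half_pos hc).ne'] using
    hC (dilation (c / 2) z) (by simpa using norm_le_one)

theorem exists_norm_le_mul :
    ∃ C : ℝ, 0 < C ∧ ∀ r, 0 < r → r ≤ 1 → ∀ z, ρ.d 0 z ≤ r → ‖z‖ ≤ r * C := by
  obtain ⟨C, hC0, hC⟩ := ρ.exists_norm_le
  refine ⟨C, hC0, fun r h0 h1 z hz => ?_⟩
  have d_le_one : ρ.d 0 (dilation (1 / r) z) ≤ 1 := by
    rw [ρ.d_zero_dilation (by positivity), one_div_mul_eq_div]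
    exact (div_le_one h0).2 hz
  calc ‖z‖ = ‖dilation r (dilation (1 / r) z)‖ := by rw [dilation_dilation_one_div h0.ne']
    _ ≤ r * ‖dilation (1 / r) z‖ := norm_dilation_le h0.le h1 _
    _ ≤ r * C := by gcongr; exact hC _ d_le_one

theorem exists_ball_subset {x : G} {U : Set G} (hU : U ∈ 𝓝 x) : ∃ r > 0, ρ.ball x r ⊆ U := by
  obtain ⟨C, hC0, hC⟩ := ρ.exists_norm_le_mul
  have translation_tendsto : Tendsto (fun z : G => x * z) (𝓝 0) (𝓝 x) := by
    simpa only [mul_zero_eq_self] using (contDiff_mul_left (m := 0) x).continuous.tendsto 0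
  obtain ⟨η, hη, hηU⟩ := Metric.mem_nhds_iff.1 (translation_tendsto hU)
  refine ⟨min 1 (η / (2 * C)), by positivity, fun y hy => ?_⟩
  have d_lt : ρ.d 0 (x⁻¹ * y) < min 1 (η / (2 * C)) := by rwa [← ρ.d_eq_d_zero_inv_mul]
  have norm_lt : ‖x⁻¹ * y‖ < η :=
    calc ‖x⁻¹ * y‖ ≤ min 1 (η / (2 * C)) * C :=
          hC _ (by positivity) (min_le_left _ _) _ d_lt.le
      _ ≤ η / (2 * C) * C := by gcongr; exact min_le_right _ _
      _ = η / 2 := by field_simp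
      _ < η := half_lt_self hη
  simpa using hηU (mem_ball_zero_iff.2 norm_lt)

theorem toTopologicalSpace_eq :
    ρ.metricSpace.toUniformSpace.toTopologicalSpace =
      (inferInstance : TopologicalSpace G) := by
  have ball_eq (x : G) (r : ℝ) :
      @Metric.ball G ρ.metricSpace.toPseudoMetricSpace x r = ρ.ball x r :=
    Set.ext fun y => (ρ.symm y x ▸ Iff.rfl : ρ.d y x < r ↔ ρ.d x y < r)
  refine TopologicalSpace.ext_nhds fun x => Filter.ext fun U => ?_
  simp only [@Metric.mem_nhds_iff G ρ.metricSpace.toPseudoMetricSpace, ball_eq]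
  refine ⟨?_, ρ.exists_ball_subset⟩
  rintro ⟨r, hr, h⟩
  exact mem_of_superset ((ρ.isOpen_ball x r).mem_nhds (ρ.mem_ball_self x hr)) h

theorem exists_forall_d_lt_of_norm_sub_lt {K : Set G} (hK : IsCompact K) {ε : ℝ} (hε : 0 < ε) :
    ∃ η > 0, ∀ z ∈ K, ∀ w, ‖z - w‖ < η → ρ.d z w < ε := by
  have d_eventually (z : G) (_ : z ∈ K) :
      ∀ᶠ q : G × G in 𝓝 (0, z), ρ.d q.2 (q.2 - q.1) < ε := by
    refine ContinuousAt.eventually_lt (f := fun q : G × G => ρ.d q.2 (q.2 - q.1)) ?_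
      continuousAt_const (by simpa [ρ.d_self] using hε)
    exact (ρ.continuous_d.comp
      (by fun_prop : Continuous fun q : G × G => (q.2, q.2 - q.1))).continuousAt
  obtain ⟨η, hη, h⟩ := Metric.eventually_nhds_iff.1
    (hK.eventually_forall_of_forall_eventually (P := fun v z => ρ.d z (z - v) < ε) d_eventually)
  exact ⟨η, hη, fun z hz w hw => by simpa using h (y := z - w) (by simpa using hw) z hz⟩

end HomogeneousDistance

/-! ### Simple multivectors -/

section Exterior

variable {E : Type*} [AddCommGroup E] [Module ℝ E] {p : ℕ}

theorem ιMulti_ne_zero_of_linearIndependent {v : Fin p → E} (hv : LinearIndependent ℝ v) :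
    exteriorPower.ιMulti ℝ p v ≠ 0 := by
  simpa [exteriorPower.ιMulti_family] using
    (exteriorPower.ιMulti_family_linearIndependent_field (n := p) hv).ne_zero
      (Set.powersetCard.ofFinEmbEquiv (RelEmbedding.refl _))

theorem ιMulti_sum_smul (A : Matrix (Fin p) (Fin p) ℝ) (v : Fin p → E) :
    exteriorPower.ιMulti ℝ p (fun i => ∑ j, A i j • v j) =
      A.det • exteriorPower.ιMulti ℝ p v := by
  have alternating_eq :
      (exteriorPower.ιMulti ℝ p).compLinearMap (Fintype.linearCombination ℝ v) =
        (Pi.basisFun ℝ (Fin p)).det.smulRight (exteriorPower.ιMulti ℝ p v) := by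
    refine (Pi.basisFun ℝ (Fin p)).ext_alternating fun s hs => ?_
    let σ : Equiv.Perm (Fin p) := Equiv.ofBijective s (Finite.injective_iff_bijective.1 hs)
    have det_perm : (Pi.basisFun ℝ (Fin p)).det (Pi.basisFun ℝ (Fin p) ∘ σ) =
        ((Equiv.Perm.sign σ : ℤ) : ℝ) := by
      rw [AlternatingMap.map_perm, Module.Basis.det_self]
      simp [Units.smul_def]
    have v_comp : (fun i => Fintype.linearCombination ℝ v (Pi.basisFun ℝ (Fin p) (s i))) = v ∘ σ :=
      funext fun i => by simp [σ, Fintype.linearCombination_apply_single]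
    calc exteriorPower.ιMulti ℝ p (fun i =>
          Fintype.linearCombination ℝ v (Pi.basisFun ℝ (Fin p) (s i)))
        = Equiv.Perm.sign σ • exteriorPower.ιMulti ℝ p v := by
          rw [v_comp, AlternatingMap.map_perm]
      _ = (Pi.basisFun ℝ (Fin p)).det (Pi.basisFun ℝ (Fin p) ∘ σ) •
            exteriorPower.ιMulti ℝ p v := by
          rw [det_perm]
          rcases Int.units_eq_one_or (Equiv.Perm.sign σ) with h | h
          · simp [h]
          · simpa only [h, Units.val_neg, Units.val_one, Int.cast_neg, Int.cast_one, Units.neg_smul,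
              one_smul] using (neg_one_smul ℝ (exteriorPower.ιMulti ℝ p v)).symm
  calc exteriorPower.ιMulti ℝ p (fun i => ∑ j, A i j • v j)
      = (Pi.basisFun ℝ (Fin p)).det A • exteriorPower.ιMulti ℝ p v :=
        AlternatingMap.congr_fun alternating_eq A
    _ = A.det • exteriorPower.ιMulti ℝ p v := by rw [Pi.basisFun_det]; rfl

theorem mem_assocSubspace {τ : ⋀[ℝ]^p E} {w : E} :
    w ∈ assocSubspace τ ↔ ExteriorAlgebra.ι ℝ w * (τ : ExteriorAlgebra ℝ E) = 0 := by
  simp [assocSubspace]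

theorem ι_mul_ιMulti (w : E) (v : Fin p → E) :
    ExteriorAlgebra.ι ℝ w * (exteriorPower.ιMulti ℝ p v : ExteriorAlgebra ℝ E) =
      (exteriorPower.ιMulti ℝ (p + 1) (Fin.cons w v : Fin (p + 1) → E) : ExteriorAlgebra ℝ E) := by
  simp [ExteriorAlgebra.ιMulti_succ_apply, Matrix.vecTail, Function.comp_def]

theorem assocSubspace_ιMulti {v : Fin p → E} (hv : LinearIndependent ℝ v) :
    assocSubspace (exteriorPower.ιMulti ℝ p v) = Submodule.span ℝ (range v) := by
  ext w
  rw [mem_assocSubspace, ι_mul_ιMulti, ZeroMemClass.coe_eq_zero]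
  refine ⟨fun h => ?_, fun h => ?_⟩
  · by_contra hw
    exact ιMulti_ne_zero_of_linearIndependent (linearIndependent_finCons.2 ⟨hv, hw⟩) h
  · exact AlternatingMap.map_linearDependent _ _ fun hwv => (linearIndependent_finCons.1 hwv).2 h

theorem assocSubspace_smul {c : ℝ} (hc : c ≠ 0) (τ : ⋀[ℝ]^p E) :
    assocSubspace (c • τ) = assocSubspace τ := by
  ext w
  simp [mem_assocSubspace, hc]

theorem exists_matrix_of_forall_mem_span {v w : Fin p → E} (hw : LinearIndependent ℝ w)
    (h : ∀ i, w i ∈ Submodule.span ℝ (range v)) :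
    ∃ A : Matrix (Fin p) (Fin p) ℝ, A.det ≠ 0 ∧ w = fun i => ∑ j, A i j • v j := by
  choose A hA using fun i => (Submodule.mem_span_range_iff_exists_fun ℝ).1 (h i)
  refine ⟨Matrix.of A, fun det_eq_zero => ιMulti_ne_zero_of_linearIndependent hw ?_,
    funext fun i => (hA i).symm⟩
  rw [show w = fun i => ∑ j, Matrix.of A i j • v j from funext fun i => (hA i).symm,
    ιMulti_sum_smul, det_eq_zero, zero_smul]

end Exterior

/-- The scalar product of `p`-vectors, as a bilinear map: the scalar product of simple
multivectors is the determinant of the matrix of scalar products of their factors. -/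
noncomputable def multivectorInner (G : Type*) [NormedAddCommGroup G] [InnerProductSpace ℝ G]
    (p : ℕ) : ⋀[ℝ]^p G →ₗ[ℝ] ⋀[ℝ]^p G →ₗ[ℝ] ℝ :=
  exteriorPower.pairingDual ℝ G p ∘ₗ exteriorPower.map p (innerₗ G)

theorem multivectorInner_ιMulti {G : Type*} [NormedAddCommGroup G] [InnerProductSpace ℝ G] {p : ℕ}
    (u w : Fin p → G) :
    multivectorInner G p (exteriorPower.ιMulti ℝ p u) (exteriorPower.ιMulti ℝ p w) =
      (Matrix.of fun i j => inner ℝ (u j) (w i)).det := by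
  simp [multivectorInner, exteriorPower.pairingDual_ιMulti_ιMulti, innerₗ_apply_apply]

namespace GradedBasis

variable {G : Type*} [NormedAddCommGroup G] [InnerProductSpace ℝ G] [StratifiedGroup G] {n p : ℕ}
  (b : GradedBasis G n)

/-- The increasing enumeration of a multi-index. -/
noncomputable def enum (α : Set.powersetCard (Fin n) p) : Fin p ↪o Fin n :=
  Set.powersetCard.ofFinEmbEquiv.symm α

theorem exists_enum_eq_iff {α : Set.powersetCard (Fin n) p} {k : Fin n} :
    (∃ i, enum α i = k) ↔ k ∈ (α : Finset (Fin n)) := by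
  rw [Set.powersetCard.mem_coe_iff]
  exact Set.powersetCard.mem_range_ofFinEmbEquiv_symm_iff_mem α k

theorem multiDeg_eq_sum (α : Set.powersetCard (Fin n) p) :
    b.multiDeg α = ∑ i, b.deg (enum α i) := by
  have image_enum : (α : Finset (Fin n)) = Finset.univ.map (enum α).toEmbedding := by
    ext k
    simp [← exists_enum_eq_iff]
  rw [multiDeg, image_enum, Finset.sum_map]
  rfl

theorem coord_ιMulti (v : Fin p → G) (α : Set.powersetCard (Fin n) p) :
    b.coord (exteriorPower.ιMulti ℝ p v) α =
      (Matrix.of fun i j => b.X.repr (v i) (enum α j)).det := by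
  rw [coord, exteriorPower.basis_repr_apply, exteriorPower.ιMultiDual_apply_ιMulti]
  simp [enum, Module.Basis.coord_apply]

theorem coord_smul (c : ℝ) (τ : ⋀[ℝ]^p G) (α : Set.powersetCard (Fin n) p) :
    b.coord (c • τ) α = c * b.coord τ α := by
  simp [coord]

theorem ext_coord {τ τ' : ⋀[ℝ]^p G} (h : ∀ α, b.coord τ α = b.coord τ' α) : τ = τ' :=
  (b.X.toBasis.exteriorPower p).ext_elem h

theorem coord_proj (D : ℕ) (τ : ⋀[ℝ]^p G) (α : Set.powersetCard (Fin n) p) :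
    b.coord (b.proj D τ) α = if b.multiDeg α = D then b.coord τ α else 0 := by
  classical
  simp only [proj, coord, map_sum, Finsupp.finsetSum_apply, map_smul, Module.Basis.repr_self,
    Finsupp.smul_single, Finsupp.single_apply, smul_eq_mul, mul_one, Finset.sum_ite_eq',
    Finset.mem_filter_univ]

theorem proj_smul (D : ℕ) (c : ℝ) (τ : ⋀[ℝ]^p G) : b.proj D (c • τ) = c • b.proj D τ :=
  b.ext_coord fun α => by simp [coord_proj, coord_smul]

theorem pnorm_smul (c : ℝ) (τ : ⋀[ℝ]^p G) : b.pnorm (c • τ) = |c| * b.pnorm τ := by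
  simp only [pnorm, coord_smul, mul_pow, ← Finset.mul_sum]
  rw [Real.sqrt_mul (sq_nonneg _), Real.sqrt_sq_eq_abs]

theorem pnorm_pos {τ : ⋀[ℝ]^p G} (h : τ ≠ 0) : 0 < b.pnorm τ := by
  contrapose! h
  have sum_nonpos : ∑ α, b.coord τ α ^ 2 ≤ 0 :=
    Real.sqrt_eq_zero'.1 (h.antisymm (Real.sqrt_nonneg _))
  refine b.ext_coord fun α => ?_
  have coord_eq_zero := (Finset.sum_eq_zero_iff_of_nonneg fun α _ => sq_nonneg (b.coord τ α)).1
    (sum_nonpos.antisymm (by positivity)) α (Finset.mem_univ α)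
  simpa [coord] using coord_eq_zero

theorem multivectorInner_basis (α : Set.powersetCard (Fin n) p) (w : Fin p → G) :
    multivectorInner G p (b.X.toBasis.exteriorPower p α) (exteriorPower.ιMulti ℝ p w) =
      b.coord (exteriorPower.ιMulti ℝ p w) α := by
  rw [exteriorPower.basis_apply, exteriorPower.ιMulti_family, multivectorInner_ιMulti, coord_ιMulti]
  simp [enum, OrthonormalBasis.repr_apply_apply]

theorem pnorm_ιMulti (v : Fin p → G) :
    b.pnorm (exteriorPower.ιMulti ℝ p v) =
      Real.sqrt (Matrix.of fun i j => inner ℝ (v i) (v j)).det := by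
  have inner_self : multivectorInner G p (exteriorPower.ιMulti ℝ p v)
      (exteriorPower.ιMulti ℝ p v) = ∑ α, b.coord (exteriorPower.ιMulti ℝ p v) α ^ 2 := by
    conv_lhs =>
      enter [1]
      rw [← (b.X.toBasis.exteriorPower p).sum_repr (exteriorPower.ιMulti ℝ p v)]
    simp only [map_sum, LinearMap.sum_apply, map_smul, LinearMap.smul_apply,
      multivectorInner_basis, smul_eq_mul, sq]
    rfl
  rw [pnorm, ← inner_self, multivectorInner_ιMulti]
  simp_rw [real_inner_comm]

end GradedBasis

/-! ### Coordinates, linear parametrizations and weighted dilations -/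

section WeightedDilation

variable {ι : Type*}

/-- The linear map that multiplies the coordinate `i` by `r ^ k i`: the dilations of a stratified
group in the coordinates of a graded basis. -/
noncomputable def weightedDilation (k : ι → ℕ) (r : ℝ) :
    EuclideanSpace ℝ ι →L[ℝ] EuclideanSpace ℝ ι :=
  (EuclideanSpace.equiv ι ℝ).symm.toContinuousLinearMap ∘L
    ContinuousLinearMap.pi fun i => r ^ k i • EuclideanSpace.proj i

@[simp] theorem weightedDilation_apply (k : ι → ℕ) (r : ℝ) (s : EuclideanSpace ℝ ι) (i : ι) :
    weightedDilation k r s i = r ^ k i * s i := rfl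

theorem weightedDilation_one_div_weightedDilation (k : ι → ℕ) {r : ℝ} (hr : r ≠ 0)
    (s : EuclideanSpace ℝ ι) : weightedDilation k (1 / r) (weightedDilation k r s) = s := by
  ext i
  simp [hr]

theorem weightedDilation_weightedDilation_one_div (k : ι → ℕ) {r : ℝ} (hr : r ≠ 0)
    (s : EuclideanSpace ℝ ι) : weightedDilation k r (weightedDilation k (1 / r) s) = s := by
  ext i
  simp [hr]

variable [Fintype ι]

/-- The linear map `s ↦ ∑ i, s i • ζ i`, which parametrizes the span of the family `ζ`. -/
noncomputable def linParam {E : Type*} [NormedAddCommGroup E] [NormedSpace ℝ E] (ζ : ι → E) :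
    EuclideanSpace ℝ ι →L[ℝ] E :=
  ∑ i, (EuclideanSpace.proj i).smulRight (ζ i)

section

variable {E : Type*} [NormedAddCommGroup E] [NormedSpace ℝ E] (ζ : ι → E)

@[simp] theorem linParam_apply (s : EuclideanSpace ℝ ι) : linParam ζ s = ∑ i, s i • ζ i := by
  simp [linParam]

theorem linParam_single [DecidableEq ι] (i : ι) :
    linParam ζ (EuclideanSpace.single i 1) = ζ i := by
  simp

theorem range_linParam : range (linParam ζ) = (Submodule.span ℝ (range ζ) : Set E) := by
  ext x
  rw [SetLike.mem_coe, Submodule.mem_span_range_iff_exists_fun]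
  exact ⟨fun ⟨s, hs⟩ => ⟨s, by simpa using hs⟩, fun ⟨c, hc⟩ => ⟨WithLp.toLp 2 c, by simpa using hc⟩⟩

end

theorem det_weightedDilation (k : ι → ℕ) (r : ℝ) : (weightedDilation k r).det = r ^ ∑ i, k i := by
  classical
  let e := (EuclideanSpace.basisFun ι ℝ).toBasis
  have toMatrix_eq : LinearMap.toMatrix e e (weightedDilation k r : _ →ₗ[ℝ] _) =
      Matrix.diagonal fun i => r ^ k i := by
    ext i j
    by_cases hij : i = j <;> simp [e, LinearMap.toMatrix_apply, hij]
  rw [ContinuousLinearMap.det, ← LinearMap.det_toMatrix e, toMatrix_eq, Matrix.det_diagonal,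
    Finset.prod_pow_eq_pow_sum]

theorem norm_weightedDilation_le {k : ι → ℕ} {m : ℕ} (hm : ∀ i, m ≤ k i) {r : ℝ} (h0 : 0 ≤ r)
    (h1 : r ≤ 1) (s : EuclideanSpace ℝ ι) : ‖weightedDilation k r s‖ ≤ r ^ m * ‖s‖ := by
  refine le_of_sq_le_sq ?_ (by positivity)
  rw [mul_pow, EuclideanSpace.norm_sq_eq, EuclideanSpace.norm_sq_eq, Finset.mul_sum]
  refine Finset.sum_le_sum fun i _ => ?_
  rw [weightedDilation_apply, norm_mul, mul_pow, Real.norm_of_nonneg (by positivity)]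
  gcongr ?_ ^ 2 * _
  exact pow_le_pow_of_le_one h0 h1 (hm i)

theorem isBigO_weightedDilation {k : ι → ℕ} {m : ℕ} (hm : ∀ i, m ≤ k i) (R : ℝ) :
    (fun q : ℝ × EuclideanSpace ℝ ι => weightedDilation k q.1 q.2)
      =O[𝓝[>] 0 ×ˢ 𝓟 {s | ‖s‖ ≤ R}] fun q => q.1 ^ m := by
  refine .of_bound R ?_
  filter_upwards [prod_mem_prod (Ioo_mem_nhdsGT one_pos) (mem_principal_self _)]
    with q ⟨⟨r_pos, r_lt_one⟩, norm_le⟩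
  calc ‖weightedDilation k q.1 q.2‖ ≤ q.1 ^ m * ‖q.2‖ :=
        norm_weightedDilation_le hm r_pos.le r_lt_one.le q.2
    _ ≤ q.1 ^ m * R := by gcongr; exact norm_le
    _ = R * ‖q.1 ^ m‖ := by rw [Real.norm_of_nonneg (by positivity), mul_comm]

theorem tendsto_weightedDilation {k : ι → ℕ} (hk : ∀ i, 0 < k i) (R : ℝ) :
    Tendsto (fun q : ℝ × EuclideanSpace ℝ ι => weightedDilation k q.1 q.2)
      (𝓝[>] 0 ×ˢ 𝓟 {s | ‖s‖ ≤ R}) (𝓝 0) := by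
  have fst_tendsto : Tendsto (fun q : ℝ × EuclideanSpace ℝ ι => q.1 ^ 1)
      (𝓝[>] 0 ×ˢ 𝓟 {s | ‖s‖ ≤ R}) (𝓝 0) := by
    simpa only [pow_one] using tendsto_fst.mono_right nhdsWithin_le_nhds
  exact (isBigO_weightedDilation hk R).trans_tendsto fst_tendsto

theorem eventually_weightedDilation_mem {k : ι → ℕ} (hk : ∀ i, 0 < k i)
    {B : Set (EuclideanSpace ℝ ι)} (hB : B ∈ 𝓝 0) (R : ℝ) :
    ∀ᶠ r in 𝓝[>] (0 : ℝ), ∀ s, ‖s‖ ≤ R → weightedDilation k r s ∈ B :=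
  eventually_prod_principal_iff.1 (tendsto_weightedDilation hk R hB)

omit [Fintype ι] in
theorem tendsto_weightedDilation_nhdsGT_zero [Finite ι] {k : ι → ℕ} (hk : ∀ i, 0 < k i)
    (s : EuclideanSpace ℝ ι) : Tendsto (fun r => weightedDilation k r s) (𝓝[>] 0) (𝓝 0) := by
  cases nonempty_fintype ι
  exact fun V hV => (eventually_weightedDilation_mem hk hV ‖s‖).mono fun r mem_V => mem_V s le_rfl

end WeightedDilation

theorem dilation_linParam {ι G : Type*} [Fintype ι] [NormedAddCommGroup G] [InnerProductSpace ℝ G]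
    [FiniteDimensional ℝ G] [StratifiedGroup G] {k : ι → ℕ} {ζ : ι → G}
    (hζ : ∀ i, ζ i ∈ layer (G := G) (k i)) (r : ℝ) (s : EuclideanSpace ℝ ι) :
    dilation r (linParam ζ s) = linParam ζ (weightedDilation k r s) := by
  simp only [← dilationLinear_apply, linParam_apply, map_sum, map_smul, weightedDilation_apply]
  refine Finset.sum_congr rfl fun i _ => ?_
  rw [dilationLinear_apply, dilation_of_mem_layer r (hζ i), smul_smul, mul_comm]

/-! ### Multi-indices of maximal degree and adapted frames -/

/- In the Leibniz expansion of `A`, a nonzero product has `e j ≤ d (σ j)` for all `j`, with equality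
throughout if and only if the two sums agree. -/
theorem det_of_ite_eq {R ι : Type*} [CommRing R] [Fintype ι] [DecidableEq ι] (A : Matrix ι ι R)
    (d e : ι → ℕ) (hA : ∀ i j, d i < e j → A i j = 0) :
    (Matrix.of fun i j => if e j = d i then A i j else 0).det =
      if ∑ j, e j = ∑ i, d i then A.det else 0 := by
  have sum_comp (σ : Equiv.Perm ι) : ∑ j, d (σ j) = ∑ i, d i := Equiv.sum_comp σ d
  simp only [Matrix.det_apply, Matrix.of_apply]
  split_ifs with sum_eq
  · refine Finset.sum_congr rfl fun σ _ => ?_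
    by_cases le : ∀ j, e j ≤ d (σ j)
    · have eq := (Finset.sum_eq_sum_iff_of_le fun j _ => le j).1 (sum_eq.trans (sum_comp σ).symm)
      simp [fun j => eq j (Finset.mem_univ j)]
    · obtain ⟨j, hj⟩ := not_forall.1 le
      rw [Finset.prod_eq_zero (Finset.mem_univ j) (if_neg (by omega)),
        Finset.prod_eq_zero (f := fun j => A (σ j) j) (Finset.mem_univ j) (hA _ _ (not_le.1 hj))]
  · refine Finset.sum_eq_zero fun σ _ => ?_
    obtain ⟨j, hj⟩ : ∃ j, e j ≠ d (σ j) := by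
      by_contra! eq
      exact sum_eq ((Finset.sum_congr rfl fun j _ => eq j).trans (sum_comp σ))
    rw [Finset.prod_eq_zero (Finset.mem_univ j) (if_neg hj), smul_zero]

namespace GradedBasis

variable {G : Type*} [NormedAddCommGroup G] [InnerProductSpace ℝ G] [StratifiedGroup G] {n p : ℕ}
  (b : GradedBasis G n)

theorem multiDeg_le_maxDim (α : Set.powersetCard (Fin n) p) : b.multiDeg α ≤ b.maxDim p :=
  Finset.le_sup (f := fun α => b.multiDeg α) (Finset.mem_univ α)

/- Exchanging the entry `enum α i` for `k` cannot increase the degree. -/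
theorem deg_le_of_multiDeg_eq {α : Set.powersetCard (Fin n) p} (hα : b.multiDeg α = b.maxDim p)
    {k : Fin n} (hk : k ∉ (α : Finset (Fin n))) (i : Fin p) : b.deg k ≤ b.deg (enum α i) := by
  set rest := (α : Finset (Fin n)).erase (enum α i)
  have hi : enum α i ∈ (α : Finset (Fin n)) := exists_enum_eq_iff.1 ⟨i, rfl⟩
  have hk' : k ∉ rest := fun h => hk (Finset.mem_of_mem_erase h)
  have card_insert : (insert k rest).card = p := by
    rw [Finset.card_insert_of_notMem hk', Finset.card_erase_add_one hi]
    exact α.2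
  have exchange_le : ∑ j ∈ insert k rest, b.deg j ≤ b.multiDeg α :=
    hα ▸ b.multiDeg_le_maxDim (⟨_, card_insert⟩ : Set.powersetCard (Fin n) p)
  rw [Finset.sum_insert hk', multiDeg, ← Finset.add_sum_erase _ _ hi] at exchange_le
  exact Nat.le_of_add_le_add_right exchange_le

/-- A frame whose coordinates of index in `α` form the identity matrix, for a multi-index `α` of
maximal degree. -/
structure IsAdaptedFrame (α : Set.powersetCard (Fin n) p) (w : Fin p → G) : Prop where
  multiDeg_eq : b.multiDeg α = b.maxDim p
  repr_enum : ∀ i j, b.X.repr (w i) (enum α j) = if i = j then 1 else 0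

theorem exists_isAdaptedFrame {α : Set.powersetCard (Fin n) p} (hα : b.multiDeg α = b.maxDim p)
    {u : Fin p → G} (hu : b.coord (exteriorPower.ιMulti ℝ p u) α ≠ 0) :
    ∃ A : Matrix (Fin p) (Fin p) ℝ, A.det ≠ 0 ∧ b.IsAdaptedFrame α fun i => ∑ j, A i j • u j := by
  rw [coord_ιMulti] at hu
  set C : Matrix (Fin p) (Fin p) ℝ := Matrix.of fun i j => b.X.repr (u i) (enum α j) with C_def
  have isUnit_det : IsUnit C.det := isUnit_iff_ne_zero.2 hu
  refine ⟨C⁻¹, (Matrix.isUnit_nonsing_inv_det _ isUnit_det).ne_zero, hα, fun i j => ?_⟩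
  simpa [C_def, Matrix.mul_apply, Matrix.one_apply] using
    congrFun (congrFun (Matrix.nonsing_inv_mul _ isUnit_det) i) j

/-- The component of `w i` in the layer of degree `deg (α i)`. -/
noncomputable def topPart (α : Set.powersetCard (Fin n) p) (w : Fin p → G) (i : Fin p) : G :=
  ∑ k with b.deg k = b.deg (enum α i), b.X.repr (w i) k • b.X k

theorem repr_topPart (α : Set.powersetCard (Fin n) p) (w : Fin p → G) (i : Fin p) (k : Fin n) :
    b.X.repr (b.topPart α w i) k =
      if b.deg k = b.deg (enum α i) then b.X.repr (w i) k else 0 := by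
  rw [topPart, map_sum, WithLp.ofLp_sum, Finset.sum_apply]
  simp [Finset.sum_ite_eq]

theorem topPart_mem_layer (α : Set.powersetCard (Fin n) p) (w : Fin p → G) (i : Fin p) :
    b.topPart α w i ∈ layer (G := G) (b.deg (enum α i)) :=
  b.mem_layer_iff.2 fun k hk => by simp [repr_topPart, hk]

/-- The coordinates of index in `α`. -/
noncomputable def coords (α : Set.powersetCard (Fin n) p) : G →L[ℝ] EuclideanSpace ℝ (Fin p) :=
  (EuclideanSpace.equiv (Fin p) ℝ).symm.toContinuousLinearMap ∘L
    ContinuousLinearMap.pi fun i => (EuclideanSpace.proj (enum α i)) ∘L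
      (b.X.repr.toContinuousLinearEquiv : G →L[ℝ] EuclideanSpace ℝ (Fin n))

@[simp] theorem coords_apply (α : Set.powersetCard (Fin n) p) (x : G) (i : Fin p) :
    b.coords α x i = b.X.repr x (enum α i) := rfl

theorem coords_linParam {α : Set.powersetCard (Fin n) p} {ζ : Fin p → G}
    (hζ : ∀ i j, b.X.repr (ζ i) (enum α j) = if i = j then 1 else 0)
    (s : EuclideanSpace ℝ (Fin p)) : b.coords α (linParam ζ s) = s := by
  ext j
  rw [coords_apply, linParam_apply, map_sum, WithLp.ofLp_sum, Finset.sum_apply]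
  simp [hζ]

/-- The dilations in the coordinates of index in `α`. -/
noncomputable abbrev stretch (α : Set.powersetCard (Fin n) p) (r : ℝ) :
    EuclideanSpace ℝ (Fin p) →L[ℝ] EuclideanSpace ℝ (Fin p) :=
  weightedDilation (fun i => b.deg (enum α i)) r

theorem coords_dilation [FiniteDimensional ℝ G] (α : Set.powersetCard (Fin n) p) (r : ℝ) (x : G) :
    b.coords α (dilation r x) = b.stretch α r (b.coords α x) := by
  ext i
  simp [b.repr_dilation]

namespace IsAdaptedFrame

variable {b} {α : Set.powersetCard (Fin n) p} {w : Fin p → G} (h : b.IsAdaptedFrame α w)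
include h

theorem repr_topPart_enum (i j : Fin p) :
    b.X.repr (b.topPart α w i) (enum α j) = if i = j then 1 else 0 := by
  rw [repr_topPart, h.repr_enum]
  by_cases hij : i = j <;> simp [hij]

theorem repr_eq_zero_of_deg_lt {i : Fin p} {k : Fin n} (hk : b.deg (enum α i) < b.deg k) :
    b.X.repr (w i) k = 0 := by
  by_cases hkα : k ∈ (α : Finset (Fin n))
  · obtain ⟨j, rfl⟩ := exists_enum_eq_iff.2 hkα
    rw [h.repr_enum, if_neg]
    rintro rfl
    exact lt_irrefl _ hk
  · exact absurd (b.deg_le_of_multiDeg_eq h.multiDeg_eq hkα i) hk.not_ge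

theorem coords_linParam_topPart (s : EuclideanSpace ℝ (Fin p)) :
    b.coords α (linParam (b.topPart α w) s) = s :=
  b.coords_linParam h.repr_topPart_enum s

theorem linearIndependent_topPart : LinearIndependent ℝ (b.topPart α w) := by
  refine Fintype.linearIndependent_iff.2 fun c hc i => ?_
  have coords_eq := h.coords_linParam_topPart (WithLp.toLp 2 c)
  rw [linParam_apply, hc, map_zero] at coords_eq
  exact (congrArg (fun s : EuclideanSpace ℝ (Fin p) => s i) coords_eq).symm

theorem finrank_span : Module.finrank ℝ (Submodule.span ℝ (range (b.topPart α w))) = p := by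
  simpa using finrank_span_eq_card h.linearIndependent_topPart

theorem proj_ιMulti :
    b.proj (b.maxDim p) (exteriorPower.ιMulti ℝ p w) =
      exteriorPower.ιMulti ℝ p (b.topPart α w) := by
  refine b.ext_coord fun β => ?_
  simp only [coord_proj, coord_ιMulti, repr_topPart, ← h.multiDeg_eq, b.multiDeg_eq_sum]
  exact (det_of_ite_eq (Matrix.of fun i j => b.X.repr (w i) (enum β j))
    (fun i => b.deg (enum α i)) (fun j => b.deg (enum β j))
    fun i j hij => h.repr_eq_zero_of_deg_lt hij).symm

theorem topPart_eq_of_lt {i i₀ : Fin p} (hi : b.deg (enum α i₀) < b.deg (enum α i)) :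
    b.topPart α w i = b.X (enum α i) := by
  refine b.X.repr.injective (PiLp.ext fun k => ?_)
  by_cases hk : k ∈ (α : Finset (Fin n))
  · obtain ⟨j, rfl⟩ := exists_enum_eq_iff.2 hk
    rw [h.repr_topPart_enum]
    simp [(enum α).injective.eq_iff, eq_comm]
  · have k_ne : k ≠ enum α i := fun hki => hk (exists_enum_eq_iff.1 ⟨i, hki.symm⟩)
    have deg_lt : b.deg k < b.deg (enum α i) :=
      (b.deg_le_of_multiDeg_eq h.multiDeg_eq hk i₀).trans_lt hi
    simp [repr_topPart, deg_lt.ne, k_ne]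

theorem layer_le_span {i₀ : Fin p} {j : ℕ} (hj : b.deg (enum α i₀) < j) :
    layer (G := G) j ≤ Submodule.span ℝ (range (b.topPart α w)) := by
  intro y hy
  rw [← b.X.sum_repr y]
  refine Submodule.sum_mem _ fun k _ => ?_
  by_cases hk : b.deg k = j
  · have hkα : k ∈ (α : Finset (Fin n)) := by
      by_contra hkα
      exact (b.deg_le_of_multiDeg_eq h.multiDeg_eq hkα i₀).not_gt (hk ▸ hj)
    obtain ⟨i, rfl⟩ := exists_enum_eq_iff.2 hkα
    rw [← h.topPart_eq_of_lt (hk ▸ hj)]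
    exact Submodule.smul_mem _ _ (Submodule.subset_span (mem_range_self i))
  · simp [b.repr_eq_zero_of_mem_layer hy hk]

theorem exists_layer_decomposition (hp : 1 ≤ p) :
    ∃ (l : ℕ) (Z : Submodule ℝ G), Z ≤ layer (G := G) l ∧ Z ≠ ⊥ ∧
      Submodule.span ℝ (range (b.topPart α w)) = Z ⊔ ⨆ j > l, layer (G := G) j := by
  let i₀ : Fin p := ⟨0, hp⟩
  let lowest : Set (Fin p) := {i | b.deg (enum α i) = b.deg (enum α i₀)}
  have deg_min (i : Fin p) : b.deg (enum α i₀) ≤ b.deg (enum α i) :=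
    b.deg_mono ((enum α).monotone (Fin.le_def.2 (Nat.zero_le _)))
  refine ⟨b.deg (enum α i₀), Submodule.span ℝ (b.topPart α w '' lowest), ?_, ?_, ?_⟩
  · rw [Submodule.span_le]
    rintro _ ⟨i, hi, rfl⟩
    exact (show b.deg (enum α i) = _ from hi) ▸ b.topPart_mem_layer α w i
  · exact (Submodule.ne_bot_iff _).2 ⟨b.topPart α w i₀, Submodule.subset_span ⟨i₀, rfl, rfl⟩,
      h.linearIndependent_topPart.ne_zero i₀⟩
  · refine le_antisymm (Submodule.span_le.2 ?_) (sup_le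
      (Submodule.span_mono (image_subset_range _ _)) (iSup₂_le fun j hj => h.layer_le_span hj))
    rintro _ ⟨i, rfl⟩
    rcases (deg_min i).eq_or_lt with hi | hi
    · exact Submodule.mem_sup_left (Submodule.subset_span ⟨i, hi.symm, rfl⟩)
    · exact Submodule.mem_sup_right (Submodule.mem_iSup_of_mem _
        (Submodule.mem_iSup_of_mem hi (b.topPart_mem_layer α w i)))

theorem lie_mem_span (x : G) {y : G} (hy : y ∈ Submodule.span ℝ (range (b.topPart α w))) :
    lie x y ∈ Submodule.span ℝ (range (b.topPart α w)) := by
  suffices Submodule.span ℝ (range (b.topPart α w)) ≤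
      (Submodule.span ℝ (range (b.topPart α w))).comap (lie x) from this hy
  rw [Submodule.span_le]
  rintro _ ⟨i, rfl⟩
  rw [SetLike.mem_coe, Submodule.mem_comap, ← b.X.sum_repr x, map_sum, LinearMap.sum_apply]
  refine Submodule.sum_mem _ fun k _ => ?_
  rw [map_smul, LinearMap.smul_apply]
  refine Submodule.smul_mem _ _ (h.layer_le_span (i₀ := i) ?_
    (lie_mem_layer (b.mem_layer k) (b.topPart_mem_layer α w i)))
  exact Nat.lt_add_of_pos_left (b.deg_pos k)

end IsAdaptedFrame

end GradedBasis

/-! ### Riemannian metrics and Gram determinants -/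

section Riemannian

variable {G : Type*} [NormedAddCommGroup G] [NormedSpace ℝ G] (gt : SmoothRiemannianMetric G)
  {p : ℕ}

open scoped Bundle in
theorem continuousOn_metric_inner {H : Type*} [TopologicalSpace H] {f v w : H → G} {s : Set H}
    (hf : ContinuousOn f s) (hv : ContinuousOn v s) (hw : ContinuousOn w s) :
    ContinuousOn (fun t => (gt.inner (f t) (v t) (w t) : ℝ)) s := by
  let : Bundle.RiemannianBundle (fun x : G => TangentSpace 𝓘(ℝ, G) x) := ⟨gt.toRiemannianMetric⟩
  have : IsContinuousRiemannianBundle G (fun x : G => TangentSpace 𝓘(ℝ, G) x) :=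
    ⟨gt.inner, gt.contMDiff.continuous, fun _ _ _ => rfl⟩
  have continuousOn_section {u : H → G} (hu : ContinuousOn u s) : ContinuousOn (fun t =>
      (⟨f t, u t⟩ : Bundle.TotalSpace G (fun x : G => TangentSpace 𝓘(ℝ, G) x))) s :=
    (tangentBundleModelSpaceHomeomorph 𝓘(ℝ, G)).symm.continuous.comp_continuousOn (hf.prodMk hu)
  exact ContinuousOn.inner_bundle (F := G) (E := fun x : G => TangentSpace 𝓘(ℝ, G) x)
    (continuousOn_section hv) (continuousOn_section hw)

theorem continuousOn_riemNorm {H : Type*} [TopologicalSpace H] {f : H → G} {v : H → Fin p → G}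
    {s : Set H} (hf : ContinuousOn f s) (hv : ∀ i, ContinuousOn (fun t => v t i) s) :
    ContinuousOn (fun t => riemNorm gt (f t) (v t)) s := by
  have gram_continuousOn : ContinuousOn (fun t => Matrix.of fun i j : Fin p =>
      (gt.inner (f t) (v t i) (v t j) : ℝ)) s :=
    continuousOn_pi.2 fun i => continuousOn_pi.2 fun j =>
      continuousOn_metric_inner gt hf (hv i) (hv j)
  exact Real.continuous_sqrt.comp_continuousOn
    (continuous_id.matrix_det.comp_continuousOn gram_continuousOn)

theorem riemNorm_sum_smul (x : G) (A : Matrix (Fin p) (Fin p) ℝ) (v : Fin p → G) :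
    riemNorm gt x (fun i => ∑ j, A i j • v j) = |A.det| * riemNorm gt x v := by
  let g : G →L[ℝ] G →L[ℝ] ℝ := gt.inner x
  have gram_eq : (Matrix.of fun i j : Fin p => g (∑ k, A i k • v k) (∑ k, A j k • v k)) =
      A * (Matrix.of fun i j : Fin p => g (v i) (v j)) * A.transpose := by
    ext i j
    simp only [Matrix.of_apply, map_sum, map_smul, Matrix.mul_apply, Matrix.transpose_apply,
      sum_apply, smul_apply, smul_eq_mul, Finset.sum_mul, Finset.mul_sum]
    exact Finset.sum_congr rfl fun k _ => Finset.sum_congr rfl fun l _ => by ring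
  change Real.sqrt (Matrix.of fun i j : Fin p => g (∑ k, A i k • v k) (∑ k, A j k • v k)).det =
    |A.det| * Real.sqrt (Matrix.of fun i j : Fin p => g (v i) (v j)).det
  rw [gram_eq, Matrix.det_mul, Matrix.det_mul, Matrix.det_transpose, mul_right_comm, ← sq,
    Real.sqrt_mul (sq_nonneg _), Real.sqrt_sq_eq_abs]

theorem riemNorm_pos (x : G) {v : Fin p → G} (hv : LinearIndependent ℝ v) :
    0 < riemNorm gt x v := by
  let g : G →L[ℝ] G →L[ℝ] ℝ := gt.inner x
  have g_symm (u w : G) : g u w = g w u := gt.symm x u w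
  have g_pos (u : G) (hu : u ≠ 0) : 0 < g u u := gt.pos x u hu
  refine Real.sqrt_pos.2 (Matrix.PosDef.det_pos ?_)
  change (Matrix.of fun i j : Fin p => g (v i) (v j)).PosDef
  refine Matrix.PosDef.of_dotProduct_mulVec_pos (Matrix.ext fun i j => by simp [g_symm (v i)])
    fun c hc => ?_
  have sum_ne_zero : ∑ i, c i • v i ≠ 0 := fun h =>
    hc (funext fun i => Fintype.linearIndependent_iff.1 hv c h i)
  refine (g_pos _ sum_ne_zero).trans_eq ?_
  simp only [map_sum, map_smul, sum_apply, smul_apply, smul_eq_mul, dotProduct, Matrix.mulVec,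
    Matrix.of_apply, Pi.star_apply, star_trivial, Finset.mul_sum]
  rw [Finset.sum_comm]
  exact Finset.sum_congr rfl fun k _ => Finset.sum_congr rfl fun l _ => by ring

theorem riemNorm_comp (x : G) (L : EuclideanSpace ℝ (Fin p) →L[ℝ] G)
    (T : EuclideanSpace ℝ (Fin p) →L[ℝ] EuclideanSpace ℝ (Fin p)) :
    riemNorm gt x (fun i => L (T (EuclideanSpace.single i 1))) =
      |T.det| * riemNorm gt x fun i => L (EuclideanSpace.single i 1) := by
  let e := EuclideanSpace.basisFun (Fin p) ℝ
  have det_eq : T.det = (LinearMap.toMatrix e.toBasis e.toBasis T.toLinearMap).transpose.det := by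
    rw [Matrix.det_transpose, LinearMap.det_toMatrix, ContinuousLinearMap.det]
  have L_eq (i : Fin p) : L (T (EuclideanSpace.single i 1)) =
      ∑ j, T (EuclideanSpace.single i 1) j • L (EuclideanSpace.single j 1) := by
    conv_lhs => rw [← e.sum_repr (T (EuclideanSpace.single i 1))]
    simp [e]
  rw [det_eq, ← riemNorm_sum_smul]
  simp [L_eq, LinearMap.toMatrix_apply, e]

end Riemannian

/-! ### Directions of approach to the image of a differentiable map -/

section Directions

variable {E F : Type*} [NormedAddCommGroup E] [NormedSpace ℝ E] [NormedAddCommGroup F]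
  [NormedSpace ℝ F]

theorem tendsto_inv_norm_smul_sub_sub_fderiv {f : E → F} {f' : E →L[ℝ] F} {x : E}
    (hf : HasFDerivAt f f' x) (hf' : Topology.IsInducing f') :
    Tendsto (fun y => ‖f y - f x‖⁻¹ • (f y - f x - f' (y - x))) (𝓝 x) (𝓝 0) := by
  have remainder_isLittleO := hf.isLittleO.trans_isBigO (hf.isTheta_sub hf').isBigO_symm
  refine tendsto_zero_iff_norm_tendsto_zero.2
    (remainder_isLittleO.norm_norm.tendsto_div_nhds_zero.congr fun y => ?_)
  rw [norm_smul, norm_inv, norm_norm, div_eq_inv_mul]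

theorem mem_closure_range_of_tendsto_inv_norm_smul {f : E → F} {f' : E →L[ℝ] F} {x : E}
    (hf : HasFDerivAt f f' x) (hf' : Topology.IsInducing f') {ι : Type*} {l : Filter ι}
    [l.NeBot] {t : ι → E} (ht : Tendsto t l (𝓝 x)) {v : F}
    (hv : Tendsto (fun i => ‖f (t i) - f x‖⁻¹ • (f (t i) - f x)) l (𝓝 v)) :
    v ∈ closure (range f') := by
  have linear_part_tendsto := hv.sub ((tendsto_inv_norm_smul_sub_sub_fderiv hf hf').comp ht)
  rw [sub_zero] at linear_part_tendsto
  refine mem_closure_of_tendsto linear_part_tendsto (Eventually.of_forall fun i => ?_)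
  refine ⟨‖f (t i) - f x‖⁻¹ • (t i - x), ?_⟩
  rw [Function.comp_apply, map_smul, ← smul_sub, sub_sub_cancel]

theorem tendsto_inv_norm_smul_of_hasDerivAt {c : ℝ → F} {w : F} {s₀ : ℝ} (hc : HasDerivAt c w s₀)
    (hw : w ≠ 0) :
    Tendsto (fun s => ‖c s - c s₀‖⁻¹ • (c s - c s₀)) (𝓝[>] s₀) (𝓝 (‖w‖⁻¹ • w)) := by
  have slope_tendsto : Tendsto (slope c s₀) (𝓝[>] s₀) (𝓝 w) :=
    (hasDerivAt_iff_tendsto_slope.1 hc).mono_left (nhdsWithin_mono _ fun s hs => ne_of_gt hs)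
  refine ((slope_tendsto.norm.inv₀ (norm_ne_zero_iff.2 hw)).smul slope_tendsto).congr' ?_
  filter_upwards [self_mem_nhdsWithin] with s hs
  have s_pos : 0 < s - s₀ := sub_pos.2 hs
  rw [slope, vsub_eq_sub, norm_smul, norm_inv, Real.norm_of_nonneg s_pos.le, mul_inv, inv_inv,
    smul_smul, mul_right_comm, mul_inv_cancel₀ s_pos.ne', one_mul]

end Directions

/-! ### Local parametrizations -/

namespace IsC1Param

variable {G : Type*} [NormedAddCommGroup G] [NormedSpace ℝ G] {p : ℕ} {M : Set G}
  {A : Set (EuclideanSpace ℝ (Fin p))} {Φ : EuclideanSpace ℝ (Fin p) → G}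
  {t₀ : EuclideanSpace ℝ (Fin p)} (h : IsC1Param M A Φ)
include h

theorem hasFDerivAt (ht : t₀ ∈ A) : HasFDerivAt Φ (fderiv ℝ Φ t₀) t₀ :=
  ((h.contDiffOn.contDiffAt (h.isOpen.mem_nhds ht)).differentiableAt one_ne_zero).hasFDerivAt

theorem continuousOn : ContinuousOn Φ A := h.contDiffOn.continuousOn

theorem injOn : InjOn Φ A := injOn_iff_injective.2 h.isEmbedding.injective

theorem continuousOn_fderiv : ContinuousOn (fderiv ℝ Φ) A :=
  h.contDiffOn.continuousOn_fderiv_of_isOpen h.isOpen le_rfl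

theorem image_subset : Φ '' A ⊆ M := by
  obtain ⟨U, -, hU⟩ := h.image_eq
  exact hU ▸ inter_subset_left

theorem map_nhds_eq (ht : t₀ ∈ A) : map Φ (𝓝 t₀) = 𝓝[M] (Φ t₀) := by
  obtain ⟨U, hU, image_eq⟩ := h.image_eq
  have t₀_mem_U : Φ t₀ ∈ U := (image_eq.le (mem_image_of_mem Φ ht)).2
  calc map Φ (𝓝 t₀) = map (A.domRestrict Φ) (𝓝 ⟨t₀, ht⟩) := by
        rw [← h.isOpen.nhdsWithin_eq ht, ← map_nhds_subtype_val ⟨t₀, ht⟩, map_map]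
        rfl
    _ = 𝓝[M ∩ U] (Φ t₀) := by
        rw [h.isEmbedding.isInducing.map_nhds_eq, range_domRestrict, image_eq]
        rfl
    _ = 𝓝[M] (Φ t₀) := nhdsWithin_inter_of_mem' (mem_nhdsWithin_of_mem_nhds (hU.mem_nhds t₀_mem_U))

theorem exists_image_eq {O : Set (EuclideanSpace ℝ (Fin p))} (hO : IsOpen O) (hOA : O ⊆ A) :
    ∃ U : Set G, IsOpen U ∧ Φ '' O = M ∩ U := by
  have image_mem (y : Φ '' O) : Φ '' O ∈ 𝓝[M] (y : G) := by
    obtain ⟨_, t, ht, rfl⟩ := y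
    rw [← h.map_nhds_eq (hOA ht)]
    exact image_mem_map (hO.mem_nhds ht)
  choose U U_open mem_U U_subset using fun y => mem_nhdsWithin.1 (image_mem y)
  refine ⟨⋃ y, U y, isOpen_iUnion U_open, Subset.antisymm (fun y hy => ?_) ?_⟩
  · exact ⟨h.image_subset (image_mono hOA hy), mem_iUnion.2 ⟨⟨y, hy⟩, mem_U ⟨y, hy⟩⟩⟩
  · rintro y ⟨hyM, hyU⟩
    obtain ⟨z, hz⟩ := mem_iUnion.1 hyU
    exact U_subset z ⟨hz, hyM⟩

theorem tendsto_invFunOn (ht : t₀ ∈ A) :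
    Tendsto (Function.invFunOn Φ A) (𝓝[M] (Φ t₀)) (𝓝 t₀) := by
  rw [← h.map_nhds_eq ht, tendsto_map'_iff]
  refine tendsto_id.congr' ?_
  filter_upwards [h.isOpen.mem_nhds ht] with t htA
  exact (h.injOn.leftInvOn_invFunOn htA).symm

theorem comp_symm {e : OpenPartialHomeomorph (EuclideanSpace ℝ (Fin p)) (EuclideanSpace ℝ (Fin p))}
    (he : e.source ⊆ A) (hd : DifferentiableOn ℝ e e.source)
    (hsymm : ContDiffOn ℝ 1 e.symm e.target) : IsC1Param M e.target (Φ ∘ e.symm) := by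
  have mapsTo : MapsTo e.symm e.target A := fun s hs => he (e.map_target hs)
  refine ⟨e.open_target, h.contDiffOn.comp hsymm mapsTo, fun s hs => ?_, ?_, ?_⟩
  · have symm_deriv : HasFDerivAt e.symm (fderiv ℝ e.symm s) s :=
      ((hsymm.contDiffAt (e.open_target.mem_nhds hs)).differentiableAt one_ne_zero).hasFDerivAt
    have e_deriv : HasFDerivAt e (fderiv ℝ e (e.symm s)) (e.symm s) :=
      (hd.differentiableAt (e.open_source.mem_nhds (e.map_target hs))).hasFDerivAt
    have comp_eq_id := (e_deriv.comp s symm_deriv).unique <|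
      (hasFDerivAt_id s).congr_of_eventuallyEq <|
        eventually_of_mem (e.open_target.mem_nhds hs) fun u hu => e.right_inv hu
    rw [((h.hasFDerivAt (mapsTo hs)).comp s symm_deriv).fderiv, ContinuousLinearMap.coe_comp]
    exact (h.immersion _ (mapsTo hs)).comp <|
      Function.LeftInverse.injective (g := fderiv ℝ e (e.symm s)) fun u =>
        congrArg (fun L : _ →L[ℝ] _ => L u) comp_eq_id
  · have symm_isEmbedding : Topology.IsEmbedding (e.target.domRestrict e.symm) :=
      Topology.IsEmbedding.subtypeVal.comp e.toHomeomorphSourceTarget.symm.isEmbedding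
    exact h.isEmbedding.comp <| Topology.IsEmbedding.of_comp
      (g := Subtype.val) (f := mapsTo.restrict e.symm e.target A)
      ((continuousOn_iff_continuous_domRestrict.1 e.continuousOn_symm).subtype_mk _)
      continuous_subtype_val symm_isEmbedding
  · obtain ⟨U, hU, image_eq⟩ := h.exists_image_eq e.open_source he
    exact ⟨U, hU, by rw [image_comp, e.symm_image_target_eq_source, image_eq]⟩

theorem tangentCone_subset (ht : t₀ ∈ A) : tangentCone M (Φ t₀) ⊆ range (fderiv ℝ Φ t₀) := by
  rintro _ ⟨c, v, u, -, rfl, u_mem, u_tendsto, direction_tendsto⟩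
  have fderiv_isClosedEmbedding : Topology.IsClosedEmbedding (fderiv ℝ Φ t₀) :=
    LinearMap.isClosedEmbedding_of_injective (LinearMap.ker_eq_bot.2 (h.immersion t₀ ht))
  have u_tendsto' : Tendsto u atTop (𝓝[M] (Φ t₀)) :=
    tendsto_nhdsWithin_iff.2 ⟨u_tendsto, Eventually.of_forall fun i => (u_mem i).1⟩
  have image_mem : Φ '' A ∈ 𝓝[M] (Φ t₀) :=
    h.map_nhds_eq ht ▸ image_mem_map (h.isOpen.mem_nhds ht)
  have v_mem : v ∈ closure (range (fderiv ℝ Φ t₀)) := by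
    refine mem_closure_range_of_tendsto_inv_norm_smul (h.hasFDerivAt ht)
      fderiv_isClosedEmbedding.isInducing ((h.tendsto_invFunOn ht).comp u_tendsto')
      (direction_tendsto.congr' ?_)
    filter_upwards [u_tendsto' image_mem] with i hi
    rw [Function.comp_apply, Function.invFunOn_eq hi]
  obtain ⟨a, rfl⟩ := fderiv_isClosedEmbedding.isClosed_range.closure_eq ▸ v_mem
  exact ⟨c • a, map_smul _ _ _⟩

theorem smul_fderiv_mem_tangentCone (ht : t₀ ∈ A) {a : EuclideanSpace ℝ (Fin p)} (ha : a ≠ 0)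
    {c : ℝ} (hc : 0 ≤ c) : c • fderiv ℝ Φ t₀ a ∈ tangentCone M (Φ t₀) := by
  have image_ne_zero : fderiv ℝ Φ t₀ a ≠ 0 :=
    (map_ne_zero_iff (fderiv ℝ Φ t₀) (h.immersion t₀ ht)).2 ha
  let line : ℝ → EuclideanSpace ℝ (Fin p) := fun s => t₀ + s • a
  have line_zero : line 0 = t₀ := by simp [line]
  have line_deriv : HasDerivAt line a 0 := by
    simpa [line] using ((hasDerivAt_id (0 : ℝ)).smul_const a).const_add t₀
  have curve_deriv : HasDerivAt (Φ ∘ line) (fderiv ℝ Φ t₀ a) 0 :=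
    HasFDerivAt.comp_hasDerivAt 0 (by rw [line_zero]; exact h.hasFDerivAt ht) line_deriv
  have curve_mem : ∀ᶠ s in 𝓝[>] (0 : ℝ), Φ (line s) ∈ M ∧ Φ (line s) ≠ Φ t₀ := by
    have line_mem : ∀ᶠ s in 𝓝[>] (0 : ℝ), line s ∈ A :=
      (line_deriv.continuousAt.mono_left nhdsWithin_le_nhds).eventually
        (line_zero ▸ h.isOpen.mem_nhds ht)
    filter_upwards [line_mem, self_mem_nhdsWithin] with s hsA s_pos
    refine ⟨h.image_subset (mem_image_of_mem Φ hsA), fun heq => ?_⟩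
    have smul_eq_zero : s • a = 0 := by simpa [line] using h.injOn hsA ht heq
    exact (smul_ne_zero (ne_of_gt s_pos) ha) smul_eq_zero
  obtain ⟨s, s_tendsto, hs⟩ := exists_seq_forall_of_frequently curve_mem.frequently
  have curve_zero : (Φ ∘ line) 0 = Φ t₀ := congrArg Φ line_zero
  refine ⟨c * ‖fderiv ℝ Φ t₀ a‖, ‖fderiv ℝ Φ t₀ a‖⁻¹ • fderiv ℝ Φ t₀ a, Φ ∘ line ∘ s,
    by positivity, ?_, hs, ?_, ?_⟩
  · rw [smul_smul, mul_assoc, mul_inv_cancel₀ (norm_ne_zero_iff.2 image_ne_zero), mul_one]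
  · exact curve_zero ▸ (curve_deriv.continuousAt.mono_left nhdsWithin_le_nhds).comp s_tendsto
  · exact curve_zero ▸
      (tendsto_inv_norm_smul_of_hasDerivAt curve_deriv image_ne_zero).comp s_tendsto

theorem tangentCone_eq (hp : 1 ≤ p) (ht : t₀ ∈ A) :
    tangentCone M (Φ t₀) = range (fderiv ℝ Φ t₀) := by
  refine (h.tangentCone_subset ht).antisymm ?_
  rintro _ ⟨a, rfl⟩
  rcases eq_or_ne a 0 with rfl | ha
  · have single_ne_zero : EuclideanSpace.single (⟨0, hp⟩ : Fin p) (1 : ℝ) ≠ 0 := by simp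
    simpa using h.smul_fderiv_mem_tangentCone ht single_ne_zero le_rfl
  · simpa using h.smul_fderiv_mem_tangentCone ht ha zero_le_one

end IsC1Param

/-! ### The surface measure in one parametrization -/

/-- The density `‖∂_1Φ ∧ ⋯ ∧ ∂_pΦ‖_{g̃}` of the surface measure in the parametrization `Φ`. -/
noncomputable def surfaceDensity {G : Type*} [NormedAddCommGroup G] [NormedSpace ℝ G] {p : ℕ}
    (gt : SmoothRiemannianMetric G) (Φ : EuclideanSpace ℝ (Fin p) → G)
    (t : EuclideanSpace ℝ (Fin p)) : ℝ :=
  riemNorm gt (Φ t) fun i => fderiv ℝ Φ t (EuclideanSpace.single i 1)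

namespace IsC1Param

variable {G : Type*} [NormedAddCommGroup G] [NormedSpace ℝ G] {p : ℕ} {M : Set G}
  {A A₀ : Set (EuclideanSpace ℝ (Fin p))} {Φ Φ₀ : EuclideanSpace ℝ (Fin p) → G}

theorem continuousOn_surfaceDensity (gt : SmoothRiemannianMetric G) (h : IsC1Param M A Φ) :
    ContinuousOn (surfaceDensity gt Φ) A :=
  continuousOn_riemNorm gt h.continuousOn fun _ =>
    h.continuousOn_fderiv.clm_apply continuousOn_const

theorem continuousAt_surfaceDensity (gt : SmoothRiemannianMetric G) (h : IsC1Param M A Φ)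
    {t : EuclideanSpace ℝ (Fin p)} (ht : t ∈ A) : ContinuousAt (surfaceDensity gt Φ) t :=
  (h.continuousOn_surfaceDensity gt).continuousAt (h.isOpen.mem_nhds ht)

theorem invFunOn_comp_spec (h : IsC1Param M A Φ) {U : Set G} (hU : Φ₀ '' A₀ = M ∩ U)
    {t : EuclideanSpace ℝ (Fin p)} (ht : t ∈ A ∩ Φ ⁻¹' U) :
    Function.invFunOn Φ₀ A₀ (Φ t) ∈ A₀ ∧ Φ₀ (Function.invFunOn Φ₀ A₀ (Φ t)) = Φ t := by
  have mem_image : Φ t ∈ Φ₀ '' A₀ := hU ▸ ⟨h.image_subset (mem_image_of_mem Φ ht.1), ht.2⟩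
  exact ⟨Function.invFunOn_mem mem_image, Function.invFunOn_eq mem_image⟩

theorem exists_hasFDerivAt_invFunOn_comp [FiniteDimensional ℝ G] (h : IsC1Param M A Φ)
    (h₀ : IsC1Param M A₀ Φ₀) {U : Set G} (hU : IsOpen U) (hUA : Φ₀ '' A₀ = M ∩ U)
    {t : EuclideanSpace ℝ (Fin p)} (ht : t ∈ A ∩ Φ ⁻¹' U) :
    ∃ φ', HasFDerivAt (Function.invFunOn Φ₀ A₀ ∘ Φ) φ' t ∧
      fderiv ℝ Φ t = (fderiv ℝ Φ₀ (Function.invFunOn Φ₀ A₀ (Φ t))).comp φ' := by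
  set φ := Function.invFunOn Φ₀ A₀ ∘ Φ
  obtain ⟨φt_mem, Φ₀_φt⟩ := h.invFunOn_comp_spec hUA ht
  have comp_eq : Φ₀ ∘ φ =ᶠ[𝓝 t] Φ := by
    filter_upwards [(h.continuousOn.isOpen_inter_preimage h.isOpen hU).mem_nhds ht] with s hs
    exact (h.invFunOn_comp_spec hUA hs).2
  have φ_continuousAt : ContinuousAt φ t := by
    refine (h₀.tendsto_invFunOn φt_mem).comp ?_
    rw [Φ₀_φt]
    exact h.map_nhds_eq ht.1 ▸ tendsto_map
  obtain ⟨Q, hQ⟩ := ContinuousLinearMap.HasLeftInverse.of_injective_of_finiteDimensional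
    (h₀.immersion _ φt_mem)
  have φ_hasFDerivAt : HasFDerivAt φ (Q.comp (fderiv ℝ Φ t)) t :=
    .of_comp_of_leftInverse φ_continuousAt (h₀.hasFDerivAt φt_mem) (h.hasFDerivAt ht.1) comp_eq hQ
  refine ⟨_, φ_hasFDerivAt, ?_⟩
  exact ((((h₀.hasFDerivAt φt_mem).comp t φ_hasFDerivAt).congr_of_eventuallyEq comp_eq.symm)).fderiv

variable [MeasurableSpace G] [BorelSpace G]

theorem measurableSet_inter_preimage (h : IsC1Param M A Φ) {S : Set G} (hS : MeasurableSet S) :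
    MeasurableSet (A ∩ Φ ⁻¹' S) := by
  have Φ_measurable : Measurable (A.domRestrict Φ) := h.isEmbedding.continuous.measurable
  convert h.isOpen.measurableSet.subtype_image (Φ_measurable hS) using 1
  ext t
  simp [and_comm]

theorem paramMeasure_apply (gt : SmoothRiemannianMetric G) (h : IsC1Param M A Φ) {S : Set G}
    (hS : MeasurableSet S) :
    paramMeasure gt A Φ S = ∫⁻ t in A ∩ Φ ⁻¹' S, ENNReal.ofReal (surfaceDensity gt Φ t) := by
  have A_measurable := h.isOpen.measurableSet
  have Φ_aemeasurable : AEMeasurable Φ ((volume.restrict A).withDensity fun t => ENNReal.ofReal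
      (riemNorm gt (Φ t) fun i => fderiv ℝ Φ t (EuclideanSpace.single i 1))) :=
    (h.continuousOn.aemeasurable A_measurable).mono_ac (withDensity_absolutelyContinuous _ _)
  rw [paramMeasure, Measure.map_apply_of_aemeasurable Φ_aemeasurable hS, withDensity_apply',
    Measure.restrict_restrict' A_measurable, inter_comm]
  rfl

theorem paramMeasure_restrict_le [FiniteDimensional ℝ G] (gt : SmoothRiemannianMetric G)
    (h : IsC1Param M A Φ) (h₀ : IsC1Param M A₀ Φ₀) {U : Set G} (hU : IsOpen U)
    (hUA : Φ₀ '' A₀ = M ∩ U) :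
    (paramMeasure gt A Φ).restrict U ≤ paramMeasure gt A₀ Φ₀ := by
  refine Measure.le_iff.2 fun S hS => ?_
  rw [Measure.restrict_apply hS, h.paramMeasure_apply gt (hS.inter hU.measurableSet),
    h₀.paramMeasure_apply gt hS]
  set φ := Function.invFunOn Φ₀ A₀ ∘ Φ
  choose! φ' φ_hasFDerivAt fderiv_eq using
    fun t (ht : t ∈ A ∩ Φ ⁻¹' U) => h.exists_hasFDerivAt_invFunOn_comp h₀ hU hUA ht
  have φ_spec {t} (ht : t ∈ A ∩ Φ ⁻¹' U) : φ t ∈ A₀ ∧ Φ₀ (φ t) = Φ t :=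
    h.invFunOn_comp_spec hUA ht
  set T := A ∩ Φ ⁻¹' (S ∩ U)
  have T_subset : T ⊆ A ∩ Φ ⁻¹' U := fun t ht => ⟨ht.1, ht.2.2⟩
  have T_measurable : MeasurableSet T := h.measurableSet_inter_preimage (hS.inter hU.measurableSet)
  have φ_injOn : InjOn φ T := fun s hs t ht hst => h.injOn hs.1 ht.1 <| by
    rw [← (φ_spec (T_subset hs)).2, ← (φ_spec (T_subset ht)).2, hst]
  calc ∫⁻ t in T, ENNReal.ofReal (surfaceDensity gt Φ t)
      = ∫⁻ t in T, ENNReal.ofReal |(φ' t).det| * ENNReal.ofReal (surfaceDensity gt Φ₀ (φ t)) := by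
        refine setLIntegral_congr_fun T_measurable fun t ht => ?_
        rw [← ENNReal.ofReal_mul (abs_nonneg _), surfaceDensity, fderiv_eq t (T_subset ht),
          surfaceDensity, (φ_spec (T_subset ht)).2]
        exact congrArg ENNReal.ofReal (riemNorm_comp gt _ _ _)
    _ = ∫⁻ s in φ '' T, ENNReal.ofReal (surfaceDensity gt Φ₀ s) :=
        (lintegral_image_eq_lintegral_abs_det_fderiv_mul volume T_measurable
          (fun t ht => (φ_hasFDerivAt t (T_subset ht)).hasFDerivWithinAt) φ_injOn
          fun s => ENNReal.ofReal (surfaceDensity gt Φ₀ s)).symm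
    _ ≤ ∫⁻ s in A₀ ∩ Φ₀ ⁻¹' S, ENNReal.ofReal (surfaceDensity gt Φ₀ s) := by
        refine lintegral_mono_set (image_subset_iff.2 fun t ht => ?_)
        obtain ⟨φt_mem, Φ₀_φt⟩ := φ_spec (T_subset ht)
        exact ⟨φt_mem, mem_preimage.2 (Φ₀_φt ▸ ht.2.1)⟩

theorem surfaceMeasure_apply [FiniteDimensional ℝ G] (gt : SmoothRiemannianMetric G)
    (h₀ : IsC1Param M A₀ Φ₀) {U : Set G} (hU : IsOpen U) (hUA : Φ₀ '' A₀ = M ∩ U)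
    {S : Set G} (hS : MeasurableSet S) (hSU : S ⊆ U) :
    surfaceMeasure gt p M S = paramMeasure gt A₀ Φ₀ S := by
  have paramMeasure_le {A Φ} (h : IsC1Param M A Φ) :
      paramMeasure gt A Φ ≤ surfaceMeasure gt p M :=
    le_iSup_of_le A (le_iSup_of_le Φ (le_iSup_of_le h le_rfl))
  refine le_antisymm ?_ (paramMeasure_le h₀ S)
  have surfaceMeasure_le : surfaceMeasure gt p M ≤
      paramMeasure gt A₀ Φ₀ + (surfaceMeasure gt p M).restrict Uᶜ := by
    conv_lhs => unfold surfaceMeasure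
    refine iSup_le fun A => iSup_le fun Φ => iSup_le fun h => ?_
    rw [← Measure.restrict_add_restrict_compl (μ := paramMeasure gt A Φ) hU.measurableSet]
    exact add_le_add (h.paramMeasure_restrict_le gt h₀ hU hUA)
      (Measure.restrict_mono subset_rfl (paramMeasure_le h))
  refine (surfaceMeasure_le S).trans_eq ?_
  rw [Measure.add_apply, Measure.restrict_apply hS,
    (disjoint_compl_right_iff_subset.2 hSU).inter_eq, measure_empty, add_zero]

end IsC1Param

/-! ### Graph parametrizations and their rescalings -/

theorem exists_openPartialHomeomorph_of_bijective_fderiv {E : Type*} [NormedAddCommGroup E]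
    [NormedSpace ℝ E] [FiniteDimensional ℝ E] {f : E → E} {A : Set E} {t₀ : E} (hA : IsOpen A)
    (hf : ContDiffOn ℝ 1 f A) (ht₀ : t₀ ∈ A) (hbij : Function.Bijective (fderiv ℝ f t₀)) :
    ∃ e : OpenPartialHomeomorph E E, t₀ ∈ e.source ∧ e.source ⊆ A ∧ ⇑e = f ∧
      ContDiffOn ℝ 1 e.symm e.target := by
  have f_contDiffAt {t : E} (ht : t ∈ A) : ContDiffAt ℝ 1 f t := hf.contDiffAt (hA.mem_nhds ht)
  have f_hasFDerivAt {t : E} (ht : t ∈ A) : HasFDerivAt f (fderiv ℝ f t) t :=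
    ((f_contDiffAt ht).differentiableAt one_ne_zero).hasFDerivAt
  let f' : E ≃L[ℝ] E :=
    (LinearEquiv.ofBijective (fderiv ℝ f t₀).toLinearMap hbij).toContinuousLinearEquiv
  have f'_hasFDerivAt : HasFDerivAt f (f' : E →L[ℝ] E) t₀ := f_hasFDerivAt ht₀
  let N : Set E := A ∩ fderiv ℝ f ⁻¹' range ((↑) : (E ≃L[ℝ] E) → E →L[ℝ] E)
  have N_open : IsOpen N :=
    (hf.continuousOn_fderiv_of_isOpen hA le_rfl).isOpen_inter_preimage hA
      ContinuousLinearEquiv.isOpen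
  let e := ((f_contDiffAt ht₀).toOpenPartialHomeomorph f f'_hasFDerivAt one_ne_zero).restrOpen
    N N_open
  have source_subset : e.source ⊆ N := inter_subset_right
  refine ⟨e, ⟨?_, ht₀, f', rfl⟩, source_subset.trans inter_subset_left, rfl, fun s hs => ?_⟩
  · exact (f_contDiffAt ht₀).mem_toOpenPartialHomeomorph_source f'_hasFDerivAt one_ne_zero
  · obtain ⟨mem_A, g, hg⟩ := source_subset (e.map_target hs)
    exact (e.contDiffAt_symm hs (hg ▸ f_hasFDerivAt mem_A) (f_contDiffAt mem_A)).contDiffWithinAt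

theorem IsC1Param.hasFDerivAt_inv_mul {G : Type*} [NormedAddCommGroup G] [InnerProductSpace ℝ G]
    [FiniteDimensional ℝ G] [StratifiedGroup G] {p : ℕ} {M : Set G}
    {A : Set (EuclideanSpace ℝ (Fin p))} {Φ : EuclideanSpace ℝ (Fin p) → G}
    {t₀ : EuclideanSpace ℝ (Fin p)} (h : IsC1Param M A Φ) (ht₀ : t₀ ∈ A) :
    HasFDerivAt (fun t => (Φ t₀)⁻¹ * Φ t)
      ((fderiv ℝ (fun y : G => (Φ t₀)⁻¹ * y) (Φ t₀)).comp (fderiv ℝ Φ t₀)) t₀ :=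
  (hasFDerivAt_mul_left (Φ t₀)⁻¹ (Φ t₀)).comp t₀ (h.hasFDerivAt ht₀)

namespace GradedBasis

variable {G : Type*} [NormedAddCommGroup G] [InnerProductSpace ℝ G] [StratifiedGroup G] {n p : ℕ}
  (b : GradedBasis G n)

section LinearCoordinates

variable {α : Set.powersetCard (Fin n) p} {ζ : Fin p → G} {L : EuclideanSpace ℝ (Fin p) →L[ℝ] G}

theorem bijective_coords_comp (hζ : ∀ i j, b.X.repr (ζ i) (enum α j) = if i = j then 1 else 0)
    (hL : range L = Submodule.span ℝ (range ζ)) :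
    Function.Bijective ((b.coords α).comp L) := by
  have surjective : Function.Surjective ((b.coords α).comp L) := fun s => by
    obtain ⟨t, ht⟩ : linParam ζ s ∈ range L := hL ▸ range_linParam ζ ▸ mem_range_self s
    exact ⟨t, by rw [ContinuousLinearMap.comp_apply, ht, b.coords_linParam hζ]⟩
  exact ⟨LinearMap.injective_iff_surjective.2 surjective, surjective⟩

theorem eq_linParam_of_coords_comp
    (hζ : ∀ i j, b.X.repr (ζ i) (enum α j) = if i = j then 1 else 0)
    (hL : range L ⊆ Submodule.span ℝ (range ζ)) (hc : ∀ s, b.coords α (L s) = s) :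
    L = linParam ζ := by
  ext1 s
  obtain ⟨c, hcs⟩ : L s ∈ range (linParam ζ) := range_linParam ζ ▸ hL (mem_range_self s)
  rw [← hcs, ← b.coords_linParam hζ c, hcs, hc]

end LinearCoordinates

theorem tendsto_zero_of_repr {H : Type*} {l : Filter H} {f : H → G}
    (hf : ∀ k, Tendsto (fun q => b.X.repr (f q) k) l (𝓝 0)) : Tendsto f l (𝓝 0) := by
  have sum_tendsto : Tendsto (fun q => ∑ k, b.X.repr (f q) k • b.X k) l
      (𝓝 (∑ k, (0 : ℝ) • b.X k)) :=
    tendsto_finsetSum _ fun k _ => (hf k).smul_const _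
  simpa only [b.X.sum_repr, zero_smul, Finset.sum_const_zero] using sum_tendsto

/-- A parametrization `Ψ` of `M` around `x` that writes `x⁻¹ M` as a graph over the coordinates of
index in `α`, with tangent frame `w` at the origin. -/
structure IsGraphParam (M : Set G) (x : G) (α : Set.powersetCard (Fin n) p) (w : Fin p → G)
    (B : Set (EuclideanSpace ℝ (Fin p))) (Ψ : EuclideanSpace ℝ (Fin p) → G) : Prop where
  param : IsC1Param M B Ψ
  adapted : b.IsAdaptedFrame α w
  zero_mem : 0 ∈ B
  map_zero : Ψ 0 = x
  coords_eq : ∀ s ∈ B, b.coords α (x⁻¹ * Ψ s) = s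
  hasFDerivAt : HasFDerivAt (fun s => x⁻¹ * Ψ s) (linParam w) 0

variable [FiniteDimensional ℝ G]

theorem exists_isGraphParam {M : Set G} {A : Set (EuclideanSpace ℝ (Fin p))}
    {Φ : EuclideanSpace ℝ (Fin p) → G} (h : IsC1Param M A Φ) {t₀ : EuclideanSpace ℝ (Fin p)}
    (ht₀ : t₀ ∈ A) {α : Set.powersetCard (Fin n) p} {w : Fin p → G} (hw : b.IsAdaptedFrame α w)
    (hrange : range ((fderiv ℝ (fun y : G => (Φ t₀)⁻¹ * y) (Φ t₀)).comp (fderiv ℝ Φ t₀)) =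
      Submodule.span ℝ (range w)) :
    ∃ B Ψ, b.IsGraphParam M (Φ t₀) α w B Ψ := by
  set x := Φ t₀ with x_def
  set L := (fderiv ℝ (fun y : G => x⁻¹ * y) x).comp (fderiv ℝ Φ t₀)
  let f : EuclideanSpace ℝ (Fin p) → EuclideanSpace ℝ (Fin p) := fun t => b.coords α (x⁻¹ * Φ t)
  have f_contDiffOn : ContDiffOn ℝ 1 f A :=
    (b.coords α).contDiff.comp_contDiffOn ((contDiff_mul_left x⁻¹).comp_contDiffOn h.contDiffOn)
  have f_hasFDerivAt : HasFDerivAt f ((b.coords α).comp L) t₀ :=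
    (b.coords α).hasFDerivAt.comp t₀ (h.hasFDerivAt_inv_mul ht₀)
  obtain ⟨e, t₀_mem, source_subset, e_eq, symm_contDiffOn⟩ :=
    exists_openPartialHomeomorph_of_bijective_fderiv h.isOpen f_contDiffOn ht₀
      (f_hasFDerivAt.fderiv ▸ b.bijective_coords_comp hw.repr_enum hrange)
  have e_t₀ : e t₀ = 0 := by simp only [e_eq, f, ← x_def, inv_mul_self_eq_zero, _root_.map_zero]
  have zero_mem : 0 ∈ e.target := e_t₀ ▸ e.map_source t₀_mem
  have symm_zero : e.symm 0 = t₀ := e_t₀ ▸ e.left_inv t₀_mem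
  have coords_eq (s) (hs : s ∈ e.target) : b.coords α (x⁻¹ * (Φ ∘ e.symm) s) = s :=
    (congrFun e_eq (e.symm s)).symm.trans (e.right_inv hs)
  have graph_hasFDerivAt :
      HasFDerivAt (fun s => x⁻¹ * (Φ ∘ e.symm) s) (L.comp (fderiv ℝ e.symm 0)) 0 := by
    refine HasFDerivAt.comp (g := fun t => x⁻¹ * Φ t) 0 ?_
      ((symm_contDiffOn.contDiffAt (e.open_target.mem_nhds zero_mem)).differentiableAt
        one_ne_zero).hasFDerivAt
    exact symm_zero ▸ h.hasFDerivAt_inv_mul ht₀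
  have coords_comp : (b.coords α).comp (L.comp (fderiv ℝ e.symm 0)) = .id ℝ _ :=
    ((b.coords α).hasFDerivAt.comp 0 graph_hasFDerivAt).unique <|
      (hasFDerivAt_id _).congr_of_eventuallyEq
        (eventually_of_mem (e.open_target.mem_nhds zero_mem) coords_eq)
  rw [b.eq_linParam_of_coords_comp hw.repr_enum
    ((range_comp_subset_range (fderiv ℝ e.symm 0) L).trans hrange.le)
    fun s => congrArg (fun F : _ →L[ℝ] _ => F s) coords_comp] at graph_hasFDerivAt
  exact ⟨e.target, Φ ∘ e.symm, h.comp_symm source_subset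
    (e_eq ▸ (f_contDiffOn.mono source_subset).differentiableOn one_ne_zero) symm_contDiffOn,
    hw, zero_mem, congrArg Φ symm_zero, coords_eq, graph_hasFDerivAt⟩

/-- The rescaled graph `s ↦ δ_{1/r} (x⁻¹ Ψ (δ_r s))`. -/
noncomputable def rescaled (α : Set.powersetCard (Fin n) p) (x : G)
    (Ψ : EuclideanSpace ℝ (Fin p) → G) (r : ℝ) (s : EuclideanSpace ℝ (Fin p)) : G :=
  dilation (1 / r) (x⁻¹ * Ψ (b.stretch α r s))

include b in
theorem eventually_dilation_mem {U : Set G} (hU : U ∈ 𝓝 0) (R : ℝ) :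
    ∀ᶠ r in 𝓝[>] (0 : ℝ), ∀ z : G, ‖z‖ ≤ R → dilation r z ∈ U := by
  have preimage_mem : b.X.repr.symm ⁻¹' U ∈ 𝓝 0 :=
    b.X.repr.symm.continuous.continuousAt.preimage_mem_nhds (by rwa [_root_.map_zero])
  filter_upwards [eventually_weightedDilation_mem b.deg_pos preimage_mem R] with r hr z hz
  have dilation_eq : dilation r z = b.X.repr.symm (weightedDilation b.deg r (b.X.repr z)) := by
    rw [LinearIsometryEquiv.eq_symm_apply]
    ext k
    rw [b.repr_dilation, weightedDilation_apply]
  exact dilation_eq ▸ hr _ (by rwa [b.X.repr.norm_map])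

section Rescaling

variable {α : Set.powersetCard (Fin n) p} {k : Fin n} (hk : ∀ i, b.deg k ≤ b.deg (enum α i))
include hk

theorem tendsto_repr_dilation_of_isLittleO {g : EuclideanSpace ℝ (Fin p) → G}
    (hg : g =o[𝓝 0] (id : EuclideanSpace ℝ (Fin p) → _)) (R : ℝ) :
    Tendsto (fun q : ℝ × EuclideanSpace ℝ (Fin p) =>
      b.X.repr (dilation (1 / q.1) (g (b.stretch α q.1 q.2))) k)
      (𝓝[>] 0 ×ˢ 𝓟 {s | ‖s‖ ≤ R}) (𝓝 0) := by
  have comp_isLittleO := (hg.comp_tendsto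
    (tendsto_weightedDilation (fun i => b.deg_pos (enum α i)) R)).trans_isBigO
      (isBigO_weightedDilation hk R)
  have repr_isLittleO : (fun q : ℝ × EuclideanSpace ℝ (Fin p) =>
      b.X.repr (g (b.stretch α q.1 q.2)) k) =o[𝓝[>] 0 ×ˢ 𝓟 {s | ‖s‖ ≤ R}]
      fun q => q.1 ^ b.deg k :=
    (Asymptotics.isBigO_of_le _ fun q => (PiLp.norm_apply_le _ k).trans_eq
      (b.X.repr.norm_map _)).trans_isLittleO comp_isLittleO
  refine repr_isLittleO.tendsto_div_nhds_zero.congr fun q => ?_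
  rw [b.repr_dilation, one_div, inv_pow, div_eq_inv_mul]

theorem repr_dilation_linParam_stretch (w : Fin p → G) {r : ℝ} (hr : r ≠ 0)
    (s : EuclideanSpace ℝ (Fin p)) :
    b.X.repr (dilation (1 / r) (linParam w (b.stretch α r s))) k =
      ∑ i, s i * (b.X.repr (w i) k * r ^ (b.deg (enum α i) - b.deg k)) := by
  rw [b.repr_dilation, linParam_apply, map_sum, WithLp.ofLp_sum, Finset.sum_apply, Finset.mul_sum]
  refine Finset.sum_congr rfl fun i _ => ?_
  rw [map_smul, PiLp.smul_apply, smul_eq_mul, weightedDilation_apply,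
    ← pow_mul_pow_sub r (hk i), one_div, inv_pow]
  field_simp

/- The coordinate `k` of `w i` is multiplied by `r ^ (deg (α i) - deg k)`, so that only the top part
survives in the limit. -/
theorem tendsto_repr_dilation_linParam_stretch (w : Fin p → G) (R : ℝ) :
    Tendsto (fun q : ℝ × EuclideanSpace ℝ (Fin p) =>
      b.X.repr (dilation (1 / q.1) (linParam w (b.stretch α q.1 q.2))) k -
        b.X.repr (linParam (b.topPart α w) q.2) k)
      (𝓝[>] 0 ×ˢ 𝓟 {s | ‖s‖ ≤ R}) (𝓝 0) := by
  set F : Filter (ℝ × EuclideanSpace ℝ (Fin p)) := 𝓝[>] 0 ×ˢ 𝓟 {s | ‖s‖ ≤ R}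
  have coefficient_tendsto (i : Fin p) : Tendsto (fun q : ℝ × EuclideanSpace ℝ (Fin p) =>
      b.X.repr (w i) k * q.1 ^ (b.deg (enum α i) - b.deg k) - b.X.repr (b.topPart α w i) k)
      F (𝓝 0) := by
    have fst_tendsto : Tendsto (fun q : ℝ × EuclideanSpace ℝ (Fin p) => q.1) F (𝓝 0) :=
      tendsto_fst.mono_right nhdsWithin_le_nhds
    convert ((fst_tendsto.pow (b.deg (enum α i) - b.deg k)).const_mul
      (b.X.repr (w i) k)).sub_const (b.X.repr (b.topPart α w i) k) using 2
    rw [repr_topPart]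
    split_ifs with hd
    · simp [hd]
    · have := hk i
      simp [show b.deg (enum α i) - b.deg k ≠ 0 by omega]
  have sum_tendsto : Tendsto (fun q : ℝ × EuclideanSpace ℝ (Fin p) => ∑ i, q.2 i *
      (b.X.repr (w i) k * q.1 ^ (b.deg (enum α i) - b.deg k) - b.X.repr (b.topPart α w i) k))
      F (𝓝 (∑ _i : Fin p, 0)) := by
    refine tendsto_finsetSum _ fun i _ => bdd_le_mul_tendsto_zero' R ?_ (coefficient_tendsto i)
    filter_upwards [prod_mem_prod univ_mem (mem_principal_self _)] with q hq
    exact (PiLp.norm_apply_le _ i).trans hq.2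
  rw [Finset.sum_const_zero] at sum_tendsto
  refine sum_tendsto.congr' ?_
  filter_upwards [prod_mem_prod self_mem_nhdsWithin univ_mem] with q hq
  rw [b.repr_dilation_linParam_stretch hk w (ne_of_gt hq.1), linParam_apply, map_sum,
    WithLp.ofLp_sum, Finset.sum_apply, ← Finset.sum_sub_distrib]
  simp only [map_smul, PiLp.smul_apply, smul_eq_mul, mul_sub]

end Rescaling

namespace IsGraphParam

variable {b} {M : Set G} {x : G} {α : Set.powersetCard (Fin n) p} {w : Fin p → G}
  {B : Set (EuclideanSpace ℝ (Fin p))} {Ψ : EuclideanSpace ℝ (Fin p) → G}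
  (h : b.IsGraphParam M x α w B Ψ)
include h

omit [FiniteDimensional ℝ G] in
theorem eventually_stretch_mem (R : ℝ) :
    ∀ᶠ r in 𝓝[>] (0 : ℝ), ∀ s : EuclideanSpace ℝ (Fin p), ‖s‖ ≤ R → b.stretch α r s ∈ B :=
  eventually_weightedDilation_mem (fun i => b.deg_pos (enum α i))
    (h.param.isOpen.mem_nhds h.zero_mem) R

theorem coords_rescaled {r : ℝ} (hr : r ≠ 0) {s : EuclideanSpace ℝ (Fin p)}
    (hs : b.stretch α r s ∈ B) : b.coords α (b.rescaled α x Ψ r s) = s := by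
  rw [rescaled, b.coords_dilation, h.coords_eq _ hs, stretch, stretch,
    weightedDilation_one_div_weightedDilation _ hr]

theorem rescaled_mem_blowUp {r : ℝ} {s : EuclideanSpace ℝ (Fin p)}
    (hs : b.stretch α r s ∈ B) : b.rescaled α x Ψ r s ∈ blowUp M x r :=
  ⟨Ψ (b.stretch α r s), h.param.image_subset (mem_image_of_mem Ψ hs), rfl⟩

theorem eventually_rescaled_coords (R : ℝ) :
    ∀ᶠ r in 𝓝[>] (0 : ℝ), ∀ z : G, ‖z‖ ≤ R → z ∈ blowUp M x r →
      b.rescaled α x Ψ r (b.coords α z) = z := by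
  obtain ⟨U, U_open, image_eq⟩ := h.param.image_eq
  have x_mem : x ∈ U := (image_eq.le ⟨0, h.zero_mem, h.map_zero⟩).2
  have preimage_mem : (fun z : G => x * z) ⁻¹' U ∈ 𝓝 0 := by
    refine (contDiff_mul_left (m := 0) x).continuous.continuousAt.preimage_mem_nhds ?_
    rw [mul_zero_eq_self]
    exact U_open.mem_nhds x_mem
  filter_upwards [b.eventually_dilation_mem preimage_mem R, self_mem_nhdsWithin] with r hr r_pos
  rintro z hz ⟨y, hyM, rfl⟩
  set z := dilation (1 / r) (x⁻¹ * y)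
  have dilation_z : dilation r z = x⁻¹ * y := dilation_dilation_one_div (ne_of_gt r_pos) _
  have y_mem : y ∈ U := by
    simpa only [mem_preimage, dilation_z, mul_inv_cancel_left] using hr z hz
  obtain ⟨s, hs, rfl⟩ : y ∈ Ψ '' B := image_eq ▸ ⟨hyM, y_mem⟩
  have stretch_coords : b.stretch α r (b.coords α z) = s := by
    rw [← b.coords_dilation, dilation_z, h.coords_eq s hs]
  rw [rescaled, stretch_coords]

omit [FiniteDimensional ℝ G] in
theorem isLittleO_sub_linParam :
    (fun s => x⁻¹ * Ψ s - linParam w s) =o[𝓝 0] (id : EuclideanSpace ℝ (Fin p) → _) := by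
  have remainder_isLittleO := h.hasFDerivAt.isLittleO
  simp only [h.map_zero, inv_mul_self_eq_zero, sub_zero] at remainder_isLittleO
  exact remainder_isLittleO

theorem tendsto_rescaled (R : ℝ) :
    Tendsto (fun q : ℝ × EuclideanSpace ℝ (Fin p) =>
      b.rescaled α x Ψ q.1 q.2 - linParam (b.topPart α w) q.2)
      (𝓝[>] 0 ×ˢ 𝓟 {s | ‖s‖ ≤ R}) (𝓝 0) := by
  refine b.tendsto_zero_of_repr fun k => ?_
  by_cases hkα : k ∈ (α : Finset (Fin n))
  · obtain ⟨j, rfl⟩ := exists_enum_eq_iff.2 hkα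
    have stretch_mem : ∀ᶠ q : ℝ × EuclideanSpace ℝ (Fin p) in 𝓝[>] 0 ×ˢ 𝓟 {s | ‖s‖ ≤ R},
        b.stretch α q.1 q.2 ∈ B :=
      eventually_prod_principal_iff.2 (h.eventually_stretch_mem R)
    refine tendsto_const_nhds.congr' ?_
    filter_upwards [stretch_mem, prod_mem_prod self_mem_nhdsWithin univ_mem] with q hqB hq
    rw [← b.coords_apply, map_sub, h.coords_rescaled (ne_of_gt hq.1) hqB,
      h.adapted.coords_linParam_topPart, sub_self, PiLp.zero_apply]
  · have hk := b.deg_le_of_multiDeg_eq h.adapted.multiDeg_eq hkα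
    have sum_tendsto := (b.tendsto_repr_dilation_of_isLittleO hk h.isLittleO_sub_linParam R).add
      (b.tendsto_repr_dilation_linParam_stretch hk w R)
    rw [add_zero] at sum_tendsto
    refine sum_tendsto.congr fun q => ?_
    simp only [rescaled, ← dilationLinear_apply, map_sub, PiLp.sub_apply]
    ring

theorem eventually_norm_rescaled_sub_lt (R : ℝ) {ε : ℝ} (hε : 0 < ε) :
    ∀ᶠ r in 𝓝[>] (0 : ℝ), ∀ s : EuclideanSpace ℝ (Fin p), ‖s‖ ≤ R →
      ‖b.rescaled α x Ψ r s - linParam (b.topPart α w) s‖ < ε :=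
  eventually_prod_principal_iff.1
    ((tendsto_zero_iff_norm_tendsto_zero.1 (h.tendsto_rescaled R)).eventually_lt_const hε)

theorem continuousOn_rescaled (r : ℝ) :
    ContinuousOn (b.rescaled α x Ψ r) {s | b.stretch α r s ∈ B} := by
  have dilation_mul_continuous : Continuous fun z : G => dilation (1 / r) (x⁻¹ * z) :=
    (continuous_dilation_right (1 / r)).comp (contDiff_mul_left (m := 0) x⁻¹).continuous
  exact dilation_mul_continuous.comp_continuousOn
    (h.param.continuousOn.comp (b.stretch α r).continuous.continuousOn fun _ hs => hs)

end IsGraphParam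

end GradedBasis

/-! ### Convergence of the blow-ups -/

namespace HomogeneousDistance

variable {G : Type*} [NormedAddCommGroup G] [InnerProductSpace ℝ G] [FiniteDimensional ℝ G]
  [StratifiedGroup G] (ρ : HomogeneousDistance G)

theorem exists_finite_net {K S : Set G} (hK : IsCompact K) (hKS : K ⊆ closure S) {ε : ℝ}
    (hε : 0 < ε) : ∃ I ⊆ S, I.Finite ∧ ∀ y ∈ K, ∃ z ∈ I, ρ.d y z < ε := by
  obtain ⟨I, I_subset, I_finite, covers⟩ := hK.elim_finite_subcover_image (b := S)
    (c := fun z => ρ.ball z ε) (fun z _ => ρ.isOpen_ball z ε) fun y hy => by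
      obtain ⟨z, z_mem_ball, z_mem⟩ := mem_closure_iff.1 (hKS hy) _ (ρ.isOpen_ball y ε)
        (ρ.mem_ball_self y hε)
      exact mem_iUnion₂.2 ⟨z, z_mem, (ρ.symm z y).trans_lt z_mem_ball⟩
  refine ⟨I, I_subset, I_finite, fun y hy => ?_⟩
  obtain ⟨z, z_mem, y_mem_ball⟩ := mem_iUnion₂.1 (covers hy)
  exact ⟨z, z_mem, (ρ.symm y z).trans_lt y_mem_ball⟩

theorem exists_pos_forall_exists_d_lt {F P : Set G} (hF : IsCompact F) {f : G → ℝ}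
    (hf : ContinuousOn f F) (hpos : ∀ z ∈ F, z ∉ P → 0 < f z) {ε : ℝ} (hε : 0 < ε) :
    ∃ c > 0, ∀ z ∈ F, f z < c → ∃ y ∈ F ∩ P, ρ.d z y < ε := by
  let V : Set G := ⋃ y ∈ F ∩ P, ρ.ball y ε
  have V_open : IsOpen V := isOpen_biUnion fun y _ => ρ.isOpen_ball y ε
  obtain ⟨c, c_pos, le_f⟩ := (hF.diff V_open).exists_forall_le' (hf.mono sdiff_subset)
    fun z hz => hpos z hz.1 fun hzP =>
      hz.2 (mem_iUnion₂.2 ⟨z, ⟨hz.1, hzP⟩, ρ.mem_ball_self z hε⟩)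
  refine ⟨c, c_pos, fun z hz f_lt => ?_⟩
  have z_mem : z ∈ V := by
    by_contra z_notMem
    exact f_lt.not_ge (le_f z ⟨hz, z_notMem⟩)
  obtain ⟨y, hy, z_mem_ball⟩ := mem_iUnion₂.1 z_mem
  exact ⟨y, hy, (ρ.symm z y).trans_lt z_mem_ball⟩

theorem hausdorffEDist_le {S T : Set G} {ε : ℝ} (hST : ∀ z ∈ S, ∃ w ∈ T, ρ.d z w ≤ ε)
    (hTS : ∀ w ∈ T, ∃ z ∈ S, ρ.d w z ≤ ε) : ρ.hausdorffEDist S T ≤ ENNReal.ofReal ε := by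
  have edist_le {z w : G} (h : ρ.d z w ≤ ε) :
      @edist G ρ.metricSpace.toPseudoMetricSpace.toEDist z w ≤ ENNReal.ofReal ε :=
    (@edist_dist G ρ.metricSpace.toPseudoMetricSpace z w).trans_le (ENNReal.ofReal_le_ofReal h)
  exact @Metric.hausdorffEDist_le_of_mem_edist G ρ.metricSpace.toPseudoEMetricSpace S T _
    (fun z hz => (hST z hz).imp fun _ hw => hw.imp_right edist_le)
    fun w hw => (hTS w hw).imp fun _ hz => hz.imp_right edist_le

theorem tendsto_hausdorffEDist_zero {ι : Type*} {l : Filter ι} {S : ι → Set G} {T : Set G}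
    (hST : ∀ ε > 0, ∀ᶠ i in l, ∀ z ∈ S i, ∃ w ∈ T, ρ.d z w < ε)
    (hTS : ∀ ε > 0, ∀ᶠ i in l, ∀ w ∈ T, ∃ z ∈ S i, ρ.d w z < ε) :
    Tendsto (fun i => ρ.hausdorffEDist (S i) T) l (𝓝 0) := by
  refine ENNReal.tendsto_nhds_zero.2 fun ε hε => ?_
  obtain ⟨c, c_pos, c_lt⟩ := ENNReal.lt_iff_exists_nnreal_btwn.1 hε
  have c_pos : (0 : ℝ) < c := by exact_mod_cast c_pos
  filter_upwards [hST c c_pos, hTS c c_pos] with i hi hi'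
  refine (ρ.hausdorffEDist_le (ε := c) (fun z hz => ?_) fun w hw => ?_).trans
    (ENNReal.ofReal_coe_nnreal.trans_le c_lt.le)
  · exact (hi z hz).imp fun _ hw => hw.imp_right le_of_lt
  · exact (hi' w hw).imp fun _ hz => hz.imp_right le_of_lt

end HomogeneousDistance

namespace GradedBasis

theorem exists_norm_le_and_norm_coords_le {G : Type*} [NormedAddCommGroup G]
    [InnerProductSpace ℝ G] [StratifiedGroup G] {n p : ℕ} (b : GradedBasis G n)
    (α : Set.powersetCard (Fin n) p) {F : Set G} (hF : IsCompact F) :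
    ∃ R, ∀ z ∈ F, ‖z‖ ≤ R ∧ ‖b.coords α z‖ ≤ R := by
  obtain ⟨R, hR⟩ := hF.exists_bound_of_continuousOn (f := fun z => (z, b.coords α z))
    (by fun_prop)
  exact ⟨R, fun z hz => norm_prod_le_iff.1 (hR z hz)⟩

namespace IsGraphParam

variable {G : Type*} [NormedAddCommGroup G] [InnerProductSpace ℝ G] [FiniteDimensional ℝ G]
  [StratifiedGroup G] {n p : ℕ} {b : GradedBasis G n} {M : Set G} {x : G}
  {α : Set.powersetCard (Fin n) p} {w : Fin p → G} {B : Set (EuclideanSpace ℝ (Fin p))}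
  {Ψ : EuclideanSpace ℝ (Fin p) → G} (h : b.IsGraphParam M x α w B Ψ) {F : Set G}
include h

theorem eventually_isCompact (hF : IsCompact F) :
    ∀ᶠ r in 𝓝[>] (0 : ℝ), IsCompact (F ∩ blowUp M x r) := by
  obtain ⟨R, hR⟩ := b.exists_norm_le_and_norm_coords_le α hF
  filter_upwards [h.eventually_rescaled_coords R, h.eventually_stretch_mem R]
    with r rescaled_coords stretch_mem
  let f : G → G := fun z => b.rescaled α x Ψ r (b.coords α z)
  have f_continuousOn : ContinuousOn f F :=
    (h.continuousOn_rescaled r).comp (b.coords α).continuous.continuousOn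
      fun z hz => stretch_mem _ (hR z hz).2
  have inter_eq : F ∩ blowUp M x r = F ∩ (fun z => f z - z) ⁻¹' {0} := by
    ext z
    refine and_congr_right fun hz => ⟨fun z_mem => ?_, fun f_sub => ?_⟩
    · exact sub_eq_zero.2 (rescaled_coords z (hR z hz).1 z_mem)
    · rw [← sub_eq_zero.1 f_sub]
      exact h.rescaled_mem_blowUp (stretch_mem _ (hR z hz).2)
  rw [inter_eq]
  exact hF.of_isClosed_subset ((f_continuousOn.sub continuousOn_id).preimage_isClosed_of_isClosed
    hF.isClosed isClosed_singleton) inter_subset_left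

theorem eventually_exists_mem_span (ρ : HomogeneousDistance G) (hF : IsCompact F) {ε : ℝ}
    (hε : 0 < ε) :
    ∀ᶠ r in 𝓝[>] (0 : ℝ), ∀ z ∈ F ∩ blowUp M x r,
      ∃ y ∈ F ∩ (Submodule.span ℝ (range (b.topPart α w)) : Set G), ρ.d z y < ε := by
  obtain ⟨R, hR⟩ := b.exists_norm_le_and_norm_coords_le α hF
  let graphDefect : G → ℝ := fun z => ‖z - linParam (b.topPart α w) (b.coords α z)‖
  have graphDefect_pos (z) (hz : z ∉ (Submodule.span ℝ (range (b.topPart α w)) : Set G)) :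
      0 < graphDefect z := by
    refine norm_pos_iff.2 (sub_ne_zero.2 fun z_eq => hz ?_)
    rw [z_eq, ← range_linParam]
    exact mem_range_self _
  obtain ⟨c, c_pos, hc⟩ := ρ.exists_pos_forall_exists_d_lt hF
    (by fun_prop : Continuous graphDefect).continuousOn (fun z _ => graphDefect_pos z) hε
  filter_upwards [h.eventually_rescaled_coords R, h.eventually_norm_rescaled_sub_lt R c_pos]
    with r rescaled_coords norm_sub_lt z hz
  have norm_sub_lt := norm_sub_lt (b.coords α z) (hR z hz.1).2
  rw [rescaled_coords z (hR z hz.1).1 hz.2] at norm_sub_lt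
  exact hc z hz.1 norm_sub_lt

theorem eventually_exists_mem_blowUp (ρ : HomogeneousDistance G) (hF : IsCompact F) {ε : ℝ}
    (hε : 0 < ε) :
    ∀ᶠ r in 𝓝[>] (0 : ℝ), ∀ y ∈ F ∩ (Submodule.span ℝ (range (b.topPart α w)) : Set G),
      ∃ z ∈ blowUp M x r, ρ.d y z < ε := by
  obtain ⟨R, hR⟩ := b.exists_norm_le_and_norm_coords_le α hF
  obtain ⟨η, η_pos, d_lt⟩ := ρ.exists_forall_d_lt_of_norm_sub_lt hF hε
  filter_upwards [h.eventually_stretch_mem R, h.eventually_norm_rescaled_sub_lt R η_pos]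
    with r stretch_mem norm_sub_lt y hy
  have linParam_coords : linParam (b.topPart α w) (b.coords α y) = y := by
    obtain ⟨s, rfl⟩ : y ∈ range (linParam (b.topPart α w)) := range_linParam (b.topPart α w) ▸ hy.2
    rw [h.adapted.coords_linParam_topPart]
  have norm_sub_lt := norm_sub_lt _ (hR y hy.1).2
  rw [linParam_coords, norm_sub_rev] at norm_sub_lt
  exact ⟨_, h.rescaled_mem_blowUp (stretch_mem _ (hR y hy.1).2), d_lt y hy.1 _ norm_sub_lt⟩

theorem eventually_rescaled_mem_of_isOpen {V : Set G} (hV : IsOpen V)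
    {s : EuclideanSpace ℝ (Fin p)} (hs : linParam (b.topPart α w) s ∈ V) :
    ∀ᶠ r in 𝓝[>] (0 : ℝ), b.rescaled α x Ψ r s ∈ V := by
  obtain ⟨η, η_pos, ball_subset⟩ := Metric.isOpen_iff.1 hV _ hs
  filter_upwards [h.eventually_norm_rescaled_sub_lt ‖s‖ η_pos] with r norm_sub_lt
  exact ball_subset (mem_ball_iff_norm.2 (norm_sub_lt s le_rfl))

theorem eventually_inter_blowUp_nonempty {V : Set G} (hV : IsOpen V)
    (hne : ((Submodule.span ℝ (range (b.topPart α w)) : Set G) ∩ V).Nonempty) :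
    ∀ᶠ r in 𝓝[>] (0 : ℝ), (blowUp M x r ∩ V).Nonempty := by
  obtain ⟨y, hy, y_mem⟩ := hne
  obtain ⟨s, rfl⟩ : y ∈ range (linParam (b.topPart α w)) := range_linParam (b.topPart α w) ▸ hy
  filter_upwards [h.eventually_rescaled_mem_of_isOpen hV y_mem, h.eventually_stretch_mem ‖s‖]
    with r rescaled_mem stretch_mem
  exact ⟨_, h.rescaled_mem_blowUp (stretch_mem s le_rfl), rescaled_mem⟩

/- Near each point of a finite `ε / 2`-net of `F ∩ span` inside `interior F`, the blow-up eventually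
has a point that still lies in `F`. -/
theorem eventually_exists_mem_inter_blowUp (ρ : HomogeneousDistance G) (hF : IsCompact F)
    (hcl : F ∩ (Submodule.span ℝ (range (b.topPart α w)) : Set G) ⊆
      closure (interior F ∩ (Submodule.span ℝ (range (b.topPart α w)) : Set G)))
    {ε : ℝ} (hε : 0 < ε) :
    ∀ᶠ r in 𝓝[>] (0 : ℝ), ∀ y ∈ F ∩ (Submodule.span ℝ (range (b.topPart α w)) : Set G),
      ∃ z ∈ F ∩ blowUp M x r, ρ.d y z < ε := by
  have inter_compact : IsCompact (F ∩ (Submodule.span ℝ (range (b.topPart α w)) : Set G)) :=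
    hF.inter_right (Submodule.closed_of_finiteDimensional _)
  obtain ⟨I, I_subset, I_finite, hI⟩ := ρ.exists_finite_net inter_compact hcl (half_pos hε)
  have near_net : ∀ y ∈ I, ∀ᶠ r in 𝓝[>] (0 : ℝ),
      (blowUp M x r ∩ (interior F ∩ ρ.ball y (ε / 2))).Nonempty := fun y hy =>
    h.eventually_inter_blowUp_nonempty (isOpen_interior.inter (ρ.isOpen_ball y _))
      ⟨y, (I_subset hy).2, (I_subset hy).1, ρ.mem_ball_self y (half_pos hε)⟩
  filter_upwards [I_finite.eventually_all.2 near_net] with r hr y hy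
  obtain ⟨y', hy', d_lt⟩ := hI y hy
  obtain ⟨z, z_mem, z_mem_interior, d_lt' : ρ.d y' z < ε / 2⟩ := hr y' hy'
  exact ⟨z, ⟨interior_subset z_mem_interior, z_mem⟩, by linarith [ρ.triangle y y' z]⟩

theorem tendsto_hausdorffEDist (ρ : HomogeneousDistance G) (hF : IsCompact F)
    (hcl : F ∩ (Submodule.span ℝ (range (b.topPart α w)) : Set G) ⊆
      closure (interior F ∩ (Submodule.span ℝ (range (b.topPart α w)) : Set G))) :
    Tendsto (fun r : ℝ => ρ.hausdorffEDist (F ∩ blowUp M x r)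
      (F ∩ (Submodule.span ℝ (range (b.topPart α w)) : Set G))) (𝓝[>] 0) (𝓝 0) :=
  ρ.tendsto_hausdorffEDist_zero (fun _ hε => h.eventually_exists_mem_span ρ hF hε)
    fun _ hε => h.eventually_exists_mem_inter_blowUp ρ hF hcl hε

end IsGraphParam

end GradedBasis

/-! ### The area formula for a linear parametrization -/

section LinearImage

variable {G : Type*} [NormedAddCommGroup G] [InnerProductSpace ℝ G] {p : ℕ}

theorem det_gram_linearIsometry_comp (i : EuclideanSpace ℝ (Fin p) →ₗᵢ[ℝ] G)
    (T : EuclideanSpace ℝ (Fin p) →L[ℝ] EuclideanSpace ℝ (Fin p)) :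
    (Matrix.of fun j k => inner ℝ (i (T (EuclideanSpace.single j 1)))
      (i (T (EuclideanSpace.single k 1)))).det = T.det ^ 2 := by
  let e := (EuclideanSpace.basisFun (Fin p) ℝ).toBasis
  let Q := LinearMap.toMatrix e e T
  have gram_eq : (Matrix.of fun j k => inner ℝ (i (T (EuclideanSpace.single j 1)))
      (i (T (EuclideanSpace.single k 1)))) = Q.transpose * Q := by
    ext j k
    simp [Q, e, LinearMap.toMatrix_apply, Matrix.mul_apply, PiLp.inner_apply, mul_comm]
  rw [gram_eq, Matrix.det_mul, Matrix.det_transpose, ← sq, LinearMap.det_toMatrix]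

theorem exists_linearIsometry_comp_eq_linParam {ζ : Fin p → G} (hζ : LinearIndependent ℝ ζ) :
    ∃ (i : EuclideanSpace ℝ (Fin p) →ₗᵢ[ℝ] G)
      (T : EuclideanSpace ℝ (Fin p) →L[ℝ] EuclideanSpace ℝ (Fin p)),
      ∀ s, i (T s) = linParam ζ s := by
  let S := Submodule.span ℝ (range ζ)
  have : FiniteDimensional ℝ S := FiniteDimensional.span_of_finite ℝ (finite_range ζ)
  have finrank_eq : Module.finrank ℝ S = p := by simpa using finrank_span_eq_card hζ
  let o : OrthonormalBasis (Fin p) ℝ S := (stdOrthonormalBasis ℝ S).reindex (finCongr finrank_eq)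
  have linParam_mem (s) : linParam ζ s ∈ S :=
    (range_linParam ζ).le (mem_range_self s)
  refine ⟨S.subtypeₗᵢ.comp o.repr.symm.toLinearIsometry,
    (o.repr.toLinearEquiv.toLinearMap ∘ₗ
      (linParam ζ).toLinearMap.codRestrict S linParam_mem).toContinuousLinearMap, fun s => ?_⟩
  simp

theorem euclideanHausdorffMeasure_linParam_image [MeasurableSpace G] [BorelSpace G]
    {ζ : Fin p → G} (hζ : LinearIndependent ℝ ζ) (V : Set (EuclideanSpace ℝ (Fin p))) :
    (Measure.euclideanHausdorffMeasure p : Measure G) (linParam ζ '' V) =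
      ENNReal.ofReal (Real.sqrt (Matrix.of fun i j => inner ℝ (ζ i) (ζ j)).det) * volume V := by
  obtain ⟨i, T, comp_eq⟩ := exists_linearIsometry_comp_eq_linParam hζ
  have image_eq : linParam ζ '' V = i '' (T '' V) := by
    simp only [image_image, comp_eq]
  have gram_det := det_gram_linearIsometry_comp i T
  simp only [comp_eq, linParam_single] at gram_det
  rw [image_eq, i.isometry.euclideanHausdorffMeasure_image,
    EuclideanSpace.euclideanHausdorffMeasure_eq_volume, Measure.addHaar_image_continuousLinearMap,
    gram_det, Real.sqrt_sq_eq_abs]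

end LinearImage

theorem lintegral_weightedDilation {ι : Type*} [Fintype ι] (k : ι → ℕ) {r : ℝ} (hr : 0 < r)
    {S : Set (EuclideanSpace ℝ ι)} (hS : MeasurableSet S) (f : EuclideanSpace ℝ ι → ℝ≥0∞) :
    ∫⁻ s in S, f s = ENNReal.ofReal (r ^ ∑ i, k i) *
      ∫⁻ s in weightedDilation k r ⁻¹' S, f (weightedDilation k r s) := by
  have injective : Function.Injective (weightedDilation k r) :=
    Function.LeftInverse.injective (weightedDilation_one_div_weightedDilation k hr.ne')
  have surjective : Function.Surjective (weightedDilation k r) :=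
    Function.RightInverse.surjective (weightedDilation_weightedDilation_one_div k hr.ne')
  rw [← image_preimage_eq S surjective, lintegral_image_eq_lintegral_abs_det_fderiv_mul volume
    ((weightedDilation k r).continuous.measurable hS)
    (fun s _ => (weightedDilation k r).hasFDerivWithinAt) injective.injOn,
    det_weightedDilation, abs_of_pos (pow_pos hr _),
    lintegral_const_mul' _ _ ENNReal.ofReal_ne_top, image_preimage_eq S surjective]

/-! ### Balls of a homogeneous distance in linear coordinates -/

namespace HomogeneousDistance

variable {G : Type*} [NormedAddCommGroup G] [InnerProductSpace ℝ G] [FiniteDimensional ℝ G]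
  [StratifiedGroup G] (ρ : HomogeneousDistance G) {ι : Type*} [Fintype ι] {k : ι → ℕ} {ζ : ι → G}

/-- The trace of the ball of centre `0` and radius `r` on the span of the family `ζ`, read in the
coordinates given by `ζ`. -/
def coordBall (ζ : ι → G) (r : ℝ) : Set (EuclideanSpace ℝ ι) := linParam ζ ⁻¹' ρ.ball 0 r

theorem isOpen_coordBall (ζ : ι → G) (r : ℝ) : IsOpen (ρ.coordBall ζ r) :=
  (ρ.isOpen_ball 0 r).preimage (linParam ζ).continuous

theorem weightedDilation_preimage_coordBall (hζ : ∀ i, ζ i ∈ layer (G := G) (k i)) {r : ℝ}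
    (hr : 0 < r) : weightedDilation k r ⁻¹' ρ.coordBall ζ r = ρ.coordBall ζ 1 := by
  ext s
  change ρ.d 0 (linParam ζ (weightedDilation k r s)) < r ↔ ρ.d 0 (linParam ζ s) < 1
  rw [← dilation_linParam hζ, ρ.d_zero_dilation hr, mul_lt_iff_lt_one_right hr]

theorem volume_coordBall (hζ : ∀ i, ζ i ∈ layer (G := G) (k i)) {r : ℝ} (hr : 0 < r) :
    volume (ρ.coordBall ζ r) =
      ENNReal.ofReal (r ^ ∑ i, k i) * volume (ρ.coordBall ζ 1) := by
  have change_of_variables :=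
    lintegral_weightedDilation k hr (ρ.isOpen_coordBall ζ r).measurableSet fun _ => 1
  rwa [setLIntegral_one, setLIntegral_one, ρ.weightedDilation_preimage_coordBall hζ hr]
    at change_of_variables

theorem volume_coordBall_one_ne_top (hζ : LinearIndependent ℝ ζ) :
    volume (ρ.coordBall ζ 1) ≠ ⊤ := by
  obtain ⟨C, -, norm_le⟩ := ρ.exists_norm_le
  have ker_eq_bot : (linParam ζ).toLinearMap.ker = ⊥ := by
    refine LinearMap.ker_eq_bot'.2 fun s hs => ?_
    ext i
    exact Fintype.linearIndependent_iff.1 hζ s ((linParam_apply ζ s).symm.trans hs) i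
  obtain ⟨K, -, antilipschitz⟩ := (linParam ζ).toLinearMap.exists_antilipschitzWith ker_eq_bot
  refine ((antilipschitz.isBounded_preimage (Metric.isBounded_closedBall (x := 0) (r := C))).subset
    fun s hs => ?_).measure_lt_top.ne
  exact mem_closedBall_zero_iff.2 (norm_le _ (le_of_lt hs))

theorem volume_coordBall_one_pos (ζ : ι → G) : 0 < volume (ρ.coordBall ζ 1) :=
  (ρ.isOpen_coordBall ζ 1).measure_pos _
    ⟨0, by rw [coordBall, mem_preimage, map_zero]; exact ρ.mem_ball_self 0 one_pos⟩

/- The sphere lies in all the larger balls, whose measure tends to that of the open unit ball. -/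
theorem volume_coordSphere (hζ : LinearIndependent ℝ ζ)
    (hk : ∀ i, ζ i ∈ layer (G := G) (k i)) :
    volume {s | ρ.d 0 (linParam ζ s) = 1} = 0 := by
  set S : Set (EuclideanSpace ℝ ι) := {s | ρ.d 0 (linParam ζ s) = 1}
  have volume_add_le (r : ℝ) (hr : 1 < r) : volume S + volume (ρ.coordBall ζ 1) ≤
      ENNReal.ofReal (r ^ ∑ i, k i) * volume (ρ.coordBall ζ 1) := by
    have disjoint : Disjoint S (ρ.coordBall ζ 1) :=
      disjoint_left.2 fun s (hs : _ = _) (hs' : _ < _) => hs'.ne hs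
    have union_subset : S ∪ ρ.coordBall ζ 1 ⊆ ρ.coordBall ζ r :=
      union_subset (fun s (hs : _ = _) => hs.trans_lt hr) fun s (hs : _ < _) => hs.trans hr
    rw [← ρ.volume_coordBall hk (one_pos.trans hr),
      ← measure_union disjoint (ρ.isOpen_coordBall ζ 1).measurableSet]
    exact measure_mono union_subset
  have volume_ne_top := ρ.volume_coordBall_one_ne_top hζ
  have ofReal_tendsto : Tendsto (fun r : ℝ => ENNReal.ofReal (r ^ ∑ i, k i)) (𝓝[>] 1) (𝓝 1) := by
    have pow_continuous : Continuous fun r : ℝ => ENNReal.ofReal (r ^ ∑ i, k i) :=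
      ENNReal.continuous_ofReal.comp (by fun_prop)
    simpa using (pow_continuous.tendsto 1).mono_left nhdsWithin_le_nhds
  have volume_add_le_one_mul := ge_of_tendsto
    (ENNReal.Tendsto.mul_const ofReal_tendsto (Or.inr volume_ne_top))
    (eventually_mem_nhdsWithin.mono volume_add_le)
  rw [one_mul] at volume_add_le_one_mul
  exact nonpos_iff_eq_zero.1 <| (ENNReal.add_le_add_iff_right volume_ne_top).1 <|
    volume_add_le_one_mul.trans_eq (zero_add _).symm

theorem metricFactor_ιMulti [MeasurableSpace G] [BorelSpace G] {n p : ℕ} (b : GradedBasis G n)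
    {ζ : Fin p → G} (hζ : LinearIndependent ℝ ζ) :
    metricFactor ρ (exteriorPower.ιMulti ℝ p ζ) =
      ENNReal.ofReal (b.pnorm (exteriorPower.ιMulti ℝ p ζ)) * volume (ρ.coordBall ζ 1) := by
  rw [metricFactor, assocSubspace_ιMulti hζ, ← range_linParam, b.pnorm_ιMulti,
    ← euclideanHausdorffMeasure_linParam_image hζ, coordBall, image_preimage_eq_range_inter]

end HomogeneousDistance

/-! ### The surface measure of small balls -/

theorem IsC1Param.eventually_surfaceMeasure_inter_ball {G : Type*} [NormedAddCommGroup G]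
    [InnerProductSpace ℝ G] [FiniteDimensional ℝ G] [StratifiedGroup G] [MeasurableSpace G]
    [BorelSpace G] (ρ : HomogeneousDistance G) (gt : SmoothRiemannianMetric G) {p : ℕ}
    {M : Set G} {A : Set (EuclideanSpace ℝ (Fin p))} {Φ : EuclideanSpace ℝ (Fin p) → G}
    (h : IsC1Param M A Φ) {t₀ : EuclideanSpace ℝ (Fin p)} (ht₀ : t₀ ∈ A) :
    ∀ᶠ r in 𝓝[>] (0 : ℝ), surfaceMeasure gt p M (M ∩ ρ.ball (Φ t₀) r) =
      ∫⁻ t in A ∩ Φ ⁻¹' ρ.ball (Φ t₀) r, ENNReal.ofReal (surfaceDensity gt Φ t) := by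
  obtain ⟨U, hU, image_eq⟩ := h.image_eq
  have center_mem : Φ t₀ ∈ U := (image_eq.le (mem_image_of_mem Φ ht₀)).2
  obtain ⟨r₀, r₀_pos, ball_subset⟩ := ρ.exists_ball_subset (hU.mem_nhds center_mem)
  filter_upwards [Ioo_mem_nhdsGT r₀_pos] with r hr
  have ball_subset_U : ρ.ball (Φ t₀) r ⊆ U := fun y (hy : _ < _) => ball_subset (hy.trans hr.2)
  have inter_ball_eq : M ∩ ρ.ball (Φ t₀) r = Φ '' A ∩ ρ.ball (Φ t₀) r := by
    rw [image_eq, inter_assoc, inter_eq_self_of_subset_right ball_subset_U]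
  have measurable_inter : MeasurableSet (M ∩ ρ.ball (Φ t₀) r) := by
    rw [inter_ball_eq]
    exact (h.isOpen.measurableSet.image_of_continuousOn_injOn h.continuousOn h.injOn).inter
      (ρ.isOpen_ball _ r).measurableSet
  have domain_eq : A ∩ Φ ⁻¹' (M ∩ ρ.ball (Φ t₀) r) = A ∩ Φ ⁻¹' ρ.ball (Φ t₀) r :=
    Subset.antisymm (fun t ht => ⟨ht.1, ht.2.2⟩)
      fun t ht => ⟨ht.1, h.image_subset (mem_image_of_mem Φ ht.1), ht.2⟩
  rw [h.surfaceMeasure_apply gt hU image_eq measurable_inter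
    (inter_subset_right.trans ball_subset_U), h.paramMeasure_apply gt measurable_inter, domain_eq]

namespace GradedBasis

variable {G : Type*} [NormedAddCommGroup G] [InnerProductSpace ℝ G] [FiniteDimensional ℝ G]
  [StratifiedGroup G] {n p : ℕ} {b : GradedBasis G n} {α : Set.powersetCard (Fin n) p}
  {w : Fin p → G} {M : Set G} {x : G} {B : Set (EuclideanSpace ℝ (Fin p))}
  {Ψ : EuclideanSpace ℝ (Fin p) → G} (ρ : HomogeneousDistance G)

theorem mem_ball_iff_d_zero_rescaled_lt {r : ℝ} (hr : 0 < r) (s : EuclideanSpace ℝ (Fin p)) :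
    Ψ (b.stretch α r s) ∈ ρ.ball x r ↔ ρ.d 0 (b.rescaled α x Ψ r s) < 1 := by
  rw [rescaled, ρ.d_zero_dilation (by positivity), one_div_mul_eq_div, div_lt_one hr,
    ← ρ.d_eq_d_zero_inv_mul]
  rfl

/-- The pull-back of the part of a graph lying in the ball of centre `x` and radius `r` under the
anisotropic stretching of the parameter space. -/
def rescaledDomain (b : GradedBasis G n) (α : Set.powersetCard (Fin n) p) (x : G)
    (B : Set (EuclideanSpace ℝ (Fin p))) (Ψ : EuclideanSpace ℝ (Fin p) → G) (r : ℝ) :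
    Set (EuclideanSpace ℝ (Fin p)) :=
  b.stretch α r ⁻¹' (B ∩ Ψ ⁻¹' ρ.ball x r)

/-- The density with respect to the stretched parameters of the surface measure of a graph inside
the ball of centre `x` and radius `r`, divided by the Jacobian of the stretching. -/
noncomputable def rescaledDensity (b : GradedBasis G n) (α : Set.powersetCard (Fin n) p) (x : G)
    (gt : SmoothRiemannianMetric G) (B : Set (EuclideanSpace ℝ (Fin p)))
    (Ψ : EuclideanSpace ℝ (Fin p) → G) (r : ℝ) : EuclideanSpace ℝ (Fin p) → ℝ≥0∞ :=
  (b.rescaledDomain ρ α x B Ψ r).indicator fun s =>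
    ENNReal.ofReal (surfaceDensity gt Ψ (b.stretch α r s))

namespace IsGraphParam

variable (h : b.IsGraphParam M x α w B Ψ) (gt : SmoothRiemannianMetric G)
include h

theorem isOpen_rescaledDomain (r : ℝ) : IsOpen (b.rescaledDomain ρ α x B Ψ r) :=
  (h.param.continuousOn.isOpen_inter_preimage h.param.isOpen (ρ.isOpen_ball x r)).preimage
    (b.stretch α r).continuous

theorem eventually_mem_rescaledDomain {s : EuclideanSpace ℝ (Fin p)}
    (hs : ρ.d 0 (linParam (b.topPart α w) s) < 1) :
    ∀ᶠ r in 𝓝[>] (0 : ℝ), s ∈ b.rescaledDomain ρ α x B Ψ r := by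
  filter_upwards [eventually_mem_nhdsWithin, h.eventually_stretch_mem ‖s‖,
    h.eventually_rescaled_mem_of_isOpen
      (isOpen_lt (ρ.continuous_d_right 0) continuous_const) hs] with r hr stretch_mem rescaled_mem
  exact ⟨stretch_mem s le_rfl, (mem_ball_iff_d_zero_rescaled_lt ρ hr s).2 rescaled_mem⟩

theorem eventually_notMem_rescaledDomain {s : EuclideanSpace ℝ (Fin p)}
    (hs : 1 < ρ.d 0 (linParam (b.topPart α w) s)) :
    ∀ᶠ r in 𝓝[>] (0 : ℝ), s ∉ b.rescaledDomain ρ α x B Ψ r := by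
  filter_upwards [eventually_mem_nhdsWithin, h.eventually_rescaled_mem_of_isOpen
    (isOpen_lt continuous_const (ρ.continuous_d_right 0)) hs] with r hr rescaled_mem s_mem
  exact lt_asymm rescaled_mem ((mem_ball_iff_d_zero_rescaled_lt ρ hr s).1 s_mem.2)

theorem exists_norm_le_of_mem_rescaledDomain :
    ∃ R, ∀ r > 0, ∀ s ∈ b.rescaledDomain ρ α x B Ψ r, ‖s‖ ≤ R := by
  obtain ⟨C, -, norm_le⟩ := ρ.exists_norm_le
  refine ⟨‖b.coords α‖ * C, fun r hr s hs => ?_⟩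
  rw [← h.coords_rescaled hr.ne' hs.1]
  exact (b.coords α).le_of_opNorm_le_of_le le_rfl
    (norm_le _ ((mem_ball_iff_d_zero_rescaled_lt ρ hr s).1 hs.2).le)

theorem measurable_rescaledDensity (r : ℝ) :
    Measurable (b.rescaledDensity ρ α x gt B Ψ r) := by
  classical
  rw [rescaledDensity, ← piecewise_eq_indicator]
  refine ContinuousOn.measurable_piecewise ?_ continuousOn_const
    (h.isOpen_rescaledDomain ρ r).measurableSet
  exact ENNReal.continuous_ofReal.comp_continuousOn
    ((h.param.continuousOn_surfaceDensity gt).comp (b.stretch α r).continuous.continuousOn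
      fun s hs => hs.1)

theorem eventually_rescaledDensity_le :
    ∃ R, ∀ᶠ r in 𝓝[>] (0 : ℝ), ∀ s, b.rescaledDensity ρ α x gt B Ψ r s ≤
      (Metric.closedBall 0 R).indicator
        (fun _ => ENNReal.ofReal (surfaceDensity gt Ψ 0 + 1)) s := by
  obtain ⟨R, norm_le⟩ := h.exists_norm_le_of_mem_rescaledDomain ρ
  have density_lt : ∀ᶠ s in 𝓝 0, surfaceDensity gt Ψ s < surfaceDensity gt Ψ 0 + 1 :=
    (h.param.continuousAt_surfaceDensity gt h.zero_mem).eventually_lt_const (lt_add_one _)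
  refine ⟨R, ?_⟩
  filter_upwards [eventually_mem_nhdsWithin,
    eventually_weightedDilation_mem (fun i => b.deg_pos (enum α i)) density_lt R]
    with r hr density_stretch_lt
  refine indicator_le fun s hs => ?_
  rw [indicator_of_mem (mem_closedBall_zero_iff.2 (norm_le r hr s hs))]
  exact ENNReal.ofReal_le_ofReal (density_stretch_lt s (norm_le r hr s hs)).le

theorem tendsto_rescaledDensity {s : EuclideanSpace ℝ (Fin p)}
    (hs : ρ.d 0 (linParam (b.topPart α w) s) ≠ 1) :
    Tendsto (fun r => b.rescaledDensity ρ α x gt B Ψ r s) (𝓝[>] 0)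
      (𝓝 ((ρ.coordBall (b.topPart α w) 1).indicator
        (fun _ => ENNReal.ofReal (surfaceDensity gt Ψ 0)) s)) := by
  rcases hs.lt_or_gt with inside | outside
  · rw [indicator_of_mem (show s ∈ ρ.coordBall (b.topPart α w) 1 from inside)]
    have stretch_tendsto : Tendsto (fun r => b.stretch α r s) (𝓝[>] 0) (𝓝 0) :=
      tendsto_weightedDilation_nhdsGT_zero (fun i => b.deg_pos (enum α i)) s
    refine ((ENNReal.continuous_ofReal.tendsto _).comp
      ((h.param.continuousAt_surfaceDensity gt h.zero_mem).tendsto.comp stretch_tendsto)).congr' ?_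
    filter_upwards [h.eventually_mem_rescaledDomain ρ inside] with r s_mem
    rw [rescaledDensity, indicator_of_mem s_mem]
    rfl
  · rw [indicator_of_notMem (show s ∉ ρ.coordBall (b.topPart α w) 1 from outside.not_gt)]
    refine tendsto_const_nhds.congr' ?_
    filter_upwards [h.eventually_notMem_rescaledDomain ρ outside] with r s_notMem
    rw [rescaledDensity, indicator_of_notMem s_notMem]

theorem tendsto_lintegral_rescaledDensity :
    Tendsto (fun r => ∫⁻ s, b.rescaledDensity ρ α x gt B Ψ r s) (𝓝[>] 0)
      (𝓝 (ENNReal.ofReal (surfaceDensity gt Ψ 0) *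
        volume (ρ.coordBall (b.topPart α w) 1))) := by
  obtain ⟨R, density_le⟩ := h.eventually_rescaledDensity_le ρ gt
  have limit_eq : ∫⁻ s, (ρ.coordBall (b.topPart α w) 1).indicator
      (fun _ => ENNReal.ofReal (surfaceDensity gt Ψ 0)) s =
      ENNReal.ofReal (surfaceDensity gt Ψ 0) * volume (ρ.coordBall (b.topPart α w) 1) := by
    rw [lintegral_indicator (ρ.isOpen_coordBall _ 1).measurableSet, setLIntegral_const]
  rw [← limit_eq]
  refine tendsto_lintegral_filter_of_dominated_convergence _
    (Eventually.of_forall (h.measurable_rescaledDensity ρ gt))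
    (density_le.mono fun r hr => Eventually.of_forall hr) ?_ ?_
  · rw [lintegral_indicator Metric.isClosed_closedBall.measurableSet, setLIntegral_const]
    exact ENNReal.mul_ne_top ENNReal.ofReal_ne_top measure_closedBall_lt_top.ne
  · filter_upwards [compl_mem_ae_iff.2 (ρ.volume_coordSphere
      h.adapted.linearIndependent_topPart (b.topPart_mem_layer α w))] with s hs
    exact h.tendsto_rescaledDensity ρ gt hs

variable [MeasurableSpace G] [BorelSpace G]

theorem eventually_surfaceMeasure_div_eq :
    ∀ᶠ r in 𝓝[>] (0 : ℝ),
      surfaceMeasure gt p M (M ∩ ρ.ball x r) / ENNReal.ofReal (r ^ b.maxDim p) =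
        ∫⁻ s, b.rescaledDensity ρ α x gt B Ψ r s := by
  have surfaceMeasure_eq := h.param.eventually_surfaceMeasure_inter_ball ρ gt h.zero_mem
  rw [h.map_zero] at surfaceMeasure_eq
  filter_upwards [eventually_mem_nhdsWithin, surfaceMeasure_eq] with r hr surfaceMeasure_eq
  have jacobian_pos : 0 < r ^ b.maxDim p := pow_pos hr _
  rw [surfaceMeasure_eq, lintegral_weightedDilation _ hr
    (h.param.measurableSet_inter_preimage (ρ.isOpen_ball x r).measurableSet),
    ← b.multiDeg_eq_sum, h.adapted.multiDeg_eq, mul_comm,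
    ENNReal.mul_div_cancel_right (ENNReal.ofReal_pos.2 jacobian_pos).ne' ENNReal.ofReal_ne_top,
    rescaledDensity, lintegral_indicator (h.isOpen_rescaledDomain ρ r).measurableSet]
  rfl

theorem tendsto_surfaceMeasure_ball :
    Tendsto (fun r => surfaceMeasure gt p M (M ∩ ρ.ball x r) / ENNReal.ofReal (r ^ b.maxDim p))
      (𝓝[>] 0) (𝓝 (ENNReal.ofReal (surfaceDensity gt Ψ 0) *
        volume (ρ.coordBall (b.topPart α w) 1))) :=
  (h.tendsto_lintegral_rescaledDensity ρ gt).congr'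
    ((h.eventually_surfaceMeasure_div_eq ρ gt).mono fun _ hr => hr.symm)

end IsGraphParam

end GradedBasis

/-! ### Hausdorff dimension of sets carrying a regular measure -/

section Ahlfors

open scoped NNReal

variable {X : Type*} [MetricSpace X] [MeasurableSpace X] [BorelSpace X] {S : Set X} {μ : Measure X}
  {D : ℕ} {c : ℝ≥0∞}

omit [BorelSpace X] in
theorem measure_le_ediam_pow_mul (hc : c ≠ ⊤) (hS : μ Sᶜ = 0)
    (hμ : ∀ y ∈ S, ∀ r : ℝ, 0 < r → μ (Metric.ball y r) = ENNReal.ofReal (r ^ D) * c)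
    {T : Set X} (hT : Metric.ediam T ≠ ⊤) : μ T ≤ Metric.ediam T ^ D * c := by
  rcases (T ∩ S).eq_empty_or_nonempty with disjoint | ⟨y, hyT, hyS⟩
  · have T_subset : T ⊆ Sᶜ := fun z hz hzS => disjoint.subset ⟨hz, hzS⟩
    simp [measure_mono_null T_subset hS]
  set δ := (Metric.ediam T).toReal
  have measure_le (r : ℝ) (hr : δ < r) : μ T ≤ ENNReal.ofReal (r ^ D) * c := by
    rw [← hμ y hyS r (ENNReal.toReal_nonneg.trans_lt hr)]
    refine measure_mono fun z hz => ?_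
    rw [Metric.mem_ball, dist_edist]
    exact (ENNReal.toReal_mono hT (Metric.edist_le_ediam_of_mem hz hyT)).trans_lt hr
  have pow_continuous : Continuous fun r : ℝ => ENNReal.ofReal (r ^ D) :=
    ENNReal.continuous_ofReal.comp (by fun_prop)
  have tendsto_pow_mul : Tendsto (fun r : ℝ => ENNReal.ofReal (r ^ D) * c) (𝓝[>] δ)
      (𝓝 (ENNReal.ofReal (δ ^ D) * c)) :=
    ENNReal.Tendsto.mul_const ((pow_continuous.tendsto δ).mono_left nhdsWithin_le_nhds)
      (Or.inr hc)
  have limit_le := ge_of_tendsto tendsto_pow_mul (eventually_mem_nhdsWithin.mono measure_le)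
  rwa [ENNReal.ofReal_pow ENNReal.toReal_nonneg, ENNReal.ofReal_toReal hT] at limit_le

theorem natCast_le_dimH_of_measure_ball (hc0 : c ≠ 0) (hc : c ≠ ⊤) (hS : μ Sᶜ = 0)
    (hne : S.Nonempty)
    (hμ : ∀ y ∈ S, ∀ r : ℝ, 0 < r → μ (Metric.ball y r) = ENNReal.ofReal (r ^ D) * c) :
    (D : ℝ≥0∞) ≤ dimH S := by
  have measure_le_hausdorffMeasure : c⁻¹ • μ ≤ μH[((D : ℝ≥0) : ℝ)] := by
    refine Measure.le_hausdorffMeasure _ _ 1 one_pos fun T hT => ?_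
    have hT : Metric.ediam T ≠ ⊤ := ne_top_of_le_ne_top ENNReal.one_ne_top hT
    rw [Measure.smul_apply, smul_eq_mul, NNReal.coe_natCast, ENNReal.rpow_natCast, mul_comm,
      ← div_eq_mul_inv]
    exact ENNReal.div_le_of_le_mul (measure_le_ediam_pow_mul hc hS hμ hT)
  have measure_ne_zero : μ S ≠ 0 := by
    obtain ⟨y, hy⟩ := hne
    intro measure_eq_zero
    have measure_univ : μ univ = 0 := by
      rw [← union_compl_self S]
      exact measure_union_null measure_eq_zero hS
    have measure_ball := hμ y hy 1 one_pos
    rw [measure_mono_null (subset_univ _) measure_univ] at measure_ball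
    simp [hc0.symm] at measure_ball
  have hausdorffMeasure_ne_zero : μH[((D : ℝ≥0) : ℝ)] S ≠ 0 := fun eq_zero => by
    have measure_le := measure_le_hausdorffMeasure S
    rw [eq_zero, Measure.smul_apply, smul_eq_mul] at measure_le
    simp [measure_ne_zero, hc] at measure_le
  exact_mod_cast le_dimH_of_hausdorffMeasure_ne_zero hausdorffMeasure_ne_zero

theorem encard_mul_le_of_isSeparated (hc0 : c ≠ 0) (hc : c ≠ ⊤)
    (hμ : ∀ y ∈ S, ∀ r : ℝ, 0 < r → μ (Metric.ball y r) = ENNReal.ofReal (r ^ D) * c)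
    {y₀ : X} (hy₀ : y₀ ∈ S) {R : ℝ} (hR : 0 < R) {ε : ℝ≥0} (hε : 0 < ε) (hε1 : ε ≤ 1)
    {C : Set X} (hCS : C ⊆ S ∩ Metric.ball y₀ R) (hC : Metric.IsSeparated ε C) :
    (C.encard : ℝ≥0∞) * ENNReal.ofReal ((ε / 2 : ℝ) ^ D) ≤ ENNReal.ofReal ((R + 1) ^ D) := by
  have balls_disjoint :
      Pairwise (Function.onFun Disjoint fun z : C => Metric.ball (z : X) (ε / 2)) := by
    intro z z' z_ne
    refine Metric.ball_disjoint_ball ?_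
    have lt_edist : (ε : ℝ≥0∞) < edist (z : X) z' := hC z.2 z'.2 (Subtype.coe_ne_coe.2 z_ne)
    rw [edist_nndist, ENNReal.coe_lt_coe] at lt_edist
    rw [add_halves]
    exact lt_edist.le
  have balls_subset : ⋃ z : C, Metric.ball (z : X) (ε / 2) ⊆ Metric.ball y₀ (R + 1) :=
    iUnion_subset fun z => Metric.ball_subset_ball' <| by
      linarith [Metric.mem_ball.1 (hCS z.2).2, NNReal.coe_le_one.2 hε1, ε.coe_nonneg]
  have measure_small_ball (z : C) :
      μ (Metric.ball (z : X) (ε / 2)) = ENNReal.ofReal ((ε / 2 : ℝ) ^ D) * c :=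
    hμ z (hCS z.2).1 _ (by positivity)
  rw [← ENNReal.mul_le_mul_iff_left hc0 hc, mul_assoc, ← hμ y₀ hy₀ (R + 1) (by linarith)]
  calc (C.encard : ℝ≥0∞) * (ENNReal.ofReal ((ε / 2 : ℝ) ^ D) * c)
      = ∑' z : C, μ (Metric.ball (z : X) (ε / 2)) := by
        simp only [measure_small_ball, ENNReal.tsum_const]
        rfl
    _ ≤ μ (⋃ z : C, Metric.ball (z : X) (ε / 2)) :=
        tsum_meas_le_meas_iUnion_of_disjoint μ (fun _ => measurableSet_ball) balls_disjoint
    _ ≤ μ (Metric.ball y₀ (R + 1)) := measure_mono balls_subset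

theorem coveringNumber_mul_le_of_measure_ball (hc0 : c ≠ 0) (hc : c ≠ ⊤)
    (hμ : ∀ y ∈ S, ∀ r : ℝ, 0 < r → μ (Metric.ball y r) = ENNReal.ofReal (r ^ D) * c)
    {y₀ : X} (hy₀ : y₀ ∈ S) {R : ℝ} (hR : 0 < R) {ε : ℝ≥0} (hε : 0 < ε) (hε1 : ε ≤ 1) :
    (Metric.coveringNumber ε (S ∩ Metric.ball y₀ R) : ℝ≥0∞) * (2 * ε) ^ D ≤
      ENNReal.ofReal ((4 * (R + 1)) ^ D) := by
  have half_pow_ne_zero : ENNReal.ofReal ((ε / 2 : ℝ) ^ D) ≠ 0 :=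
    (ENNReal.ofReal_pos.2 (pow_pos (half_pos hε) D)).ne'
  have packingNumber_le : (Metric.packingNumber ε (S ∩ Metric.ball y₀ R) : ℝ≥0∞) ≤
      ENNReal.ofReal ((R + 1) ^ D) / ENNReal.ofReal ((ε / 2 : ℝ) ^ D) := by
    simp only [Metric.packingNumber, ENat.toENNReal_iSup]
    refine iSup_le fun C => iSup_le fun hCS => iSup_le fun hC => ?_
    rw [ENNReal.le_div_iff_mul_le (Or.inl half_pow_ne_zero) (Or.inl ENNReal.ofReal_ne_top)]
    exact encard_mul_le_of_isSeparated hc0 hc hμ hy₀ hR hε hε1 hCS hC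
  have two_mul_pow : (2 * ε : ℝ≥0∞) ^ D = ENNReal.ofReal ((2 * ε : ℝ) ^ D) := by
    rw [ENNReal.ofReal_pow (by positivity), ENNReal.ofReal_mul zero_le_two,
      ENNReal.ofReal_coe_nnreal, ENNReal.ofReal_ofNat]
  calc (Metric.coveringNumber ε (S ∩ Metric.ball y₀ R) : ℝ≥0∞) * (2 * ε) ^ D
      ≤ ENNReal.ofReal ((R + 1) ^ D) / ENNReal.ofReal ((ε / 2 : ℝ) ^ D) * (2 * ε) ^ D := by
        gcongr
        exact (ENat.toENNReal_le.2 (Metric.coveringNumber_le_packingNumber _ _)).trans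
          packingNumber_le
    _ = ENNReal.ofReal ((4 * (R + 1)) ^ D) := by
        rw [two_mul_pow, ← ENNReal.ofReal_div_of_pos (by positivity),
          ← ENNReal.ofReal_mul (by positivity), ← div_pow, ← mul_pow]
        congr 2
        field_simp
        ring

end Ahlfors

theorem exists_finset_cover_sum_ediam_pow_le {X : Type*} [MetricSpace X] {T : Set X} {D : ℕ}
    {K : ℝ≥0∞} (hK : K ≠ ⊤) {ε : NNReal} (hε : 0 < ε)
    (hT : (Metric.coveringNumber ε T : ℝ≥0∞) * (2 * ε) ^ D ≤ K) :
    ∃ C : Finset X, T ⊆ ⋃ z : C, Metric.closedEBall (z : X) ε ∧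
      ∑ z : C, Metric.ediam (Metric.closedEBall (z : X) ε) ^ D ≤ K := by
  have coveringNumber_ne_top : Metric.coveringNumber ε T ≠ ⊤ := fun eq_top => by
    rw [eq_top, ENat.toENNReal_top, ENNReal.top_mul (by simp [hε.ne'])] at hT
    exact hK (top_le_iff.1 hT)
  obtain ⟨C, _, C_finite, C_cover, C_card⟩ :=
    Metric.exists_set_encard_eq_coveringNumber coveringNumber_ne_top
  lift C to Finset X using C_finite
  refine ⟨C, ?_, ?_⟩
  · exact (Metric.isCover_iff_subset_iUnion_closedEBall.1 C_cover).trans <|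
      iUnion₂_subset fun z hz => subset_iUnion_of_subset ⟨z, hz⟩ subset_rfl
  calc ∑ z : C, Metric.ediam (Metric.closedEBall (z : X) ε) ^ D
      ≤ ∑ _z : C, (2 * ε : ℝ≥0∞) ^ D := by
        gcongr
        exact Metric.ediam_closedEBall_le
    _ = (Metric.coveringNumber ε T : ℝ≥0∞) * (2 * ε) ^ D := by
        rw [Finset.sum_const, nsmul_eq_mul, Finset.card_univ, ← C_card,
          Set.encard_coe_eq_coe_finsetCard, ENat.toENNReal_coe, Fintype.card_coe]
    _ ≤ K := hT

theorem dimH_le_natCast_of_coveringNumber_mul_le {X : Type*} [MetricSpace X] {T : Set X} {D : ℕ}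
    {K : ℝ≥0∞} (hK : K ≠ ⊤)
    (hT : ∀ ε : NNReal, 0 < ε → ε ≤ 1 → (Metric.coveringNumber ε T : ℝ≥0∞) * (2 * ε) ^ D ≤ K) :
    dimH T ≤ D := by
  borelize X
  let ε : ℕ → NNReal := fun m => 1 / ((m : NNReal) + 1)
  have ε_pos (m) : 0 < ε m := by positivity
  have ε_le_one (m) : ε m ≤ 1 := div_le_one_of_le₀ (by simp) (by positivity)
  choose C cover_subset sum_le using fun m =>
    exists_finset_cover_sum_ediam_pow_le hK (ε_pos m) (hT (ε m) (ε_pos m) (ε_le_one m))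
  have radius_tendsto : Tendsto (fun m => 2 * (ε m : ℝ≥0∞)) atTop (𝓝 0) := by
    have ε_tendsto : Tendsto ε atTop (𝓝 0) := tendsto_one_div_add_atTop_nhds_zero_nat
    simpa using ENNReal.Tendsto.const_mul (ENNReal.tendsto_coe.2 ε_tendsto)
      (Or.inr ENNReal.ofNat_ne_top)
  have hausdorffMeasure_le : μH[((D : NNReal) : ℝ)] T ≤ K :=
    calc μH[((D : NNReal) : ℝ)] T
        ≤ liminf (fun m => ∑ z : C m, Metric.ediam (Metric.closedEBall (z : X) (ε m)) ^
            ((D : NNReal) : ℝ)) atTop :=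
          Measure.hausdorffMeasure_le_liminf_sum _ T _ radius_tendsto _
            (Eventually.of_forall fun _ _ => Metric.ediam_closedEBall_le)
            (Eventually.of_forall cover_subset)
      _ ≤ liminf (fun _ : ℕ => K) atTop := liminf_le_liminf <| Eventually.of_forall fun m => by
          simpa only [NNReal.coe_natCast, ENNReal.rpow_natCast] using sum_le m
      _ = K := liminf_const K
  exact_mod_cast dimH_le_of_hausdorffMeasure_ne_top (ne_top_of_le_ne_top hK hausdorffMeasure_le)

theorem dimH_le_natCast_of_measure_ball {X : Type*} [MetricSpace X] [MeasurableSpace X]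
    [BorelSpace X] {S : Set X} {μ : Measure X} {D : ℕ} {c : ℝ≥0∞} (hc0 : c ≠ 0) (hc : c ≠ ⊤)
    (hμ : ∀ y ∈ S, ∀ r : ℝ, 0 < r → μ (Metric.ball y r) = ENNReal.ofReal (r ^ D) * c) :
    dimH S ≤ D := by
  rcases S.eq_empty_or_nonempty with rfl | ⟨y₀, hy₀⟩
  · simp
  have S_eq : S = ⋃ k : ℕ, S ∩ Metric.ball y₀ (k + 1) := by
    rw [← inter_iUnion, Metric.iUnion_ball_nat_succ, inter_univ]
  rw [S_eq, dimH_iUnion]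
  exact iSup_le fun k => dimH_le_natCast_of_coveringNumber_mul_le ENNReal.ofReal_ne_top
    fun ε hε hε1 => coveringNumber_mul_le_of_measure_ball hc0 hc hμ hy₀ k.cast_add_one_pos hε hε1

/-! ### Hausdorff dimension of the blow-up subspace -/

namespace GradedBasis

variable {G : Type*} [NormedAddCommGroup G] [InnerProductSpace ℝ G] [StratifiedGroup G]
  {n p : ℕ} (b : GradedBasis G n) (α : Set.powersetCard (Fin n) p) (w : Fin p → G)

/-- The group operation of the span of the top parts of an adapted frame `w`, in the linear
coordinates given by these top parts. -/
noncomputable def coordMul (q : EuclideanSpace ℝ (Fin p) × EuclideanSpace ℝ (Fin p)) :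
    EuclideanSpace ℝ (Fin p) :=
  b.coords α (linParam (b.topPart α w) q.1 * linParam (b.topPart α w) q.2)

namespace IsAdaptedFrame

variable {b α w} (h : b.IsAdaptedFrame α w)
include h

theorem linParam_coordMul (q : EuclideanSpace ℝ (Fin p) × EuclideanSpace ℝ (Fin p)) :
    linParam (b.topPart α w) (b.coordMul α w q) =
      linParam (b.topPart α w) q.1 * linParam (b.topPart α w) q.2 := by
  obtain ⟨P, -, P_eq⟩ := exists_normal_subgroup_coe_eq fun x y hy => h.lie_mem_span x hy
  rw [← range_linParam] at P_eq
  have linParam_mem (s) : linParam (b.topPart α w) s ∈ P := P_eq.ge (mem_range_self s)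
  obtain ⟨s, hs⟩ := P_eq.le (P.mul_mem (linParam_mem q.1) (linParam_mem q.2))
  rw [coordMul, ← hs, h.coords_linParam_topPart]

theorem coordMul_zero (s : EuclideanSpace ℝ (Fin p)) : b.coordMul α w (0, s) = s := by
  rw [coordMul, map_zero, zero_mul_eq_self, h.coords_linParam_topPart]

theorem coordMul_neg_coordMul (a s : EuclideanSpace ℝ (Fin p)) :
    b.coordMul α w (-a, b.coordMul α w (a, s)) = s := by
  rw [coordMul, h.linParam_coordMul, map_neg, ← inv_eq_neg, inv_mul_cancel_left,
    h.coords_linParam_topPart]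

end IsAdaptedFrame

variable [FiniteDimensional ℝ G]

/-- The differential of the left translation by `q.1` at `q.2`, for the operation `coordMul`. -/
noncomputable def coordMulDeriv (q : EuclideanSpace ℝ (Fin p) × EuclideanSpace ℝ (Fin p)) :
    EuclideanSpace ℝ (Fin p) →L[ℝ] EuclideanSpace ℝ (Fin p) :=
  (fderiv ℝ (b.coordMul α w) q).comp (ContinuousLinearMap.inr ℝ _ _)

theorem contDiff_coordMul : ContDiff ℝ 1 (b.coordMul α w) :=
  (b.coords α).contDiff.comp <| StratifiedGroup.contDiff_mul.comp <|
    ((linParam (b.topPart α w)).contDiff.comp contDiff_fst).prodMk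
      ((linParam (b.topPart α w)).contDiff.comp contDiff_snd)

theorem hasFDerivAt_coordMul (a s : EuclideanSpace ℝ (Fin p)) :
    HasFDerivAt (fun s => b.coordMul α w (a, s)) (b.coordMulDeriv α w (a, s)) s :=
  ((b.contDiff_coordMul α w).differentiable one_ne_zero (a, s)).hasFDerivAt.comp s
    (hasFDerivAt_prodMk_right a s)

theorem continuous_det_coordMulDeriv : Continuous fun q => (b.coordMulDeriv α w q).det :=
  ContinuousLinearMap.continuous_det.comp <|
    ((b.contDiff_coordMul α w).continuous_fderiv one_ne_zero).clm_comp continuous_const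

theorem coordMul_stretch (r : ℝ) (a s : EuclideanSpace ℝ (Fin p)) :
    b.coordMul α w (b.stretch α r a, b.stretch α r s) =
      b.stretch α r (b.coordMul α w (a, s)) := by
  simp only [coordMul, ← dilation_linParam (b.topPart_mem_layer α w), ← dilation_mul,
    b.coords_dilation]

theorem det_coordMulDeriv_stretch {r : ℝ} (hr : r ≠ 0) (a s : EuclideanSpace ℝ (Fin p)) :
    (b.coordMulDeriv α w (b.stretch α r a, b.stretch α r s)).det =
      (b.coordMulDeriv α w (a, s)).det := by
  have deriv_stretch_right : HasFDerivAt
      (fun s => b.coordMul α w (b.stretch α r a, b.stretch α r s))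
      ((b.coordMulDeriv α w (b.stretch α r a, b.stretch α r s)).comp (b.stretch α r)) s :=
    (b.hasFDerivAt_coordMul α w (b.stretch α r a) (b.stretch α r s)).comp s
      (b.stretch α r).hasFDerivAt
  have deriv_stretch_left : HasFDerivAt
      (fun s => b.coordMul α w (b.stretch α r a, b.stretch α r s))
      ((b.stretch α r).comp (b.coordMulDeriv α w (a, s))) s := by
    simp only [coordMul_stretch]
    exact (b.stretch α r).hasFDerivAt.comp s (b.hasFDerivAt_coordMul α w a s)
  have det_eq := congrArg ContinuousLinearMap.det (deriv_stretch_right.unique deriv_stretch_left)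
  have det_stretch_ne_zero : (b.stretch α r).det ≠ 0 := by
    rw [det_weightedDilation]
    exact pow_ne_zero _ hr
  simp only [ContinuousLinearMap.det, ContinuousLinearMap.toLinearMap_comp, LinearMap.det_comp]
    at det_eq det_stretch_ne_zero ⊢
  exact mul_left_cancel₀ det_stretch_ne_zero ((mul_comm _ _).trans det_eq)

namespace IsAdaptedFrame

variable {b α w} (h : b.IsAdaptedFrame α w)
include h

/- The determinant is invariant under the dilations, which contract every point to `0`. -/
theorem det_coordMulDeriv (q : EuclideanSpace ℝ (Fin p) × EuclideanSpace ℝ (Fin p)) :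
    (b.coordMulDeriv α w q).det = 1 := by
  have deriv_zero : b.coordMulDeriv α w (0, 0) = ContinuousLinearMap.id ℝ _ := by
    refine (b.hasFDerivAt_coordMul α w 0 0).unique ?_
    simp only [h.coordMul_zero]
    exact hasFDerivAt_id 0
  have stretch_tendsto (s : EuclideanSpace ℝ (Fin p)) :
      Tendsto (fun r => b.stretch α r s) (𝓝[>] 0) (𝓝 0) :=
    tendsto_weightedDilation_nhdsGT_zero (fun i => b.deg_pos (enum α i)) s
  have det_tendsto : Tendsto
      (fun r : ℝ => (b.coordMulDeriv α w (b.stretch α r q.1, b.stretch α r q.2)).det)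
      (𝓝[>] 0) (𝓝 (b.coordMulDeriv α w (0, 0)).det) :=
    ((b.continuous_det_coordMulDeriv α w).tendsto (0, 0)).comp
      ((stretch_tendsto q.1).prodMk_nhds (stretch_tendsto q.2))
  have det_tendsto_self : Tendsto
      (fun r : ℝ => (b.coordMulDeriv α w (b.stretch α r q.1, b.stretch α r q.2)).det)
      (𝓝[>] 0) (𝓝 (b.coordMulDeriv α w q).det) :=
    tendsto_const_nhds.congr' <| eventually_mem_nhdsWithin.mono fun r hr =>
      (b.det_coordMulDeriv_stretch α w (ne_of_gt hr) q.1 q.2).symm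
  rw [tendsto_nhds_unique det_tendsto_self det_tendsto, deriv_zero]
  simp [ContinuousLinearMap.det]

variable (ρ : HomogeneousDistance G)

theorem linParam_preimage_ball (a : EuclideanSpace ℝ (Fin p)) (r : ℝ) :
    linParam (b.topPart α w) ⁻¹' ρ.ball (linParam (b.topPart α w) a) r =
      (fun s => b.coordMul α w (a, s)) '' ρ.coordBall (b.topPart α w) r := by
  ext s
  constructor
  · intro (hs : ρ.d _ _ < r)
    refine ⟨b.coordMul α w (-a, s), ?_, by simpa using h.coordMul_neg_coordMul (-a) s⟩
    change ρ.d 0 _ < r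
    rwa [h.linParam_coordMul, map_neg, ← inv_eq_neg, ← ρ.d_eq_d_zero_inv_mul]
  · rintro ⟨s, hs, rfl⟩
    change ρ.d _ _ < r
    rw [h.linParam_coordMul, ρ.d_eq_d_zero_inv_mul, inv_mul_cancel_left]
    exact hs

theorem volume_linParam_preimage_ball (a : EuclideanSpace ℝ (Fin p)) {r : ℝ} (hr : 0 < r) :
    volume (linParam (b.topPart α w) ⁻¹' ρ.ball (linParam (b.topPart α w) a) r) =
      ENNReal.ofReal (r ^ b.maxDim p) * volume (ρ.coordBall (b.topPart α w) 1) := by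
  have left_translation_injOn :
      InjOn (fun s => b.coordMul α w (a, s)) (ρ.coordBall (b.topPart α w) r) :=
    (Function.LeftInverse.injective (g := fun s => b.coordMul α w (-a, s))
      (h.coordMul_neg_coordMul a)).injOn
  have area_formula := lintegral_abs_det_fderiv_eq_addHaar_image volume
    (ρ.isOpen_coordBall (b.topPart α w) r).measurableSet
    (fun s _ => (b.hasFDerivAt_coordMul α w a s).hasFDerivWithinAt) left_translation_injOn
  rw [h.linParam_preimage_ball, ← area_formula, ← h.multiDeg_eq, b.multiDeg_eq_sum,
    ← ρ.volume_coordBall (b.topPart_mem_layer α w) hr]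
  simp [h.det_coordMulDeriv]

/- The Lebesgue measure of the subspace is left invariant and homogeneous of degree `D(p)`. -/
theorem dimH_span :
    ρ.dimH (Submodule.span ℝ (range (b.topPart α w)) : Set G) = (b.maxDim p : ℝ≥0∞) := by
  let _ : MeasurableSpace G := borel G
  have borel_norm : BorelSpace G := ⟨rfl⟩
  have borel_ρ : @BorelSpace G ρ.metricSpace.toUniformSpace.toTopologicalSpace _ := by
    rw [ρ.toTopologicalSpace_eq]
    exact borel_norm
  let L := linParam (b.topPart α w)
  rw [← range_linParam]
  have compl_null : volume.map L (range L)ᶜ = 0 := by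
    rw [Measure.map_apply L.measurable (by
      rw [range_linParam]
      exact (Submodule.closed_of_finiteDimensional _).measurableSet.compl)]
    simp
  have measure_ball : ∀ y ∈ range L, ∀ r : ℝ, 0 < r →
      volume.map L (@Metric.ball G ρ.metricSpace.toPseudoMetricSpace y r) =
        ENNReal.ofReal (r ^ b.maxDim p) * volume (ρ.coordBall (b.topPart α w) 1) := by
    rintro _ ⟨a, rfl⟩ r hr
    have ball_eq : @Metric.ball G ρ.metricSpace.toPseudoMetricSpace (L a) r = ρ.ball (L a) r := by
      ext z
      exact iff_of_eq (congrArg (· < r) (ρ.symm z (L a)))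
    rw [ball_eq, Measure.map_apply L.measurable (ρ.isOpen_ball _ _).measurableSet]
    exact h.volume_linParam_preimage_ball ρ a hr
  have volume_ne_zero := (ρ.volume_coordBall_one_pos (b.topPart α w)).ne'
  have volume_ne_top := ρ.volume_coordBall_one_ne_top h.linearIndependent_topPart
  exact le_antisymm
    (@dimH_le_natCast_of_measure_ball G ρ.metricSpace _ borel_ρ _ _ _ _ volume_ne_zero
      volume_ne_top measure_ball)
    (@natCast_le_dimH_of_measure_ball G ρ.metricSpace _ borel_ρ _ _ _ _ volume_ne_zero
      volume_ne_top compl_null (range_nonempty L) measure_ball)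

end IsAdaptedFrame

end GradedBasis

/-! ### Tangent frames at transversal points -/

theorem IsC1Param.isTangentFrame {G : Type*} [NormedAddCommGroup G] [InnerProductSpace ℝ G]
    [FiniteDimensional ℝ G] {p : ℕ} {M : Set G} {A : Set (EuclideanSpace ℝ (Fin p))}
    {Φ : EuclideanSpace ℝ (Fin p) → G} (h : IsC1Param M A Φ) (hp : 1 ≤ p)
    {t₀ : EuclideanSpace ℝ (Fin p)} (ht₀ : t₀ ∈ A) :
    IsTangentFrame M (Φ t₀) fun i => fderiv ℝ Φ t₀ (EuclideanSpace.single i 1) := by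
  let T := (fderiv ℝ Φ t₀).toLinearMap
  let e := (EuclideanSpace.basisFun (Fin p) ℝ).toBasis
  have frame_eq : (fun i => fderiv ℝ Φ t₀ (EuclideanSpace.single i 1)) = T ∘ e := by
    ext i
    simp [T, e]
  rw [IsTangentFrame, h.tangentCone_eq hp ht₀, frame_eq]
  refine ⟨e.linearIndependent.map' T (LinearMap.ker_eq_bot.2 (h.immersion t₀ ht₀)), ?_⟩
  rw [range_comp, Submodule.span_image, e.span_eq, Submodule.map_top]
  rfl

theorem IsTangentFrame.exists_matrix {G : Type*} [NormedAddCommGroup G] [NormedSpace ℝ G] {p : ℕ}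
    {M : Set G} {x : G} {v v' : Fin p → G} (hv : IsTangentFrame M x v)
    (hv' : IsTangentFrame M x v') :
    ∃ A : Matrix (Fin p) (Fin p) ℝ, A.det ≠ 0 ∧ v = fun i => ∑ j, A i j • v' j :=
  exists_matrix_of_forall_mem_span hv.1 fun i =>
    (hv'.2.trans hv.2.symm).ge (Submodule.subset_span (mem_range_self i))

theorem span_range_eq_of_forall_mem_span {K E ι : Type*} [DivisionRing K] [AddCommGroup E]
    [Module K E] [Finite ι] {v w : ι → E} (hw : LinearIndependent K w)
    (h : ∀ i, w i ∈ Submodule.span K (range v)) :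
    Submodule.span K (range w) = Submodule.span K (range v) := by
  cases nonempty_fintype ι
  have : FiniteDimensional K (Submodule.span K (range v)) :=
    FiniteDimensional.span_of_finite K (finite_range v)
  refine Submodule.eq_of_le_of_finrank_le (Submodule.span_le.2 (range_subset_iff.2 h)) ?_
  rw [finrank_span_eq_card hw]
  exact finrank_range_le_card v

section TranslatedPVector

variable {G : Type*} [NormedAddCommGroup G] [InnerProductSpace ℝ G] [StratifiedGroup G] {p : ℕ}
  (x : G)

theorem translatedPVector_sum_smul (A : Matrix (Fin p) (Fin p) ℝ) (v : Fin p → G) :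
    translatedPVector x (fun i => ∑ j, A i j • v j) = A.det • translatedPVector x v := by
  simp only [translatedPVector, ← ιMulti_sum_smul, map_sum, map_smul]

theorem linearIndependent_fderiv_inv_mul [FiniteDimensional ℝ G] {v : Fin p → G}
    (hv : LinearIndependent ℝ v) :
    LinearIndependent ℝ fun i => fderiv ℝ (fun y : G => x⁻¹ * y) x (v i) :=
  hv.map' (fderiv ℝ (fun y : G => x⁻¹ * y) x).toLinearMap
    (LinearMap.ker_eq_bot.2 (injective_fderiv_inv_mul x))

end TranslatedPVector

namespace GradedBasis

variable {G : Type*} [NormedAddCommGroup G] [InnerProductSpace ℝ G] [StratifiedGroup G] {n p : ℕ}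

theorem IsAdaptedFrame.linearIndependent {b : GradedBasis G n} {α : Set.powersetCard (Fin n) p}
    {w : Fin p → G} (h : b.IsAdaptedFrame α w) : LinearIndependent ℝ w := by
  refine Fintype.linearIndependent_iff.2 fun c hc i => ?_
  have coords_eq := b.coords_linParam h.repr_enum (WithLp.toLp 2 c)
  rw [linParam_apply, hc, map_zero] at coords_eq
  exact (congrArg (fun s : EuclideanSpace ℝ (Fin p) => s i) coords_eq).symm

variable [FiniteDimensional ℝ G] (b : GradedBasis G n) {M : Set G} {x : G}

theorem exists_multiDeg_eq_of_isTransversal (hne : ∃ v : Fin p → G, IsTangentFrame M x v)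
    (htr : IsTransversal b p M x) :
    ∃ (v : Fin p → G) (α : Set.powersetCard (Fin n) p), IsTangentFrame M x v ∧
      b.coord (translatedPVector x v) α ≠ 0 ∧ b.multiDeg α = b.maxDim p := by
  obtain ⟨v, hv⟩ := hne
  have translatedPVector_ne_zero : translatedPVector x v ≠ 0 :=
    ιMulti_ne_zero_of_linearIndependent (linearIndependent_fderiv_inv_mul x hv.1)
  obtain ⟨α, hα⟩ : ∃ α, b.coord (translatedPVector x v) α ≠ 0 := by
    by_contra! coord_eq_zero
    exact translatedPVector_ne_zero (b.ext_coord fun α => by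
      rw [coord_eq_zero, coord, map_zero, Finsupp.zero_apply])
  obtain ⟨v', β, hv', hβ, degree_eq⟩ := Nat.sSup_mem
    (s := {N | ∃ (v : Fin p → G) (α : Set.powersetCard (Fin n) p), IsTangentFrame M x v ∧
      b.coord (translatedPVector x v) α ≠ 0 ∧ N = b.multiDeg α})
    ⟨_, v, α, hv, hα, rfl⟩
    ⟨b.maxDim p, by
      rintro _ ⟨-, β, -, -, rfl⟩
      exact b.multiDeg_le_maxDim β⟩
  exact ⟨v', β, hv', hβ, degree_eq.symm.trans htr⟩

theorem exists_isGraphParam_of_isTransversal (hp : 1 ≤ p) (hM : IsC1Submanifold p M) (hx : x ∈ M)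
    (htr : IsTransversal b p M x) : ∃ α w B Ψ, b.IsGraphParam (p := p) M x α w B Ψ := by
  obtain ⟨A, Φ, h, t₀, ht₀, rfl⟩ := hM x hx
  obtain ⟨v, α, hv, hα, deg_eq⟩ :=
    b.exists_multiDeg_eq_of_isTransversal ⟨_, h.isTangentFrame hp ht₀⟩ htr
  obtain ⟨C, -, hw⟩ := b.exists_isAdaptedFrame deg_eq hα
  let T := (fderiv ℝ (fun y : G => (Φ t₀)⁻¹ * y) (Φ t₀)).toLinearMap
  have range_eq : range (T ∘ fderiv ℝ Φ t₀) = Submodule.span ℝ (range (T ∘ v)) := by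
    rw [range_comp, ← h.tangentCone_eq hp ht₀, ← hv.2, range_comp, Submodule.span_image]
    rfl
  refine ⟨α, _, b.exists_isGraphParam h ht₀ hw (range_eq.trans (congrArg _ ?_))⟩
  exact (span_range_eq_of_forall_mem_span hw.linearIndependent fun i =>
    Submodule.sum_mem _ fun j _ => Submodule.smul_mem _ _
      (Submodule.subset_span (mem_range_self j))).symm

namespace IsGraphParam

variable {b} {α : Set.powersetCard (Fin n) p} {w : Fin p → G}
  {B : Set (EuclideanSpace ℝ (Fin p))} {Ψ : EuclideanSpace ℝ (Fin p) → G}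
  (h : b.IsGraphParam M x α w B Ψ)
include h

theorem isTangentFrame (hp : 1 ≤ p) :
    IsTangentFrame M x fun i => fderiv ℝ Ψ 0 (EuclideanSpace.single i 1) := by
  simpa only [h.map_zero] using h.param.isTangentFrame hp h.zero_mem

theorem fderiv_inv_mul_fderiv (i : Fin p) :
    fderiv ℝ (fun y : G => x⁻¹ * y) x (fderiv ℝ Ψ 0 (EuclideanSpace.single i 1)) = w i := by
  have deriv_comp := h.param.hasFDerivAt_inv_mul h.zero_mem
  rw [h.map_zero] at deriv_comp
  rw [← linParam_single (ζ := w) i, ← deriv_comp.unique h.hasFDerivAt]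
  rfl

theorem exists_smul_eq (hp : 1 ≤ p) (gt : SmoothRiemannianMetric G) {v : Fin p → G}
    (hv : IsTangentFrame M x v) :
    ∃ c : ℝ, c ≠ 0 ∧ riemNorm gt x v = |c| * surfaceDensity gt Ψ 0 ∧
      b.proj (b.maxDim p) (translatedPVector x v) =
        c • exteriorPower.ιMulti ℝ p (b.topPart α w) := by
  obtain ⟨A, det_ne_zero, rfl⟩ := hv.exists_matrix (h.isTangentFrame hp)
  refine ⟨A.det, det_ne_zero, ?_, ?_⟩
  · rw [riemNorm_sum_smul, surfaceDensity, h.map_zero]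
  · rw [translatedPVector_sum_smul, proj_smul, translatedPVector]
    simp only [h.fderiv_inv_mul_fderiv]
    rw [h.adapted.proj_ιMulti]

theorem blowUpSubspace_eq (hp : 1 ≤ p) (gt : SmoothRiemannianMetric G) {v : Fin p → G}
    (hv : IsTangentFrame M x v) :
    blowUpSubspace b x v = Submodule.span ℝ (range (b.topPart α w)) := by
  obtain ⟨c, hc, -, proj_eq⟩ := h.exists_smul_eq hp gt hv
  rw [blowUpSubspace, proj_eq, assocSubspace_smul hc,
    assocSubspace_ιMulti h.adapted.linearIndependent_topPart]

theorem surfaceDensity_pos (hp : 1 ≤ p) (gt : SmoothRiemannianMetric G) :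
    0 < surfaceDensity gt Ψ 0 := by
  rw [surfaceDensity, h.map_zero]
  exact riemNorm_pos gt x (h.isTangentFrame hp).1

theorem pnorm_proj_unitTangent (hp : 1 ≤ p) (gt : SmoothRiemannianMetric G) {v : Fin p → G}
    (hv : IsTangentFrame M x v) :
    b.pnorm (b.proj (b.maxDim p) (unitTangent gt x v)) =
      b.pnorm (exteriorPower.ιMulti ℝ p (b.topPart α w)) / surfaceDensity gt Ψ 0 := by
  obtain ⟨c, hc, norm_eq, proj_eq⟩ := h.exists_smul_eq hp gt hv
  rw [unitTangent, proj_smul, proj_eq, pnorm_smul, pnorm_smul, norm_eq, abs_inv, abs_mul, abs_abs,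
    abs_of_pos (h.surfaceDensity_pos hp gt), mul_inv, mul_comm |c|⁻¹, mul_assoc,
    inv_mul_cancel_left₀ (abs_ne_zero.2 hc), ← div_eq_inv_mul]

theorem metricFactor_div_eq [MeasurableSpace G] [BorelSpace G] (ρ : HomogeneousDistance G)
    (hp : 1 ≤ p) (gt : SmoothRiemannianMetric G) {v : Fin p → G} (hv : IsTangentFrame M x v) :
    metricFactor ρ (b.proj (b.maxDim p) (translatedPVector x v)) /
        ENNReal.ofReal (b.pnorm (b.proj (b.maxDim p) (unitTangent gt x v))) =
      ENNReal.ofReal (surfaceDensity gt Ψ 0) * volume (ρ.coordBall (b.topPart α w) 1) := by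
  set τ := exteriorPower.ιMulti ℝ p (b.topPart α w) with τ_def
  have topPart_independent := h.adapted.linearIndependent_topPart
  have metricFactor_eq : metricFactor ρ (b.proj (b.maxDim p) (translatedPVector x v)) =
      ENNReal.ofReal (b.pnorm τ) * volume (ρ.coordBall (b.topPart α w) 1) := by
    obtain ⟨c, hc, -, proj_eq⟩ := h.exists_smul_eq hp gt hv
    rw [← ρ.metricFactor_ιMulti b topPart_independent, metricFactor, metricFactor, proj_eq,
      assocSubspace_smul hc]
  have ofReal_pnorm_ne_zero : ENNReal.ofReal (b.pnorm τ) ≠ 0 :=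
    (ENNReal.ofReal_pos.2 (b.pnorm_pos
      (ιMulti_ne_zero_of_linearIndependent topPart_independent))).ne'
  have density_pos := h.surfaceDensity_pos hp gt
  rw [metricFactor_eq, h.pnorm_proj_unitTangent hp gt hv, ← τ_def,
    ENNReal.ofReal_div_of_pos density_pos, ENNReal.div_eq_inv_mul,
    ENNReal.inv_div (Or.inl ENNReal.ofReal_ne_top) (Or.inl (ENNReal.ofReal_pos.2 density_pos).ne'),
    ← mul_assoc, ENNReal.div_mul_cancel ofReal_pnorm_ne_zero ENNReal.ofReal_ne_top]

end IsGraphParam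

theorem dilation_mem_span_topPart {α : Set.powersetCard (Fin n) p} {w : Fin p → G} (r : ℝ) {y : G}
    (hy : y ∈ Submodule.span ℝ (range (b.topPart α w))) :
    dilation r y ∈ Submodule.span ℝ (range (b.topPart α w)) := by
  rw [← SetLike.mem_coe, ← range_linParam] at hy ⊢
  obtain ⟨s, rfl⟩ := hy
  exact ⟨_, (dilation_linParam (b.topPart_mem_layer α w) r s).symm⟩

end GradedBasis

theorem theorem1p1 {G : Type*} [NormedAddCommGroup G] [InnerProductSpace ℝ G]
    [FiniteDimensional ℝ G] [MeasurableSpace G] [BorelSpace G] [StratifiedGroup G]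
    {n p : ℕ} (hp : 1 ≤ p) (b : GradedBasis G n) (ρ : HomogeneousDistance G)
    (gt : SmoothRiemannianMetric G) (M : Set G) (hM : IsC1Submanifold p M)
    (x : G) (hx : x ∈ M) (htr : IsTransversal b p M x) :
    -- tangent `p`-vectors exist, and all the claims hold for each of them
    (∃ v : Fin p → G, IsTangentFrame M x v) ∧
    ∀ v : Fin p → G, IsTangentFrame M x v →
      -- `Π` is a `p`-dimensional normal homogeneous subgroup of Hausdorff dimension `D(p)`
      (∃ P : Subgroup G, P.Normal ∧ (P : Set G) = blowUpSubspace b x v) ∧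
      Module.finrank ℝ (blowUpSubspace b x v) = p ∧
      (∀ r : ℝ, 0 < r → ∀ w ∈ blowUpSubspace b x v, dilation r w ∈ blowUpSubspace b x v) ∧
      ρ.dimH (blowUpSubspace b x v : Set G) = (b.maxDim p : ℝ≥0∞) ∧
      -- it has the form `Z ⊕ H_{ℓ+1} ⊕ ⋯ ⊕ H_ι` with `Z ⊆ H_ℓ`
      (∃ (l : ℕ) (Z : Submodule ℝ G), Z ≤ StratifiedGroup.layer l ∧ Z ≠ ⊥ ∧
        blowUpSubspace b x v = Z ⊔ ⨆ j > l, StratifiedGroup.layer (G := G) j) ∧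
      -- convergence of the blow-ups, on every compact neighbourhood of the origin
      (∀ F : Set G, IsCompact F → F ∈ 𝓝 (0 : G) →
        (∀ᶠ r in 𝓝[>] (0 : ℝ), IsCompact (F ∩ blowUp M x r)) ∧
        (∀ ε : ℝ, 0 < ε → ∀ᶠ r in 𝓝[>] (0 : ℝ),
          (∀ z ∈ F ∩ blowUp M x r, ∃ w ∈ F ∩ (blowUpSubspace b x v : Set G), ρ.d z w < ε) ∧
          (∀ w ∈ F ∩ (blowUpSubspace b x v : Set G), ∃ z ∈ blowUp M x r, ρ.d w z < ε)) ∧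
        (F ∩ (blowUpSubspace b x v : Set G) ⊆
            closure (interior F ∩ (blowUpSubspace b x v : Set G)) →
          Tendsto (fun r : ℝ => ρ.hausdorffEDist (F ∩ blowUp M x r)
            (F ∩ (blowUpSubspace b x v : Set G))) (𝓝[>] 0) (𝓝 0))) ∧
      -- the density of the Riemannian surface measure
      Tendsto (fun r : ℝ => surfaceMeasure gt p M (M ∩ ρ.ball x r) /
          ENNReal.ofReal (r ^ b.maxDim p)) (𝓝[>] 0)
        (𝓝 (metricFactor ρ (b.proj (b.maxDim p) (translatedPVector x v)) /
          ENNReal.ofReal (b.pnorm (b.proj (b.maxDim p) (unitTangent gt x v))))) := by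
  obtain ⟨α, w, B, Ψ, h⟩ := b.exists_isGraphParam_of_isTransversal hp hM hx htr
  refine ⟨⟨_, h.isTangentFrame hp⟩, fun v hv => ?_⟩
  rw [h.metricFactor_div_eq ρ hp gt hv, h.blowUpSubspace_eq hp gt hv]
  exact ⟨exists_normal_subgroup_coe_eq fun _ _ hy => h.adapted.lie_mem_span _ hy,
    h.adapted.finrank_span,
    fun r _ _ hy => b.dilation_mem_span_topPart r hy,
    h.adapted.dimH_span ρ,
    h.adapted.exists_layer_decomposition hp,
    fun F hF _ => ⟨h.eventually_isCompact hF, fun ε hε =>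
      (h.eventually_exists_mem_span ρ hF hε).and (h.eventually_exists_mem_blowUp ρ hF hε),
      h.tendsto_hausdorffEDist ρ hF⟩,
    h.tendsto_surfaceMeasure_ball ρ gt⟩
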